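/- Work on the real RAM: unit-cost arithmetic ($+,-,\times,/,\sqrt{\ }$) and comparison of real numbers, addition, subtraction and comparison of indices, conversion of an index to a real number, and indirect addressing. A *direction* is a unit vector in the plane; it points *upwards* if its second coordinate is positive. For $n \ge 3$ let $k = \lfloor n/\lfloor\log_2 n\rfloor^2\rfloor$. Let $\mathcal D=\prod_{i=1}^n\mathcal D_i$, where the $\mathcal D_i$ are continuous distributions in the plane (probability measures that give every line mass $0$), and write $P=(p_1,\dots,p_n)\sim\mathcal D$ for a random input of $n$ independent points $p_i\sim\mathcal D_i$. For a finite planar point set $P$ and a direction $v$, let $e_v$ be the lexicographically smallest point of $P$ that maximizes $\langle p,v\rangle$ over $p\in P$. A point of $P$ is *extremal* if it lies on the upper hull of $P$, that is, if no point of the convex hull of $P$ lies vertically above it. The *upper semislab* $\mathrm{uss}(p,q)$ is the open region bounded by the segment $\overline{pq}$ and the upward vertical rays from $p$ and $q$ (empty if $p$ and $q$ have the same $x$-coordinate). There are absolute constants $C,c$ and one real RAM program, which does not depend on $n$ or on the distributions, such that for every $n\ge 3$ there is a number $m(n)\le C\log^c n$ with the following properties. Given $n$ and any $m(n)$ inputs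 of $n$ points each, the program halts after at most $C\,n\log^c n$ steps and outputs $k$ upward directions $v_1,\dots,v_k$ in strictly clockwise order. Moreover, for all continuous $\mathcal D_1,\dots,\mathcal D_n$, if the $m(n)$ inputs are drawn independently from $\mathcal D$, then with probability at least $1-n^{-4}$ over these inputs $$\mathbf E_{P\sim\mathcal D}\Bigl[\sum_{i=0}^{k} X_i\log(Y_i+1)\Bigr]\le C\,n\log\log n .$$ Here $v_0=(-1,0)$, $v_{k+1}=(1,0)$ and $e_i=e_{v_i}$ (so $e_0$ and $e_{k+1}$ are the leftmost and the rightmost point of $P$), $X_i$ is the number of points of $P$ in $\mathrm{uss}(e_i,e_{i+1})$, and $Y_i$ is the number of extremal points of $P$ in $\mathrm{uss}(e_i,e_{i+1})$. -/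

import Mathlib

open MeasureTheory

/-! ### A real RAM with a step count -/

namespace RealRAM

/-- A store has index registers and real registers (addressed by constants of the program), a
memory of naturals and a memory of reals (both addressed indirectly through index registers). -/
structure Store where
  ireg : ℕ → ℕ
  rreg : ℕ → ℝ
  imem : ℕ → ℕ
  rmem : ℕ → ℝ

/-- The unit-cost instructions. The first argument is the target; there is no rounding of reals
to integers and no multiplication or bit operation on indices. -/
inductive Instr where
  | iconst (d c : ℕ)
  | iadd (d a b : ℕ)
  | isub (d a b : ℕ)
  | iload (d a : ℕ)
  | istore (a s : ℕ)
  | rcast (d a : ℕ)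
  | radd (d a b : ℕ)
  | rsub (d a b : ℕ)
  | rmul (d a b : ℕ)
  | rdiv (d a b : ℕ)
  | rsqrt (d a : ℕ)
  | rload (d a : ℕ)
  | rstore (a s : ℕ)

/-- The effect of an instruction. Index subtraction is truncated; a quotient by zero and the
square root of a negative number have the value zero. -/
noncomputable def Instr.eval : Instr → Store → Store
  | .iconst d c, s => { s with ireg := Function.update s.ireg d c }
  | .iadd d a b, s => { s with ireg := Function.update s.ireg d (s.ireg a + s.ireg b) }
  | .isub d a b, s => { s with ireg := Function.update s.ireg d (s.ireg a - s.ireg b) }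
  | .iload d a, s => { s with ireg := Function.update s.ireg d (s.imem (s.ireg a)) }
  | .istore a r, s => { s with imem := Function.update s.imem (s.ireg a) (s.ireg r) }
  | .rcast d a, s => { s with rreg := Function.update s.rreg d (s.ireg a : ℝ) }
  | .radd d a b, s => { s with rreg := Function.update s.rreg d (s.rreg a + s.rreg b) }
  | .rsub d a b, s => { s with rreg := Function.update s.rreg d (s.rreg a - s.rreg b) }
  | .rmul d a b, s => { s with rreg := Function.update s.rreg d (s.rreg a * s.rreg b) }
  | .rdiv d a b, s => { s with rreg := Function.update s.rreg d (s.rreg a / s.rreg b) }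
  | .rsqrt d a, s => { s with rreg := Function.update s.rreg d (Real.sqrt (s.rreg a)) }
  | .rload d a, s => { s with rreg := Function.update s.rreg d (s.rmem (s.ireg a)) }
  | .rstore a r, s => { s with rmem := Function.update s.rmem (s.ireg a) (s.rreg r) }

/-- Tests: strict comparison of two index registers or of two real registers. -/
inductive Test where
  | ilt (a b : ℕ)
  | rlt (a b : ℕ)

def Test.Holds : Test → Store → Prop
  | .ilt a b, s => s.ireg a < s.ireg b
  | .rlt a b, s => s.rreg a < s.rreg b

/-- Programs: finite control flow over the instructions. -/
inductive Prog where
  | skip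
  | instr (i : Instr)
  | seq (p q : Prog)
  | branch (b : Test) (p q : Prog)
  | loop (b : Test) (p : Prog)

/-- `Exec p s s' t`: started in the store `s`, the program `p` halts in the store `s'` after
exactly `t` steps, where every executed instruction and every evaluated test is one step. -/
inductive Exec : Prog → Store → Store → ℕ → Prop where
  | skip (s : Store) : Exec .skip s s 0
  | instr (i : Instr) (s : Store) : Exec (.instr i) s (i.eval s) 1
  | seq {p q : Prog} {s s' s'' : Store} {t u : ℕ} :
      Exec p s s' t → Exec q s' s'' u → Exec (.seq p q) s s'' (t + u)
  | branch_true {b : Test} {p q : Prog} {s s' : Store} {t : ℕ} :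
      b.Holds s → Exec p s s' t → Exec (.branch b p q) s s' (1 + t)
  | branch_false {b : Test} {p q : Prog} {s s' : Store} {t : ℕ} :
      ¬ b.Holds s → Exec q s s' t → Exec (.branch b p q) s s' (1 + t)
  | loop_true {b : Test} {p : Prog} {s s' s'' : Store} {t u : ℕ} :
      b.Holds s → Exec p s s' t → Exec (.loop b p) s' s'' u → Exec (.loop b p) s s'' (1 + t + u)
  | loop_false {b : Test} {p : Prog} {s : Store} :
      ¬ b.Holds s → Exec (.loop b p) s s 1

/-- The initial store for `m` point sets of `n` points each: index register `0` holds `n`, point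
`i` of point set `a` is stored at the real addresses `2 * (a * n + i)` and `2 * (a * n + i) + 1`,
and everything else is zero. -/
noncomputable def initStore {m n : ℕ} (S : Fin m → Fin n → ℝ × ℝ) : Store where
  ireg := fun r => if r = 0 then n else 0
  rreg := fun _ => 0
  imem := fun _ => 0
  rmem := fun x =>
    if h : x / 2 / n < m ∧ x / 2 % n < n then
      let p := S ⟨x / 2 / n, h.1⟩ ⟨x / 2 % n, h.2⟩
      if x % 2 = 0 then p.1 else p.2
    else 0

/-- On the point sets `S`, the program `p` halts after at most `T` steps with output `v`: index
register `0` holds the length `k`, and the vectors are stored consecutively from real address `0`. -/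
def OutputsWithin (p : Prog) {m n k : ℕ} (S : Fin m → Fin n → ℝ × ℝ) (v : Fin k → ℝ × ℝ)
    (T : ℝ) : Prop :=
  ∃ (s : Store) (t : ℕ), Exec p (initStore S) s t ∧ (t : ℝ) ≤ T ∧ s.ireg 0 = k ∧
    ∀ i : Fin k, s.rmem (2 * (i : ℕ)) = (v i).1 ∧ s.rmem (2 * (i : ℕ) + 1) = (v i).2

end RealRAM

/-! ### Directions, extremal points and semislabs -/

namespace CanonicalHull

/-- The scalar product in the plane. -/
def dot (p v : ℝ × ℝ) : ℝ := p.1 * v.1 + p.2 * v.2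

/-- A unit vector that points upwards. -/
def IsUpwardDirection (v : ℝ × ℝ) : Prop := v.1 ^ 2 + v.2 ^ 2 = 1 ∧ 0 < v.2

/-- A finite sequence of upward directions in strictly clockwise order. -/
def IsDirectionSequence {k : ℕ} (v : Fin k → ℝ × ℝ) : Prop :=
  (∀ i, IsUpwardDirection (v i)) ∧
    ∀ i j, i < j → (v i).1 * (v j).2 - (v i).2 * (v j).1 < 0

/-- `v` preceded by the leftward and followed by the rightward direction. -/
def withHorizontals {k : ℕ} (v : Fin k → ℝ × ℝ) : Fin (k + 2) → ℝ × ℝ :=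
  Fin.snoc (α := fun _ => ℝ × ℝ) (Fin.cons (α := fun _ => ℝ × ℝ) (-1, 0) v) (1, 0)

open Classical in
/-- The lexicographically smallest point of `P` that maximizes the scalar product with `v`
(the value `0` is only taken if `P` has no points). -/
noncomputable def extremalPoint {n : ℕ} (P : Fin n → ℝ × ℝ) (v : ℝ × ℝ) : ℝ × ℝ :=
  let F : Finset (ℝ ×ₗ ℝ) :=
    (Finset.univ.image fun j => toLex (P j)).filter fun q => ∀ j, dot (P j) v ≤ dot (ofLex q) v
  if h : F.Nonempty then ofLex (F.min' h) else 0

/-- The open region above the segment `pq`, between the vertical lines through `p` and `q`; it is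
empty if these lines coincide. -/
def upperSemislab (p q : ℝ × ℝ) : Set (ℝ × ℝ) :=
  {r | p.1 ≠ q.1 ∧ ∃ s ∈ openSegment ℝ p q, s.1 = r.1 ∧ s.2 < r.2}

/-- The upper hull: the points of the convex hull with no point of the convex hull above them. -/
def upperHull {n : ℕ} (P : Fin n → ℝ × ℝ) : Set (ℝ × ℝ) :=
  {p | p ∈ convexHull ℝ (Set.range P) ∧
    ∀ z ∈ convexHull ℝ (Set.range P), z.1 = p.1 → z.2 ≤ p.2}

/-- The number of points of `P` in the region `R`. -/
noncomputable def pointCount {n : ℕ} (P : Fin n → ℝ × ℝ) (R : Set (ℝ × ℝ)) : ℕ :=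
  Nat.card {j : Fin n // P j ∈ R}

/-- The number of extremal points of `P` in the region `R`. -/
noncomputable def extremalCount {n : ℕ} (P : Fin n → ℝ × ℝ) (R : Set (ℝ × ℝ)) : ℕ :=
  Nat.card {j : Fin n // P j ∈ R ∧ P j ∈ upperHull P}

/-- The sum of `X_i * log (Y_i + 1)` over the semislabs between consecutive extremal points for
the extended direction sequence. -/
noncomputable def semislabCost {n k : ℕ} (v : Fin k → ℝ × ℝ) (P : Fin n → ℝ × ℝ) : ℝ :=
  ∑ i : Fin (k + 1),
    let R := upperSemislab (extremalPoint P (withHorizontals v i.castSucc))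
      (extremalPoint P (withHorizontals v i.succ))
    (pointCount P R : ℝ) * Real.log (extremalCount P R + 1)

/-- A continuous planar distribution: a probability measure for which all lines are null sets. -/
structure IsContinuousDistribution (μ : Measure (ℝ × ℝ)) : Prop where
  isProbabilityMeasure : IsProbabilityMeasure μ
  line_null : ∀ a b c : ℝ, (a, b) ≠ (0, 0) → μ {p | a * p.1 + b * p.2 = c} = 0

/-- The number `n / log² n` of directions, with the binary logarithm and the quotient both rounded
down. -/
def numDirections (n : ℕ) : ℕ := n / Nat.log 2 n ^ 2

end CanonicalHull

/-! Let L be the rounded binary logarithm of n. The inputs are read as L^2 groups of L^6 + 1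
samples. The model has no source of randomness, so the coins for thinning are extracted from the
inputs themselves. Sample 0 of a group supplies the points; point i is retained if, among its copies
in samples 1, …, L^6, the first copy has the strictly largest first coordinate. The copies are
exchangeable and almost surely have no ties, so this happens with probability exactly 1/L^6,
independently of the copy in sample 0 (`pi_retains`). The program computes the upper hull of each
thinned sample, pools the slopes of all hull edges, and outputs the corresponding normal directions,
padded to the required number. A thinned sample has about n/L^6 points, so with high probability all
pooled slopes fit into the output.

The slabs have disjoint x-ranges, so the X_i sum to at most n, and it suffices that every Y_i is
polylogarithmic (`semislabCost_le`). The geometric core is `extremalCount_slab_le`. Between two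
consecutive output slopes each thinned sample b has a single maximizer r_b (`Chain.breaks`). An
extremal point p of the slab has a supporting line whose slope lies in this interval. The region
above that line is covered, apart from irrelevant vertical boundaries, by a right and a left
half-plane at p that contain no input point and are determined by at most three input points
(`exists_avoided_half`). If some thinned sample b also avoids both, then r_b does not lie above the
supporting line, so p is not below the parallel line through r_b. Hence p lies in one of two
half-planes at r_b that are avoided by the thinned sample b. If every such half-plane contains few
points of P, the slab has few extremal points.

Two estimates make this work for all half-planes at once. Half-planes at p that are empty of P carry
mass less than 12L except with small probability (`pi_avoid_le`), so a single thinned sample hits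
them with probability at most 12L/L^6, and it is very unlikely that all L^2 independent ones do
(`pi_missEvent_le`). A half-plane avoided by a thinned sample carries mass less than 12L · L^6
except with small probability, so by a Chernoff bound it contains fewer than 36L^7 points of P
(`pi_crowdEvent_le`). Only polynomially many half-planes occur, so a union bound applies.

By Fubini and Markov, for all but a fraction n^{-4} of the inputs the bad event has conditional
probability at most 1/n over P (`pi_failure_le`). There the trivial bound n log(n+1) on the cost
contributes only log(n+1). Inputs with L < 64 are absorbed into the constant.

The running time is certified with a small program logic: a potential rule for loops, weakest
preconditions for loop-free code, and syntactic frame rules. -/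

namespace RealRAM

/-! ### Reasoning about programs -/

/-- From `s`, the program halts within `T` steps in a store that satisfies `Q`. -/
def Runs (p : Prog) (s : Store) (T : ℕ) (Q : Store → Prop) : Prop :=
  ∃ s' t, Exec p s s' t ∧ t ≤ T ∧ Q s'

theorem Runs.mono {p : Prog} {s : Store} {T T' : ℕ} {Q Q' : Store → Prop} (h : Runs p s T Q)
    (hT : T ≤ T') (hQ : ∀ s', Q s' → Q' s') : Runs p s T' Q' := by
  obtain ⟨s', t, he, ht, hq⟩ := h
  exact ⟨s', t, he, ht.trans hT, hQ _ hq⟩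

theorem Runs.seq {p q : Prog} {s : Store} {T U : ℕ} {Q : Store → Prop}
    (h : Runs p s T fun s' => Runs q s' U Q) : Runs (.seq p q) s (T + U) Q := by
  obtain ⟨s', t, he, ht, s'', u, he', hu, hq⟩ := h
  exact ⟨s'', t + u, .seq he he', by omega, hq⟩

theorem Runs.branch {b : Test} {p q : Prog} {s : Store} {T : ℕ} {Q : Store → Prop}
    (h : b.Holds s → Runs p s T Q) (h' : ¬ b.Holds s → Runs q s T Q) :
    Runs (.branch b p q) s (T + 1) Q := by
  by_cases hb : b.Holds s
  · obtain ⟨s', t, he, ht, hq⟩ := h hb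
    exact ⟨s', 1 + t, .branch_true hb he, by omega, hq⟩
  · obtain ⟨s', t, he, ht, hq⟩ := h' hb
    exact ⟨s', 1 + t, .branch_false hb he, by omega, hq⟩

/-- The loop rule with a potential `Φ` that pays for all steps. -/
theorem Runs.loop {b : Test} {p : Prog} {s : Store} {Q : Store → Prop} (I : Store → Prop)
    (Φ : Store → ℕ) (h0 : I s)
    (hstep : ∀ s, I s → b.Holds s →
      ∃ T, Runs p s T fun s' => I s' ∧ T + 1 + Φ s' ≤ Φ s)
    (hexit : ∀ s, I s → ¬ b.Holds s → Q s) : Runs (.loop b p) s (Φ s + 1) Q := by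
  induction hN : Φ s using Nat.strong_induction_on generalizing s with
  | _ N ih =>
    by_cases hb : b.Holds s
    · obtain ⟨T, s', t, he, ht, hI, hΦ⟩ := hstep s h0 hb
      obtain ⟨s'', u, he', hu, hq⟩ := ih (Φ s') (by omega) hI rfl
      exact ⟨s'', 1 + t + u, .loop_true hb he he', by omega, hq⟩
    · exact ⟨s, 1, .loop_false hb, by omega, hexit s h0 hb⟩

/-- The loop rule with a bound `T` for one round and a bound `μ` for the number of rounds. -/
theorem Runs.loop_const {b : Test} {p : Prog} {s : Store} {Q : Store → Prop} (I : Store → Prop)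
    (μ : Store → ℕ) (T : ℕ) (h0 : I s)
    (hstep : ∀ s, I s → b.Holds s → Runs p s T fun s' => I s' ∧ μ s' < μ s)
    (hexit : ∀ s, I s → ¬ b.Holds s → Q s) : Runs (.loop b p) s ((T + 1) * μ s + 1) Q := by
  refine Runs.loop I (fun s => (T + 1) * μ s) h0 (fun s hI hb => ⟨T, ?_⟩) hexit
  refine (hstep s hI hb).mono le_rfl fun s' h => ⟨h.1, ?_⟩
  have := Nat.mul_le_mul_left (T + 1) (Nat.succ_le_of_lt h.2)
  rw [Nat.mul_succ] at this
  omega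

/-- A sequence of instructions. -/
def block : List Instr → Prog
  | [] => .skip
  | i :: l => .seq (.instr i) (block l)

theorem Runs.skip {s : Store} {Q : Store → Prop} (h : Q s) : Runs .skip s 0 Q :=
  ⟨s, 0, .skip s, le_rfl, h⟩

theorem Runs.pad {p : Prog} {s : Store} {T T' : ℕ} {Q : Store → Prop} (hT : T ≤ T')
    (h : Runs p s T Q) : Runs p s T' Q :=
  h.mono hT fun _ => id

/-! ### Loop-free programs -/

/-- The weakest precondition of a loop-free program. -/
def Prog.wp : Prog → (Store → Prop) → Store → Prop
  | .skip, Q, s => Q s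
  | .instr i, Q, s => Q (i.eval s)
  | .seq p q, Q, s => p.wp (q.wp Q) s
  | .branch b p q, Q, s => (b.Holds s → p.wp Q s) ∧ (¬ b.Holds s → q.wp Q s)
  | .loop _ _, _, _ => False

/-- The largest number of steps of a loop-free program. -/
def Prog.cost : Prog → ℕ
  | .skip => 0
  | .instr _ => 1
  | .seq p q => p.cost + q.cost
  | .branch _ p q => max p.cost q.cost + 1
  | .loop _ _ => 0

/-- Straight-line code and branches are verified by unfolding `wp` into a statement about updated
registers. A loop has precondition `False`, so the cost zero that `cost` assigns to it is never
used. -/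
theorem Runs.of_wp {p : Prog} {s : Store} {Q : Store → Prop} (h : p.wp Q s) :
    Runs p s p.cost Q := by
  induction p generalizing s Q with
  | skip => exact Runs.skip h
  | instr i => exact ⟨_, 1, .instr i s, le_rfl, h⟩
  | seq p q ihp ihq => exact Runs.seq ((ihp h).mono le_rfl fun _ h => ihq h)
  | branch b p q ihp ihq =>
    exact Runs.branch (fun hb => (ihp (h.1 hb)).pad (le_max_left _ _))
      fun hb => (ihq (h.2 hb)).pad (le_max_right _ _)
  | loop b p _ => exact h.elim

/-- A loop-free program followed by any program. -/
theorem Runs.wp_seq {p q : Prog} {s : Store} {T : ℕ} {Q : Store → Prop}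
    (h : p.wp (fun s' => Runs q s' T Q) s) : Runs (.seq p q) s (p.cost + T) Q :=
  Runs.seq (Runs.of_wp h)

/-! ### Frame rules -/

def Instr.KeepsI (r : ℕ) : Instr → Prop
  | .iconst d _ | .iadd d _ _ | .isub d _ _ | .iload d _ => r ≠ d
  | _ => True

def Instr.KeepsRmem : Instr → Prop
  | .rstore _ _ => False
  | _ => True

def Instr.KeepsImem : Instr → Prop
  | .istore _ _ => False
  | _ => True

/-- All instructions of the program satisfy `K`. -/
def Prog.All (K : Instr → Prop) : Prog → Prop
  | .skip => True
  | .instr i => K i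
  | .seq p q => p.All K ∧ q.All K
  | .branch _ p q => p.All K ∧ q.All K
  | .loop _ p => p.All K

/-- Reflexivity and transitivity carry the relation through sequences and loops, so the preservation
of a register or a memory needs only a syntactic check of the instructions and no loop invariant. -/
theorem Exec.rel {K : Instr → Prop} {R : Store → Store → Prop} (hrefl : ∀ s, R s s)
    (htrans : ∀ s s' s'', R s s' → R s' s'' → R s s'') (hK : ∀ i s, K i → R s (i.eval s))
    {p : Prog} {s s' : Store} {t : ℕ} (h : Exec p s s' t) (hp : p.All K) : R s s' := by
  induction h with
  | skip s => exact hrefl s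
  | instr i s => exact hK i s hp
  | seq _ _ ih ih' => exact htrans _ _ _ (ih hp.1) (ih' hp.2)
  | branch_true _ _ ih => exact ih hp.1
  | branch_false _ _ ih => exact ih hp.2
  | loop_true _ _ _ ih ih' => exact htrans _ _ _ (ih hp) (ih' hp)
  | loop_false _ => exact hrefl _

theorem Exec.ireg_eq {p : Prog} {s s' : Store} {t r : ℕ} (h : Exec p s s' t)
    (hp : p.All (Instr.KeepsI r)) : s'.ireg r = s.ireg r := by
  refine h.rel (R := fun s s' => s'.ireg r = s.ireg r) (fun _ => rfl)
    (fun _ _ _ h h' => h'.trans h) (fun i s hi => ?_) hp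
  cases i <;> simp_all [Instr.eval, Instr.KeepsI]

theorem Exec.rmem_eq {p : Prog} {s s' : Store} {t : ℕ} (h : Exec p s s' t)
    (hp : p.All Instr.KeepsRmem) : s'.rmem = s.rmem := by
  refine h.rel (R := fun s s' => s'.rmem = s.rmem) (fun _ => rfl)
    (fun _ _ _ h h' => h'.trans h) (fun i s hi => ?_) hp
  cases i <;> simp_all [Instr.eval, Instr.KeepsRmem]

theorem Exec.imem_eq {p : Prog} {s s' : Store} {t : ℕ} (h : Exec p s s' t)
    (hp : p.All Instr.KeepsImem) : s'.imem = s.imem := by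
  refine h.rel (R := fun s s' => s'.imem = s.imem) (fun _ => rfl)
    (fun _ _ _ h h' => h'.trans h) (fun i s hi => ?_) hp
  cases i <;> simp_all [Instr.eval, Instr.KeepsImem]

/-- The postcondition may use every relation between the stores that execution preserves. -/
theorem Runs.frame {p : Prog} {s : Store} {T : ℕ} {Q Q' : Store → Prop} (h : Runs p s T Q)
    (hQ : ∀ s' t, Exec p s s' t → Q s' → Q' s') : Runs p s T Q' := by
  obtain ⟨s', t, he, ht, hq⟩ := h
  exact ⟨s', t, he, ht, hQ _ _ he hq⟩

theorem Test.holds_ilt {a b : ℕ} {s : Store} : (Test.ilt a b).Holds s ↔ s.ireg a < s.ireg b :=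
  Iff.rfl

/-- `d := a * b` for index registers, with the scratch register `c` and the constant one in
register `1`. -/
def mulProg (d a b c : ℕ) : Prog :=
  .seq (block [.iconst c 0, .iconst d 0])
    (.loop (.ilt c b) (block [.iadd d d a, .iadd c c 1]))

/-- Indices can only be added, so a product takes time linear in its second factor. In all uses
below that factor is polylogarithmic. -/
theorem runs_mulProg {d a b c : ℕ} (hda : d ≠ a) (hdb : d ≠ b) (hdc : d ≠ c) (hca : c ≠ a)
    (hcb : c ≠ b) (hd : d ≠ 1) (hc : c ≠ 1) (s : Store) (h1 : s.ireg 1 = 1) :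
    Runs (mulProg d a b c) s (3 * s.ireg b + 3) fun s' =>
      s'.ireg d = s.ireg a * s.ireg b ∧ ∀ r, r ≠ d → r ≠ c → s'.ireg r = s.ireg r := by
  have key : Runs (mulProg d a b c) s (2 + (3 * s.ireg b + 1)) fun s' =>
      s'.ireg d = s.ireg a * s.ireg b := by
    refine Runs.wp_seq ?_
    simp only [block, Prog.wp, Instr.eval]
    refine (Runs.loop_const (fun s' => s'.ireg 1 = 1 ∧ s'.ireg a = s.ireg a ∧
      s'.ireg b = s.ireg b ∧ s'.ireg d = s.ireg a * s'.ireg c ∧ s'.ireg c ≤ s.ireg b)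
      (fun s' => s.ireg b - s'.ireg c) 2 ?_ ?_ ?_).pad ?_
    · simp [Function.update_apply, hd.symm, hc.symm, hda.symm, hdb.symm,
        hca.symm, hcb.symm, h1]
    · rintro s' ⟨e1, ea, eb, ed, hle⟩ hlt
      rw [Test.holds_ilt, eb] at hlt
      refine Runs.of_wp ?_
      simp only [Prog.wp, Instr.eval, Function.update_apply, hdc, hdc.symm, hd.symm,
        hc.symm, hda.symm, hdb.symm, hca.symm, hcb.symm, e1, ea, eb, ed, if_true, if_false]
      exact ⟨⟨trivial, trivial, trivial, by ring, by omega⟩, by omega⟩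
    · rintro s' ⟨e1, ea, eb, ed, hle⟩ hlt
      rw [Test.holds_ilt, eb] at hlt
      rw [ed, show s'.ireg c = s.ireg b by omega]
    · simp only [Function.update_apply]
      split_ifs <;> omega
  refine (key.frame fun s' t he hq => ⟨hq, fun r hrd hrc => ?_⟩).pad (by omega)
  exact he.ireg_eq (by simp [mulProg, block, Prog.All, Instr.KeepsI, hrd, hrc])

end RealRAM

namespace RealRAM

/-! ### Merging sorted segments -/

/-- The contents of the cells `a, …, b - 1`. -/
def cells (f : ℕ → ℕ) (a b : ℕ) : Multiset ℕ := (Finset.Ico a b).val.map f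

theorem cells_self (f : ℕ → ℕ) (a : ℕ) : cells f a a = 0 := by simp [cells]

theorem cells_succ (f : ℕ → ℕ) {a b : ℕ} (h : a ≤ b) : cells f a (b + 1) = f b ::ₘ cells f a b := by
  have : Finset.Ico a (b + 1) = insert b (Finset.Ico a b) := by ext x; simp; omega
  rw [cells, this, Finset.insert_val_of_notMem (by simp), Multiset.map_cons, cells]

theorem cells_append (f : ℕ → ℕ) {a b c : ℕ} (h : a ≤ b) (h' : b ≤ c) :
    cells f a c = cells f a b + cells f b c := by
  induction c, h' using Nat.le_induction with
  | base => simp [cells_self]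
  | succ c hc ih => rw [cells_succ f (h.trans hc), cells_succ f hc, ih, Multiset.add_cons]

theorem cells_congr {f g : ℕ → ℕ} {a b : ℕ} (h : ∀ x, a ≤ x → x < b → f x = g x) :
    cells f a b = cells g a b :=
  Multiset.map_congr rfl fun x hx => by
    have hx := Finset.mem_Ico.1 (Finset.mem_def.2 hx)
    exact h x hx.1 hx.2

theorem cells_shift (f : ℕ → ℕ) (a b M : ℕ) :
    cells f (M + a) (M + b) = cells (fun x => f (M + x)) a b := by
  rcases le_total a b with h | h
  · induction b, h using Nat.le_induction with
    | base => simp [cells_self]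
    | succ b hb ih => rw [← add_assoc, cells_succ _ (by omega), cells_succ _ hb, ih]
  · simp [cells, h]

theorem mem_cells {f : ℕ → ℕ} {a b y : ℕ} : y ∈ cells f a b ↔ ∃ x, a ≤ x ∧ x < b ∧ f x = y := by
  simp [cells, and_assoc]

/-- The cells `a, …, b - 1` are sorted by `key`. -/
def SortedOn (key : ℕ → ℝ) (f : ℕ → ℕ) (a b : ℕ) : Prop :=
  ∀ p q, a ≤ p → p < q → q < b → key (f p) ≤ key (f q)

/-- A state of the merge of the cells `c, …, m - 1` and `m, …, e - 1` of `f` into cells of `g` from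
`M + c` on: the cells `i, …, m - 1` and `j, …, e - 1` have not yet been moved. -/
structure MergeInv (key : ℕ → ℝ) (f g : ℕ → ℕ) (M c m e i j o : ℕ) : Prop where
  le_i : c ≤ i
  i_le : i ≤ m
  le_j : m ≤ j
  j_le : j ≤ e
  out : o + m = M + i + j
  same : ∀ x, x < M + c ∨ o ≤ x → g x = f x
  cells_eq : cells g (M + c) o = cells f c i + cells f m j
  sorted : SortedOn key g (M + c) o
  left : ∀ p q, M + c ≤ p → p < o → i ≤ q → q < m → key (g p) ≤ key (f q)
  right : ∀ p q, M + c ≤ p → p < o → j ≤ q → q < e → key (g p) ≤ key (f q)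

/-- The moved entry heads one of the two remaining segments and its key is minimal among everything
not yet moved; both choices of the merge are instances of this. -/
theorem MergeInv.take {key : ℕ → ℝ} {f g : ℕ → ℕ} {M c m e i j o i' j' y : ℕ}
    (h : MergeInv key f g M c m e i j o) (hi' : i' ≤ m) (hj' : j' ≤ e)
    (hij : i' = i + 1 ∧ j' = j ∧ y = f i ∨ i' = i ∧ j' = j + 1 ∧ y = f j)
    (hl : ∀ q, i ≤ q → q < m → key y ≤ key (f q)) (hr : ∀ q, j ≤ q → q < e → key y ≤ key (f q)) :
    MergeInv key f (Function.update g o y) M c m e i' j' (o + 1) := by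
  obtain ⟨h1, h2, h3, h4, h5, h6, h7, h8, h9, h10⟩ := h
  have hco : M + c ≤ o := by omega
  have hg : ∀ x, x ≠ o → Function.update g o y x = g x := fun x hx => Function.update_of_ne hx _ _
  have hy : key y ≤ key y := le_rfl
  refine ⟨by omega, hi', by omega, hj', by omega, fun x hx => ?_, ?_, fun p q hp hpq hq => ?_,
    fun p q hp hp' hq hq' => ?_, fun p q hp hp' hq hq' => ?_⟩
  · rw [hg x (by omega), h6 x (by omega)]
  · rw [cells_succ _ hco, Function.update_self,
      cells_congr (g := g) fun x _ hx => hg x (by omega), h7]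
    rcases hij with ⟨rfl, rfl, rfl⟩ | ⟨rfl, rfl, rfl⟩
    · rw [cells_succ _ h1, Multiset.cons_add]
    · rw [cells_succ _ h3, Multiset.add_cons]
  · rw [hg p (by omega)]
    rcases eq_or_ne q o with rfl | hqo
    · rw [Function.update_self]
      rcases hij with ⟨rfl, rfl, rfl⟩ | ⟨rfl, rfl, rfl⟩
      · exact h9 p i hp hpq le_rfl (by omega)
      · exact h10 p j hp hpq le_rfl (by omega)
    · rw [hg q hqo]; exact h8 p q hp hpq (by omega)
  · rcases eq_or_ne p o with rfl | hpo
    · rw [Function.update_self]; exact hl q (by omega) hq'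
    · rw [hg p hpo]; exact h9 p q hp (by omega) (by omega) hq'
  · rcases eq_or_ne p o with rfl | hpo
    · rw [Function.update_self]; exact hr q (by omega) hq'
    · rw [hg p hpo]; exact h10 p q hp (by omega) (by omega) hq'

/-- One step of a merge; see `mergeProg`. -/
def mergeStep : Prog :=
  -- Register 11 is a flag: it is set if the next entry comes from the right segment. On equal keys
  -- the left segment is preferred.
  .seq (block [.iconst 11 0])
  (.seq (.branch (.ilt 6 7)
    (.branch (.ilt 8 9)
      (.seq (block [.iload 13 6, .iload 14 8, .rload 0 13, .rload 1 14])
        (.branch (.rlt 1 0) (block [.iconst 11 1]) .skip))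
      .skip)
    (block [.iconst 11 1]))
  (.branch (.ilt 19 11)
    (block [.iload 13 8, .istore 10 13, .iadd 8 8 1, .iadd 10 10 1])
    (block [.iload 13 6, .istore 10 13, .iadd 6 6 1, .iadd 10 10 1])))

/-- Merge the index memory cells from register `6` up to register `7` and those from register `8`
up to register `9`, by the real keys to which they point, into the cells from register `10` up to
register `12`. -/
def mergeProg : Prog := .loop (.ilt 10 12) mergeStep

/-- The hypothesis `heM` places the output behind both input segments, so entries not yet moved are
never overwritten. -/
theorem runs_mergeProg {s : Store} {M c m e : ℕ} (hcm : c ≤ m) (hme : m ≤ e) (heM : e ≤ M + c)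
    (h1 : s.ireg 1 = 1) (h19 : s.ireg 19 = 0) (h6 : s.ireg 6 = c) (h7 : s.ireg 7 = m)
    (h8 : s.ireg 8 = m) (h9 : s.ireg 9 = e) (h10 : s.ireg 10 = M + c) (h12 : s.ireg 12 = M + e)
    (hl : SortedOn s.rmem s.imem c m) (hr : SortedOn s.rmem s.imem m e) :
    Runs mergeProg s (20 * (e - c) + 1) fun s' =>
      (∀ x, x < M + c ∨ M + e ≤ x → s'.imem x = s.imem x) ∧
      cells s'.imem (M + c) (M + e) = cells s.imem c e ∧
      SortedOn s.rmem s'.imem (M + c) (M + e) := by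
  have key := Runs.loop_const (b := .ilt 10 12) (p := mergeStep) (s := s)
    (Q := fun s' => (∀ x, x < M + c ∨ M + e ≤ x → s'.imem x = s.imem x) ∧
      cells s'.imem (M + c) (M + e) = cells s.imem c e ∧
      SortedOn s.rmem s'.imem (M + c) (M + e))
    (fun s' => (s'.ireg 1 = 1 ∧ s'.ireg 19 = 0 ∧ s'.ireg 7 = m ∧ s'.ireg 9 = e ∧
      s'.ireg 12 = M + e ∧ s'.rmem = s.rmem) ∧
      MergeInv s.rmem s.imem s'.imem M c m e (s'.ireg 6) (s'.ireg 8) (s'.ireg 10))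
    (fun s' => M + e - s'.ireg 10) 19 ?_ ?_ ?_
  · refine key.pad ?_
    rw [h10]
    omega
  · refine ⟨⟨h1, h19, h7, h9, h12, rfl⟩, ?_⟩
    rw [h6, h8, h10]
    exact ⟨le_rfl, hcm, le_rfl, hme, by omega, fun _ _ => rfl, by simp [cells_self],
      fun _ _ _ _ _ => by omega, fun _ _ _ _ _ => by omega, fun _ _ _ _ _ => by omega⟩
  · rintro s' ⟨⟨e1, e19, e7, e9, e12, er⟩, hI⟩ hlt
    rw [Test.holds_ilt, e12] at hlt
    have hout := hI.out
    have hsort := hI.sorted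
    have hL : ∀ i j, i ≤ j → c ≤ i → j < m → s.rmem (s.imem i) ≤ s.rmem (s.imem j) := by
      intro i j hij hi hj
      rcases hij.eq_or_lt with rfl | hij
      · exact le_rfl
      · exact hl i j hi hij hj
    have hR : ∀ i j, i ≤ j → m ≤ i → j < e → s.rmem (s.imem i) ≤ s.rmem (s.imem j) := by
      intro i j hij hi hj
      rcases hij.eq_or_lt with rfl | hij
      · exact le_rfl
      · exact hr i j hi hij hj
    have hle_i := hI.le_i
    have hi_le := hI.i_le
    have hle_j := hI.le_j
    have hj_le := hI.j_le
    have takeL : s'.ireg 6 < m → (s'.ireg 8 < e →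
        s.rmem (s.imem (s'.ireg 6)) ≤ s.rmem (s.imem (s'.ireg 8))) →
        MergeInv s.rmem s.imem (Function.update s'.imem (s'.ireg 10) (s'.imem (s'.ireg 6))) M c m e
          (s'.ireg 6 + 1) (s'.ireg 8) (s'.ireg 10 + 1) := by
      intro hi hk
      rw [hI.same (s'.ireg 6) (by omega)]
      exact hI.take hi hI.j_le (.inl ⟨rfl, rfl, rfl⟩) (fun q hq hqm => hL _ _ hq hle_i hqm)
        fun q hq hqe => (hk (by omega)).trans (hR _ _ hq hle_j hqe)
    have takeR : s'.ireg 8 < e → (s'.ireg 6 < m →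
        s.rmem (s.imem (s'.ireg 8)) ≤ s.rmem (s.imem (s'.ireg 6))) →
        MergeInv s.rmem s.imem (Function.update s'.imem (s'.ireg 10) (s'.imem (s'.ireg 8))) M c m e
          (s'.ireg 6) (s'.ireg 8 + 1) (s'.ireg 10 + 1) := by
      intro hj hk
      rw [hI.same (s'.ireg 8) (by omega)]
      exact hI.take hI.i_le hj (.inr ⟨rfl, rfl, rfl⟩)
        (fun q hq hqm => (hk (by omega)).trans (hL _ _ hq hle_i hqm))
        fun q hq hqe => hR _ _ hq hle_j hqe
    have hs6 : s'.ireg 6 < m → s'.imem (s'.ireg 6) = s.imem (s'.ireg 6) :=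
      fun h => hI.same _ (by omega)
    have hs8 : s'.ireg 8 < e → s'.imem (s'.ireg 8) = s.imem (s'.ireg 8) :=
      fun h => hI.same _ (by omega)
    refine Runs.pad (T := mergeStep.cost) (by simp [mergeStep, Prog.cost, block])
      (Runs.of_wp ?_)
    simp [mergeStep, Prog.wp, block, Instr.eval, Test.Holds, e1, e19, e7,
      e9, e12, er]
    refine ⟨fun hi => ⟨fun hj => ⟨fun hk => ⟨takeR hj fun _ => ?_, by omega⟩,
      fun hk => ⟨takeL hi fun _ => ?_, by omega⟩⟩, fun hj => ⟨takeL hi fun h => ?_, by omega⟩⟩,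
      fun hi => ⟨takeR (by omega) fun h => ?_, by omega⟩⟩
    · rw [← hs6 hi, ← hs8 hj]; exact hk.le
    · rw [← hs6 hi, ← hs8 hj]; exact hk
    · omega
    · omega
  · rintro s' ⟨⟨e1, e19, e7, e9, e12, er⟩, hI⟩ hlt
    rw [Test.holds_ilt, e12] at hlt
    have hout := hI.out
    have hi_le := hI.i_le
    have hj_le := hI.j_le
    obtain ⟨hi, hj, ho⟩ : s'.ireg 6 = m ∧ s'.ireg 8 = e ∧ s'.ireg 10 = M + e := by omega
    refine ⟨fun x hx => hI.same x (by omega), ?_, ?_⟩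
    · have := hI.cells_eq
      rw [hi, hj, ho] at this
      rw [this, cells_append _ hcm hme]
    · have := hI.sorted
      rwa [ho] at this

/-! ### Merge sort -/

/-- The cells `0, …, N - 1` are sorted within blocks of length `w`. -/
def BlockSorted (key : ℕ → ℝ) (f : ℕ → ℕ) (w N : ℕ) : Prop :=
  ∀ t, SortedOn key f (t * w) (min ((t + 1) * w) N)

/-- Merge the two blocks of length `ireg 4` from cell `ireg 5` on. -/
def mergeBlocks : Prog :=
  .seq (.seq (block [.iadd 6 5 19, .iadd 7 5 4])
    (.seq (.branch (.ilt 2 7) (block [.iadd 7 2 19]) .skip)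
    (.seq (block [.iadd 8 7 19, .iadd 9 7 4])
    (.seq (.branch (.ilt 2 9) (block [.iadd 9 2 19]) .skip)
      (block [.iadd 10 3 5, .iadd 12 3 9])))))
  (.seq mergeProg (block [.iadd 5 9 19]))

/-- The invariant of a pass of the merge sort. -/
structure PassInv (key : ℕ → ℝ) (f g : ℕ → ℕ) (N M w c : ℕ) : Prop where
  le : c ≤ N
  aligned : (∃ t, c = t * (2 * w)) ∨ c = N
  same : ∀ x, x < M → g x = f x
  cells_eq : cells g M (M + c) = cells f 0 c
  sorted : ∀ t, SortedOn key g (M + t * (2 * w)) (M + min ((t + 1) * (2 * w)) c)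

/-- The boundary moves to the next multiple of 2w, or to N, where the pass stops; so alignment is
available whenever another merge starts. -/
theorem PassInv.merge {key : ℕ → ℝ} {f g g' : ℕ → ℕ} {N M w c e : ℕ}
    (h : PassInv key f g N M w c) (hw : 0 < w) (hNM : N ≤ M) (hc : c < N)
    (he : e = min (c + 2 * w) N) (hsame : ∀ x, x < M + c ∨ M + e ≤ x → g' x = g x)
    (hcells : cells g' (M + c) (M + e) = cells g c e) (hs : SortedOn key g' (M + c) (M + e)) :
    PassInv key f g' N M w e := by
  obtain ⟨h1, h2, h3, h4, h5⟩ := h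
  obtain ⟨t, ht⟩ : ∃ t, c = t * (2 * w) := h2.resolve_right (by omega)
  clear h2
  have ht' : (t + 1) * (2 * w) = c + 2 * w := by rw [ht]; ring
  refine ⟨by omega, ?_, fun x hx => ?_, ?_, fun u => ?_⟩
  · rcases le_total (c + 2 * w) N with h | h
    · exact .inl ⟨t + 1, by omega⟩
    · exact .inr (by omega)
  · rw [hsame x (by omega), h3 x hx]
  · rw [cells_append g' (b := M + c) (by omega) (by omega), hcells,
      cells_append f (b := c) (by omega) (by omega : c ≤ e), ← h4]
    congr 1
    · exact cells_congr fun x _ hx => hsame x (by omega)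
    · exact cells_congr fun x _ hx => h3 x (by omega)
  · rcases lt_trichotomy u t with hu | rfl | hu
    · have h6 : (u + 1) * (2 * w) ≤ t * (2 * w) := Nat.mul_le_mul_right _ hu
      intro p q hp hpq hq
      rw [hsame p (by omega), hsame q (by omega)]
      exact h5 u p q hp hpq (by omega)
    · rw [← ht, ht']
      intro p q hp hpq hq
      exact hs p q hp hpq (by omega)
    · have h6 : (t + 1) * (2 * w) ≤ u * (2 * w) := Nat.mul_le_mul_right _ hu
      intro p q hp hpq hq
      omega

theorem runs_pass {s : Store} {N M w : ℕ} (hw : 0 < w) (hNM : N ≤ M)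
    (h1 : s.ireg 1 = 1) (h19 : s.ireg 19 = 0) (h2 : s.ireg 2 = N) (h3 : s.ireg 3 = M)
    (h4 : s.ireg 4 = w) (h5 : s.ireg 5 = 0) (hs : BlockSorted s.rmem s.imem w N) :
    Runs (.loop (.ilt 5 2) mergeBlocks) s (60 * N + 1) fun s' =>
      PassInv s.rmem s.imem s'.imem N M w N := by
  have key := Runs.loop (b := .ilt 5 2) (p := mergeBlocks) (s := s)
    (Q := fun s' => PassInv s.rmem s.imem s'.imem N M w N)
    (fun s' => (s'.ireg 1 = 1 ∧ s'.ireg 19 = 0 ∧ s'.ireg 2 = N ∧ s'.ireg 3 = M ∧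
      s'.ireg 4 = w ∧ s'.rmem = s.rmem) ∧ PassInv s.rmem s.imem s'.imem N M w (s'.ireg 5))
    -- A round that merges d ≥ 1 cells costs at most 20 * d + 13 steps including the test, so 60
    -- units per cell pay for it.
    (fun s' => 60 * (N - s'.ireg 5)) ?_ ?_ ?_
  · refine key.pad ?_
    rw [h5]
    omega
  · refine ⟨⟨h1, h19, h2, h3, h4, rfl⟩, ?_⟩
    rw [h5]
    refine ⟨by omega, .inl ⟨0, by omega⟩, fun _ _ => rfl, by simp [cells_self], fun t => ?_⟩
    intro p q hp hpq hq
    omega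
  · rintro s' ⟨⟨e1, e19, e2, e3, e4, er⟩, hI⟩ hlt
    rw [Test.holds_ilt, e2] at hlt
    set c := s'.ireg 5 with hc
    have hle := hI.le
    obtain ⟨t, ht⟩ : ∃ t, c = t * (2 * w) := hI.aligned.resolve_right (by omega)
    have hm0 : c ≤ min (c + w) N := by omega
    have hl : SortedOn s.rmem s'.imem c (min (c + w) N) := by
      intro p q hp hpq hq
      rw [hI.same p (by omega), hI.same q (by omega)]
      refine hs (2 * t) p q ?_ hpq ?_
      · rw [show 2 * t * w = c by rw [ht]; ring]; exact hp
      · rw [show (2 * t + 1) * w = c + w by rw [ht]; ring]; exact hq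
    have hr : SortedOn s.rmem s'.imem (min (c + w) N) (min (c + 2 * w) N) := by
      intro p q hp hpq hq
      rw [hI.same p (by omega), hI.same q (by omega)]
      refine hs (2 * t + 1) p q ?_ hpq ?_
      · rw [show (2 * t + 1) * w = c + w by rw [ht]; ring]; omega
      · rw [show (2 * t + 1 + 1) * w = c + 2 * w by rw [ht]; ring]; exact hq
    refine ⟨(10 + (20 * (min (c + 2 * w) N - c) + 1 + 1)), Runs.pad ?_
      (Runs.wp_seq (T := 20 * (min (c + 2 * w) N - c) + 1 + 1) ?_)⟩
    rotate_left
    · have step : ∀ s1 : Store, s1.ireg 1 = 1 ∧ s1.ireg 19 = 0 ∧ s1.ireg 2 = N ∧ s1.ireg 3 = M ∧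
          s1.ireg 4 = w ∧ s1.rmem = s.rmem ∧ s1.imem = s'.imem ∧ s1.ireg 6 = c ∧
          s1.ireg 7 = min (c + w) N ∧ s1.ireg 8 = min (c + w) N ∧
          s1.ireg 9 = min (c + 2 * w) N ∧ s1.ireg 10 = M + c ∧
          s1.ireg 12 = M + min (c + 2 * w) N →
          Runs (.seq mergeProg (block [.iadd 5 9 19])) s1
            (20 * (min (c + 2 * w) N - c) + 1 + 1) fun s'' =>
              ((s''.ireg 1 = 1 ∧ s''.ireg 19 = 0 ∧ s''.ireg 2 = N ∧ s''.ireg 3 = M ∧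
                s''.ireg 4 = w ∧ s''.rmem = s.rmem) ∧
                PassInv s.rmem s.imem s''.imem N M w (s''.ireg 5)) ∧
              10 + (20 * (min (c + 2 * w) N - c) + 1 + 1) + 1 + 60 * (N - s''.ireg 5) ≤
                60 * (N - c) := by
        rintro s1 ⟨f1, f19, f2, f3, f4, fr, fm, f6, f7, f8, f9, f10, f12⟩
        refine Runs.seq (((runs_mergeProg (M := M) (c := c) (m := min (c + w) N)
          (e := min (c + 2 * w) N) hm0 (by omega) (by omega) f1 f19 f6 f7 f8 f9 f10 f12
          (by rw [fr, fm]; exact hl) (by rw [fr, fm]; exact hr)).frame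
          (Q' := fun s2 => (s2.ireg 1 = 1 ∧ s2.ireg 19 = 0 ∧ s2.ireg 2 = N ∧ s2.ireg 3 = M ∧
            s2.ireg 4 = w ∧ s2.rmem = s.rmem ∧ s2.ireg 9 = min (c + 2 * w) N) ∧
            PassInv s.rmem s.imem s2.imem N M w (min (c + 2 * w) N)) ?_).mono le_rfl ?_)
        · rintro s2 u he ⟨g1, g2, g3⟩
          rw [he.ireg_eq (r := 1), he.ireg_eq (r := 19), he.ireg_eq (r := 2), he.ireg_eq (r := 3),
            he.ireg_eq (r := 4), he.ireg_eq (r := 9), he.rmem_eq]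
          · rw [fm] at g1 g2
            rw [fr] at g3
            exact ⟨⟨f1, f19, f2, f3, f4, fr, f9⟩, hI.merge hw hNM hlt rfl g1 g2 g3⟩
          all_goals simp [mergeProg, mergeStep, block, Prog.All, Instr.KeepsI, Instr.KeepsRmem]
        · rintro s2 ⟨⟨g1, g19, g2, g3, g4, gr, g9⟩, hP⟩
          refine Runs.of_wp ?_
          simp [Prog.wp, block, Instr.eval, g1, g19, g2, g3, g4, gr, g9, hP]
          omega
      simp only [Prog.wp, block, Instr.eval, Test.Holds]
      simp [e19, e2, e3, e4, er, ← hc]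
      refine ⟨fun hlt1 => ⟨fun hlt2 => step _ ?_, fun hlt2 => step _ ?_⟩,
        fun hlt1 => ⟨fun hlt2 => step _ ?_, fun hlt2 => step _ ?_⟩⟩ <;>
      simp [e1, e19, e2, e3, e4] <;> omega
    · simp [Prog.cost, block]
  · rintro s' ⟨⟨e1, e19, e2, e3, e4, er⟩, hI⟩ hlt
    rw [Test.holds_ilt, e2] at hlt
    have := hI.le
    rwa [show s'.ireg 5 = N by omega] at hI

/-- Copy `ireg 2` cells of the index memory from cell `ireg 3` on to the cells from `0` on. -/
def copyProg : Prog :=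
  .seq (block [.iconst 5 0, .iadd 10 3 19])
    (.loop (.ilt 5 2) (block [.iload 13 10, .istore 5 13, .iadd 5 5 1, .iadd 10 10 1]))

theorem runs_copyProg {s : Store} {N M : ℕ} (hNM : N ≤ M) (h1 : s.ireg 1 = 1)
    (h19 : s.ireg 19 = 0) (h2 : s.ireg 2 = N) (h3 : s.ireg 3 = M) :
    Runs copyProg s (5 * N + 3) fun s' => ∀ x, x < N → s'.imem x = s.imem (M + x) := by
  refine Runs.pad (T := 2 + (5 * N + 1)) (by omega) (Runs.wp_seq ?_)
  simp only [block, Prog.wp, Instr.eval]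
  refine (Runs.loop_const
    (fun s' => (s'.ireg 1 = 1 ∧ s'.ireg 2 = N ∧ s'.ireg 10 = M + s'.ireg 5 ∧ s'.ireg 5 ≤ N) ∧
      (∀ x, M ≤ x → s'.imem x = s.imem x) ∧ ∀ x, x < s'.ireg 5 → s'.imem x = s.imem (M + x))
    (fun s' => N - s'.ireg 5) 4 ?_ ?_ ?_).pad ?_
  · simp [h1, h2, h3, h19]
  · rintro s' ⟨⟨e1, e2, e10, hle⟩, hM, hx⟩ hlt
    rw [Test.holds_ilt, e2] at hlt
    refine Runs.of_wp ?_
    simp [Prog.wp, Instr.eval, e1, e2, e10]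
    refine ⟨⟨⟨by omega, by omega⟩, fun x hx' => ?_, fun x hx' => ?_⟩, by omega⟩
    · rw [Function.update_of_ne (by omega), hM x hx']
    · rcases eq_or_ne x (s'.ireg 5) with rfl | hne
      · rw [Function.update_self, hM _ (by omega)]
      · rw [Function.update_of_ne hne, hx x (by omega)]
  · rintro s' ⟨⟨e1, e2, e10, hle⟩, hM, hx⟩ hlt
    rw [Test.holds_ilt, e2] at hlt
    exact fun x hx' => hx x (by omega)
  · simp

/-- Sort the cells `0, …, ireg 2 - 1` of the index memory by the real keys to which they point,
with a buffer from cell `ireg 3` on. -/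
def sortProg : Prog :=
  .seq (block [.iconst 4 1])
    (.loop (.ilt 4 2)
      (.seq (block [.iconst 5 0]) (.seq (.loop (.ilt 5 2) mergeBlocks)
        (.seq copyProg (block [.iadd 4 4 4])))))

theorem runs_sortProg {s : Store} {N M K : ℕ} (hNM : N ≤ M) (hK : N ≤ 2 ^ K)
    (h1 : s.ireg 1 = 1) (h19 : s.ireg 19 = 0) (h2 : s.ireg 2 = N) (h3 : s.ireg 3 = M) :
    Runs sortProg s ((65 * N + 8) * K + 2) fun s' =>
      cells s'.imem 0 N = cells s.imem 0 N ∧ SortedOn s.rmem s'.imem 0 N := by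
  refine Runs.pad (T := 1 + ((65 * N + 8) * K + 1)) (by omega) (Runs.wp_seq ?_)
  simp only [block, Prog.wp, Instr.eval]
  refine (Runs.loop_const
    (fun s' => (s'.ireg 1 = 1 ∧ s'.ireg 19 = 0 ∧ s'.ireg 2 = N ∧ s'.ireg 3 = M ∧
      s'.rmem = s.rmem) ∧ (∃ p, p ≤ K ∧ s'.ireg 4 = 2 ^ p) ∧
      cells s'.imem 0 N = cells s.imem 0 N ∧ BlockSorted s.rmem s'.imem (s'.ireg 4) N)
    -- The block width is a power of two that doubles in each round and stays below N ≤ 2^K while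
    -- the loop runs.
    (fun s' => K - Nat.log 2 (s'.ireg 4)) (65 * N + 7) ?_ ?_ ?_).pad ?_
  · simp only [Function.update_apply]
    refine ⟨by simp [h1, h19, h2, h3], ⟨0, by omega, by simp⟩, trivial, fun t p q hp hpq hq => ?_⟩
    simp only [if_true] at hp hq
    omega
  · rintro s' ⟨⟨e1, e19, e2, e3, er⟩, ⟨p, hp, e4⟩, hc, hs⟩ hlt
    rw [Test.holds_ilt, e2, e4] at hlt
    have hpK : p < K := (Nat.pow_lt_pow_iff_right (by norm_num : 1 < 2)).1 (hlt.trans_le hK)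
    refine Runs.pad (T := 1 + ((60 * N + 1) + ((5 * N + 3) + 1))) (by omega) (Runs.wp_seq ?_)
    simp only [Prog.wp, Instr.eval]
    refine Runs.seq ((runs_pass (N := N) (M := M) (w := 2 ^ p) (by positivity) hNM ?_ ?_ ?_ ?_ ?_
      ?_ ?_).frame (Q' := fun s2 => (s2.ireg 1 = 1 ∧ s2.ireg 19 = 0 ∧ s2.ireg 2 = N ∧
        s2.ireg 3 = M ∧ s2.ireg 4 = 2 ^ p ∧ s2.rmem = s.rmem) ∧
        PassInv s.rmem s'.imem s2.imem N M (2 ^ p) N) ?_ |>.mono le_rfl ?_)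
    · simp [e1]
    · simp [e19]
    · simp [e2]
    · simp [e3]
    · simp [e4]
    · simp
    · simpa [er, ← e4] using hs
    · rintro s2 u he hP
      rw [he.ireg_eq (r := 1), he.ireg_eq (r := 19), he.ireg_eq (r := 2), he.ireg_eq (r := 3),
        he.ireg_eq (r := 4), he.rmem_eq]
      · simpa [e1, e19, e2, e3, e4, er] using hP
      all_goals simp [mergeBlocks, mergeProg, mergeStep, block, Prog.All, Instr.KeepsI,
        Instr.KeepsRmem]
    · rintro s2 ⟨⟨f1, f19, f2, f3, f4, fr⟩, hP⟩
      refine Runs.seq ((runs_copyProg hNM f1 f19 f2 f3).frame (Q' := fun s3 =>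
        (s3.ireg 1 = 1 ∧ s3.ireg 19 = 0 ∧ s3.ireg 2 = N ∧
        s3.ireg 3 = M ∧ s3.ireg 4 = 2 ^ p ∧ s3.rmem = s.rmem) ∧
        ∀ x, x < N → s3.imem x = s2.imem (M + x)) ?_ |>.mono le_rfl ?_)
      · rintro s3 u he hx
        rw [he.ireg_eq (r := 1), he.ireg_eq (r := 19), he.ireg_eq (r := 2), he.ireg_eq (r := 3),
          he.ireg_eq (r := 4), he.rmem_eq]
        · exact ⟨⟨f1, f19, f2, f3, f4, fr⟩, hx⟩
        all_goals simp [copyProg, block, Prog.All, Instr.KeepsI, Instr.KeepsRmem]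
      · rintro s3 ⟨⟨g1, g19, g2, g3, g4, gr⟩, hx⟩
        refine Runs.of_wp ?_
        have h2p : 2 ^ p + 2 ^ p = 2 ^ (p + 1) := by ring
        simp only [Prog.wp, Instr.eval, Function.update_apply]
        norm_num
        refine ⟨⟨⟨g1, g19, g2, g3, gr⟩, ⟨p + 1, hpK, by rw [g4, h2p]⟩, ?_, ?_⟩, ?_⟩
        · rw [cells_congr (g := fun x => s2.imem (M + x)) fun x _ h => hx x h, ← cells_shift,
            add_zero, hP.cells_eq, hc]
        · rw [g4, h2p]
          intro t a b ha hab hb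
          rw [hx a (by omega), hx b (by omega)]
          have := hP.sorted t (M + a) (M + b)
          rw [show 2 * 2 ^ p = 2 ^ (p + 1) by ring] at this
          exact this (by omega) (by omega) (by omega)
        · rw [g4, h2p, e4, Nat.log_pow (by norm_num), Nat.log_pow (by norm_num)]
          omega
  · rintro s' ⟨⟨e1, e19, e2, e3, er⟩, ⟨p, hp, e4⟩, hc, hs⟩ hlt
    rw [Test.holds_ilt, e2, not_lt] at hlt
    refine ⟨hc, fun a b ha hab hb => hs 0 a b (by omega) hab (by omega)⟩
  · simp

end RealRAM

/-! ### Concave chains -/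

namespace CanonicalHull

/-- The scalar product of `p` with the upward vector `(τ, 1)`. -/
def val (τ : ℝ) (p : ℝ × ℝ) : ℝ := τ * p.1 + p.2

/-- Between two consecutive elements of `A`, the functional `val τ` is maximized over `R` by a point
that does not depend on `τ`. -/
def Breaks (R : Set (ℝ × ℝ)) (A : Set ℝ) : Prop :=
  ∀ t₁ t₂, t₁ ≤ t₂ → (∀ a ∈ A, t₁ < a → t₂ ≤ a) →
    ∃ r ∈ R, ∀ p ∈ R, val t₁ p ≤ val t₁ r ∧ val t₂ p ≤ val t₂ r

/-- Additional breakpoints only refine the intervals. Hence slopes of different hulls can be pooled,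
and padding the output does no harm. -/
theorem Breaks.mono {R : Set (ℝ × ℝ)} {A A' : Set ℝ} (h : Breaks R A) (hA : A ⊆ A') :
    Breaks R A' :=
  fun t₁ t₂ ht ha => h t₁ t₂ ht fun a h => ha a (hA h)

/-- The points `h 0, …, h (N - 1)` form a concave chain, and `(T i, 1)` is a normal vector of the
edge from `h (i - 1)` to `h i`. -/
structure Chain (h : ℕ → ℝ × ℝ) (T : ℕ → ℝ) (N : ℕ) : Prop where
  fst_lt : ∀ i, i + 1 < N → (h i).1 < (h (i + 1)).1
  normal : ∀ i, i + 1 < N → T (i + 1) * ((h (i + 1)).1 - (h i).1) = (h i).2 - (h (i + 1)).2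
  mono : ∀ i, 1 ≤ i → i + 1 < N → T i < T (i + 1)

/-- The difference of the two values is (τ - t) * (q.1 - p.1), so along an edge the comparison of
values is a comparison of τ with the slope of the edge. -/
theorem val_le_val_iff {t τ : ℝ} {p q : ℝ × ℝ} (h : p.1 < q.1)
    (ht : t * (q.1 - p.1) = p.2 - q.2) : val τ p ≤ val τ q ↔ t ≤ τ := by
  have : val τ q - val τ p = (τ - t) * (q.1 - p.1) := by rw [val, val]; linear_combination ht
  rw [← sub_nonneg, this, mul_nonneg_iff_of_pos_right (sub_pos.2 h), sub_nonneg]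

theorem val_ge_val_iff {t τ : ℝ} {p q : ℝ × ℝ} (h : p.1 < q.1)
    (ht : t * (q.1 - p.1) = p.2 - q.2) : val τ q ≤ val τ p ↔ τ ≤ t := by
  have : val τ q - val τ p = (τ - t) * (q.1 - p.1) := by rw [val, val]; linear_combination ht
  rw [← sub_nonpos, this, ← not_lt, mul_pos_iff_of_pos_right (sub_pos.2 h), sub_pos, not_lt]

/-- Along a concave chain `val τ` increases over the edges with slope at most τ and decreases over
the later ones. If no slope separates t₁ from t₂, the increase stops at the same vertex for both. -/
theorem Chain.breaks {h : ℕ → ℝ × ℝ} {T : ℕ → ℝ} {N : ℕ} (hc : Chain h T N) {R : Set (ℝ × ℝ)}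
    (hR : R.Nonempty) (hmem : ∀ i, i < N → h i ∈ R)
    (hdom : ∀ p ∈ R, ∀ τ, ∃ i, i < N ∧ val τ p ≤ val τ (h i)) :
    Breaks R {t | ∃ i, i < N ∧ T i = t} := by
  classical
  intro t₁ t₂ ht hA
  obtain ⟨p₀, hp₀⟩ := hR
  obtain ⟨i₀, hi₀, -⟩ := hdom p₀ hp₀ 0
  have hmono : ∀ i j, 1 ≤ i → i ≤ j → j < N → T i ≤ T j := by
    intro i j hi hij
    induction j, hij using Nat.le_induction with
    | base => exact fun _ => le_rfl
    | succ j hj ih => exact fun hN => (ih (by omega)).trans (hc.mono j (by omega) hN).le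
  have hex : ∃ q, q < N ∧ (∀ i, 1 ≤ i → i ≤ q → T i ≤ t₁) ∧ ∀ i, q < i → i < N → t₂ ≤ T i := by
    -- `T 0` belongs to no edge and may be arbitrary, so index 0 is admitted unconditionally.
    let S := (Finset.range N).filter fun i => i = 0 ∨ T i ≤ t₁
    have hS : S.Nonempty := ⟨0, by simp [S]; omega⟩
    obtain ⟨hm₁, hm₂⟩ := Finset.mem_filter.1 (S.max'_mem hS)
    rw [Finset.mem_range] at hm₁
    refine ⟨S.max' hS, hm₁, fun i hi hiq => ?_, fun i hi hiN => ?_⟩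
    · exact (hmono i _ hi hiq hm₁).trans (hm₂.resolve_left (by omega))
    · refine hA _ ⟨i, hiN, rfl⟩ (lt_of_not_ge fun h => ?_)
      have : i ≤ S.max' hS := S.le_max' i (by simp [S]; exact ⟨hiN, .inr h⟩)
      omega
  obtain ⟨q, hqN, hq₁, hq₂⟩ := hex
  have hmax : ∀ t, t₁ ≤ t → t ≤ t₂ → ∀ i, i < N → val t (h i) ≤ val t (h q) := by
    intro t ht₁ ht₂ i hi
    rcases le_total i q with hiq | hiq
    · clear hq₂
      induction q, hiq using Nat.le_induction with
      | base => exact le_rfl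
      | succ q hq ih =>
        refine (ih (by omega) fun j hj hjq => hq₁ j hj (by omega)).trans ?_
        · exact (val_le_val_iff (hc.fst_lt q hqN) (hc.normal q hqN)).2
            ((hq₁ _ (by omega) le_rfl).trans ht₁)
    · induction i, hiq using Nat.le_induction with
      | base => exact le_rfl
      | succ i hqi ih =>
        refine le_trans ?_ (ih (by omega))
        exact (val_ge_val_iff (hc.fst_lt i hi) (hc.normal i hi)).2
          (ht₂.trans (hq₂ _ (by omega) hi))
  refine ⟨h q, hmem q hqN, fun p hp => ⟨?_, ?_⟩⟩
  · obtain ⟨i, hi, hle⟩ := hdom p hp t₁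
    exact hle.trans (hmax t₁ le_rfl ht i hi)
  · obtain ⟨i, hi, hle⟩ := hdom p hp t₂
    exact hle.trans (hmax t₂ ht le_rfl i hi)

end CanonicalHull

namespace RealRAM

/-! ### Gathering the thinned samples -/

/-- Whether the point at address `p` is retained: among the `s` cells at distances `st`, …, `s * st`
from `p`, the first one has the unique largest value. -/
def Coin (f : ℕ → ℝ) (st s p : ℕ) : Prop :=
  ∀ t, 1 ≤ t → t < s → f (p + (t + 1) * st) < f (p + st)

/-- Test whether the point at address `ireg 4` is retained; the result is in `ireg 8`. -/
def coinProg : Prog :=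
  .seq (block [.iadd 6 4 21, .rload 0 6, .iconst 7 1, .iconst 8 1, .iadd 6 6 21])
    (.loop (.ilt 7 20)
      (.seq (block [.rload 1 6])
        (.seq (.branch (.rlt 1 0) .skip (block [.iconst 8 0]))
          (block [.iadd 6 6 21, .iadd 7 7 1]))))

theorem runs_coinProg {s : Store} {st k : ℕ} (hk : 1 ≤ k) (h1 : s.ireg 1 = 1)
    (h20 : s.ireg 20 = k) (h21 : s.ireg 21 = st) :
    Runs coinProg s (6 * k + 6) fun s' =>
      (s'.ireg 8 = 0 ∨ s'.ireg 8 = 1) ∧ (0 < s'.ireg 8 ↔ Coin s.rmem st k (s.ireg 4)) := by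
  refine Runs.pad (T := 5 + (6 * k + 1)) (by omega) (Runs.wp_seq ?_)
  simp only [block, Prog.wp, Instr.eval]
  refine (Runs.loop_const
    (fun s' => (s'.ireg 1 = 1 ∧ s'.ireg 20 = k ∧ s'.ireg 21 = st ∧ s'.rmem = s.rmem) ∧
      s'.rreg 0 = s.rmem (s.ireg 4 + st) ∧ 1 ≤ s'.ireg 7 ∧ s'.ireg 7 ≤ k ∧
      s'.ireg 6 = s.ireg 4 + (s'.ireg 7 + 1) * st ∧
      (s'.ireg 8 = 0 ∨ s'.ireg 8 = 1) ∧ (0 < s'.ireg 8 ↔ Coin s.rmem st (s'.ireg 7) (s.ireg 4)))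
    (fun s' => k - s'.ireg 7) 5 ?_ ?_ ?_).pad ?_
  · simp only [Function.update_apply]
    norm_num
    refine ⟨⟨h1, h20, h21⟩, by rw [h21], hk, by rw [h21]; ring, fun t h h' => by omega⟩
  · rintro s' ⟨⟨e1, e20, e21, er⟩, f0, f7, f7', f6, f8, f8'⟩ hlt
    rw [Test.holds_ilt, e20] at hlt
    have hiff : Coin s.rmem st (s'.ireg 7 + 1) (s.ireg 4) ↔
        Coin s.rmem st (s'.ireg 7) (s.ireg 4) ∧
          s.rmem (s.ireg 4 + (s'.ireg 7 + 1) * st) < s.rmem (s.ireg 4 + st) := by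
      refine ⟨fun h => ⟨fun t ht ht' => h t ht (by omega), h _ f7 (by omega)⟩, fun h t ht ht' => ?_⟩
      rcases Nat.lt_succ_iff_lt_or_eq.1 ht' with h' | rfl
      · exact h.1 t ht h'
      · exact h.2
    refine Runs.pad (T := Prog.cost _) ?_ (Runs.of_wp ?_)
    · simp [Prog.cost]
    · simp [Prog.wp, Instr.eval, e1, e20, e21, er, f0, f6, Test.Holds, hiff, ← f8']
      refine ⟨fun h => ⟨⟨by omega, by ring, f8, ?_⟩, by omega⟩,
        fun h => ⟨⟨by omega, by ring, fun _ => h⟩, by omega⟩⟩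
      exact fun _ => h
  · rintro s' ⟨⟨e1, e20, e21, er⟩, f0, f7, f7', f6, f8, f8'⟩ hlt
    rw [Test.holds_ilt, e20] at hlt
    rw [show s'.ireg 7 = k by omega] at f8'
    exact ⟨f8, f8'⟩
  · simp

/-- Write the addresses of the retained points of the sample at address `ireg 22` to the index
memory; their number is in `ireg 2`. -/
def gatherProg : Prog :=
  .seq (block [.iconst 2 0, .iadd 4 22 19, .iadd 5 22 21])
    (.loop (.ilt 4 5)
      (.seq coinProg
        (.seq (.branch (.ilt 19 8) (block [.istore 2 4, .iadd 2 2 1]) .skip)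
          (block [.iadd 4 4 1, .iadd 4 4 1]))))

open Classical in
theorem runs_gatherProg {s : Store} {n k p : ℕ} (hk : 1 ≤ k) (h1 : s.ireg 1 = 1)
    (h19 : s.ireg 19 = 0) (h20 : s.ireg 20 = k) (h21 : s.ireg 21 = 2 * n) (h22 : s.ireg 22 = p) :
    Runs gatherProg s ((6 * k + 12) * n + 4) fun s' =>
      cells s'.imem 0 (s'.ireg 2) =
        ((Multiset.range n).filter fun j => Coin s.rmem (2 * n) k (p + 2 * j)).map
          fun j => p + 2 * j := by
  refine Runs.pad (T := 3 + ((6 * k + 12) * n + 1)) (by omega) (Runs.wp_seq ?_)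
  simp only [block, Prog.wp, Instr.eval]
  refine (Runs.loop_const
    (fun s' => (s'.ireg 1 = 1 ∧ s'.ireg 19 = 0 ∧ s'.ireg 20 = k ∧ s'.ireg 21 = 2 * n ∧
      s'.ireg 5 = p + 2 * n ∧ s'.rmem = s.rmem) ∧
      ∃ j, j ≤ n ∧ s'.ireg 4 = p + 2 * j ∧ cells s'.imem 0 (s'.ireg 2) =
        ((Multiset.range j).filter fun j => Coin s.rmem (2 * n) k (p + 2 * j)).map
          fun j => p + 2 * j)
    -- This is the number of points left: the address advances by two real cells per point.
    (fun s' => (p + 2 * n - s'.ireg 4 + 1) / 2) (6 * k + 11) ?_ ?_ ?_).pad ?_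
  · simp only [Function.update_apply]
    norm_num
    refine ⟨⟨h1, h19, h20, h21, by rw [h21, h22]⟩, 0, by simp, by rw [h19, h22], ?_⟩
    simp [cells_self]
  · rintro s' ⟨⟨e1, e19, e20, e21, e5, er⟩, j, hj, e4, hc⟩ hlt
    rw [Test.holds_ilt, e5, e4] at hlt
    refine Runs.pad (T := (6 * k + 6) + 5) (by omega) (Runs.seq ?_)
    refine ((runs_coinProg hk e1 e20 e21).frame (Q' := fun s2 => (s2.ireg 1 = 1 ∧
      s2.ireg 19 = 0 ∧ s2.ireg 20 = k ∧ s2.ireg 21 = 2 * n ∧ s2.ireg 5 = p + 2 * n ∧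
      s2.rmem = s.rmem ∧ s2.imem = s'.imem ∧ s2.ireg 4 = p + 2 * j ∧ s2.ireg 2 = s'.ireg 2) ∧
      (0 < s2.ireg 8 ↔ Coin s.rmem (2 * n) k (p + 2 * j))) ?_).mono le_rfl ?_
    · rintro s2 u he ⟨-, h8⟩
      rw [he.ireg_eq (r := 1), he.ireg_eq (r := 19), he.ireg_eq (r := 20), he.ireg_eq (r := 21),
        he.ireg_eq (r := 5), he.ireg_eq (r := 4), he.ireg_eq (r := 2), he.rmem_eq, he.imem_eq]
      · rw [e4, er] at h8
        exact ⟨⟨e1, e19, e20, e21, e5, er, rfl, e4, rfl⟩, h8⟩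
      all_goals simp [coinProg, block, Prog.All, Instr.KeepsI, Instr.KeepsRmem, Instr.KeepsImem]
    · rintro s2 ⟨⟨f1, f19, f20, f21, f5, fr, fm, f4, f2⟩, h8⟩
      refine Runs.pad (T := Prog.cost _) ?_ (Runs.of_wp ?_)
      · simp [Prog.cost]
      · simp only [Prog.wp, Instr.eval, Function.update_apply, Test.Holds]
        norm_num [f1, f19, f20, f21, f5, fr, fm, f4, f2]
        have hmu : (p + 2 * n - (p + 2 * j + 1 + 1) + 1) / 2 < (p + 2 * n - (p + 2 * j) + 1) / 2 := by
          omega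
        rw [e4]
        refine ⟨fun h => ⟨⟨j + 1, by omega, by ring, ?_⟩, hmu⟩,
          fun h => ⟨⟨j + 1, by omega, by ring, ?_⟩, hmu⟩⟩
        · rw [cells_succ _ (Nat.zero_le _), Function.update_self,
            cells_congr (g := s'.imem) fun x _ hx => Function.update_of_ne (by omega) _ _, hc,
            Multiset.range_succ,
            Multiset.filter_cons_of_pos (p := fun j => Coin s.rmem (2 * n) k (p + 2 * j)) _ (h8.1 h),
            Multiset.map_cons]
        · rw [Multiset.range_succ, Multiset.filter_cons_of_neg
            (p := fun j => Coin s.rmem (2 * n) k (p + 2 * j)) _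
            (fun h' => by have := h8.2 h'; omega), hc]
  · rintro s' ⟨⟨e1, e19, e20, e21, e5, er⟩, j, hj, e4, hc⟩ hlt
    rw [Test.holds_ilt, e5, e4] at hlt
    rw [hc, show j = n by omega]
  · simp [h22, h19]
    omega

open CanonicalHull

/-! ### The scan for the upper hull -/

/-- The point at address `p`. -/
def pt (f : ℕ → ℝ) (p : ℕ) : ℝ × ℝ := (f p, f (p + 1))

/-- The scan of the points with addresses `f 0, …, f (N - 1)` has processed the first `i` of them.
The stack of points has size `k` and is stored in the cells `0, …, k - 1` of `g`, and the slopes are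
stored in the cells of `R` from `base` on. -/
structure ScanInv (R₀ : ℕ → ℝ) (f : ℕ → ℕ) (N base : ℕ) (g : ℕ → ℕ) (R : ℕ → ℝ) (i k : ℕ) :
    Prop where
  i_le : i ≤ N
  k_le : k ≤ i
  same : ∀ x, i ≤ x → g x = f x
  rsame : ∀ x, x < base → R x = R₀ x
  mem : ∀ j, j < k → ∃ a, a < i ∧ g j = f a
  chain : (∀ a b, a < b → b < N → R₀ (f a) < R₀ (f b)) →
    Chain (fun j => pt R₀ (g j)) (fun j => R (base + j)) k
  dominated : (∀ a b, a < b → b < N → R₀ (f a) < R₀ (f b)) → ∀ a, a < i → ∀ τ,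
    (∃ j, j < k ∧ val τ (pt R₀ (f a)) ≤ val τ (pt R₀ (g j))) ∨
      i < N ∧ val τ (pt R₀ (f a)) ≤ val τ (pt R₀ (f i))

/-- For an empty stack there is no edge, and `t` is whatever the slope register happens to hold. The
cell then acts as a spurious breakpoint, which is harmless, and each hull stores exactly one cell
per vertex. -/
theorem ScanInv.push {R₀ : ℕ → ℝ} {f : ℕ → ℕ} {N base : ℕ} {g : ℕ → ℕ} {R : ℕ → ℝ} {i k : ℕ}
    (h : ScanInv R₀ f N base g R i k) (hi : i < N) {t : ℝ}
    (hslope : 0 < k → t = (R₀ (g (k - 1) + 1) - R₀ (f i + 1)) / (R₀ (f i) - R₀ (g (k - 1))))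
    (hmono : 1 < k → R (base + (k - 1)) < t) :
    ScanInv R₀ f N base (Function.update g k (f i)) (Function.update R (base + k) t)
      (i + 1) (k + 1) := by
  obtain ⟨h1, h2, h3, h4, h5, h6, h7⟩ := h
  refine ⟨hi, by omega, fun x hx => ?_, fun x hx => ?_, fun j hj => ?_, fun hs => ?_,
    fun hs a ha τ => .inl ?_⟩
  · rw [Function.update_of_ne (by omega), h3 x (by omega)]
  · rw [Function.update_of_ne (by omega), h4 x hx]
  · rcases Nat.lt_succ_iff_lt_or_eq.1 hj with hj | rfl
    · obtain ⟨a, ha, hg⟩ := h5 j hj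
      exact ⟨a, by omega, by rw [Function.update_of_ne (by omega), hg]⟩
    · exact ⟨i, by omega, Function.update_self ..⟩
  · obtain ⟨c1, c2, c3⟩ := h6 hs
    have hg : ∀ j, j < k → Function.update g k (f i) j = g j :=
      fun j hj => Function.update_of_ne (by omega) _ _
    have hr : ∀ j, j < k → Function.update R (base + k) t (base + j) = R (base + j) :=
      fun j hj => Function.update_of_ne (by omega) _ _
    have hlt : ∀ j, j < k → R₀ (g j) < R₀ (f i) := fun j hj => by
      obtain ⟨a, ha, hg⟩ := h5 j hj
      rw [hg]
      exact hs a i ha hi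
    refine ⟨fun j hj => ?_, fun j hj => ?_, fun j hj hjk => ?_⟩
    · rcases Nat.lt_succ_iff_lt_or_eq.1 hj with hj | rfl
      · simp only [hg j (by omega), hg (j + 1) hj]
        exact c1 j hj
      · simp only [hg j (by omega), Function.update_self]
        exact hlt j (by omega)
    · rcases Nat.lt_succ_iff_lt_or_eq.1 hj with hj | rfl
      · simp only [hg j (by omega), hg (j + 1) hj, hr (j + 1) hj]
        exact c2 j hj
      · simp only [hg j (by omega), Function.update_self, hslope (by omega), pt,
          Nat.add_sub_cancel]
        exact div_mul_cancel₀ _ (sub_pos.2 (hlt j (by omega))).ne'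
    · rcases Nat.lt_succ_iff_lt_or_eq.1 hjk with hjk | rfl
      · simp only [hr j (by omega), hr (j + 1) hjk]
        exact c3 j hj hjk
      · simp only [hr j (by omega), Function.update_self]
        exact hmono (by omega)
  · rcases Nat.lt_succ_iff_lt_or_eq.1 ha with ha | rfl
    · rcases h7 hs a ha τ with ⟨j, hj, hle⟩ | ⟨-, hle⟩
      · exact ⟨j, by omega, by rwa [Function.update_of_ne (by omega)]⟩
      · exact ⟨k, by omega, by rwa [Function.update_self]⟩
    · exact ⟨k, by omega, by rw [Function.update_self]⟩

/-- The top of the stack is superfluous: for τ up to the slope of its incoming edge its predecessor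
is at least as good, and for larger τ the new point is. This is why domination in the invariant may
refer to the point about to be pushed. -/
theorem ScanInv.pop {R₀ : ℕ → ℝ} {f : ℕ → ℕ} {N base : ℕ} {g : ℕ → ℕ} {R : ℕ → ℝ} {i k : ℕ}
    (h : ScanInv R₀ f N base g R i k) (hi : i < N) (hk : 1 < k)
    (hle : (R₀ (g (k - 1) + 1) - R₀ (f i + 1)) / (R₀ (f i) - R₀ (g (k - 1))) ≤
      R (base + (k - 1))) :
    ScanInv R₀ f N base g R i (k - 1) := by
  obtain ⟨h1, h2, h3, h4, h5, h6, h7⟩ := h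
  refine ⟨h1, by omega, h3, h4, fun j hj => h5 j (by omega), fun hs => ?_, fun hs a ha τ => ?_⟩
  · obtain ⟨c1, c2, c3⟩ := h6 hs
    exact ⟨fun j hj => c1 j (by omega), fun j hj => c2 j (by omega),
      fun j hj hjk => c3 j hj (by omega)⟩
  · rcases h7 hs a ha τ with ⟨j, hj, hj'⟩ | h
    · rcases Nat.lt_or_ge j (k - 1) with hjk | hjk
      · exact .inl ⟨j, hjk, hj'⟩
      obtain rfl : j = k - 1 := by omega
      obtain ⟨c1, c2, c3⟩ := h6 hs
      have hlt : R₀ (g (k - 1)) < R₀ (f i) := by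
        obtain ⟨b, hb, hg⟩ := h5 _ hj
        rw [hg]
        exact hs b i hb hi
      have e1 := c1 (k - 2) (by omega)
      have e2 := c2 (k - 2) (by omega)
      rw [show k - 2 + 1 = k - 1 by omega] at e1 e2
      rcases le_total τ (R (base + (k - 1))) with hτ | hτ
      · exact .inl ⟨k - 2, by omega, hj'.trans ((val_ge_val_iff e1 e2).2 hτ)⟩
      · refine .inr ⟨hi, hj'.trans ((val_le_val_iff (p := pt R₀ (g (k - 1)))
          (q := pt R₀ (f i)) hlt
          (div_mul_cancel₀ _ (sub_pos.2 hlt).ne')).2 (hle.trans hτ))⟩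
    · exact .inr h

/-- One step of the scan; see `scanProg`. -/
def scanStep : Prog :=
  -- Register 7 is a flag: it is set if the top of the stack has to be popped.
  .seq (block [.iconst 7 0, .iload 8 4, .rload 0 8, .iadd 8 8 1, .rload 1 8])
  (.seq (.branch (.ilt 19 5)
    (.seq (block [.isub 9 5 1, .iload 10 9, .rload 2 10, .iadd 10 10 1, .rload 3 10,
        .rsub 4 3 1, .rsub 5 0 2, .rdiv 4 4 5])
      (.branch (.ilt 1 5)
        (.seq (block [.iadd 11 6 9, .rload 6 11])
          (.branch (.rlt 6 4) .skip (block [.iconst 7 1])))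
        .skip))
    .skip)
  (.branch (.ilt 19 7)
    (block [.isub 5 5 1])
    (block [.iload 8 4, .istore 5 8, .iadd 11 6 5, .rstore 11 4, .iadd 5 5 1, .iadd 4 4 1])))

/-- Compute the upper hull of the `ireg 2` points to which the cells `0, …` of the index memory
point, sorted by the first coordinate. The slopes of its edges are stored from the real address
`ireg 3 + ireg 25` on, and their number is added to `ireg 25`. -/
def scanProg : Prog :=
  .seq (block [.iconst 4 0, .iconst 5 0, .iadd 6 3 25])
    (.seq (.loop (.ilt 4 2) scanStep) (block [.iadd 25 25 5]))

/-- All coordinates lie below `base`, so writing slopes from there on never changes the points being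
scanned. -/
theorem runs_scanProg {s : Store} {N base : ℕ} (h1 : s.ireg 1 = 1)
    (h19 : s.ireg 19 = 0) (h2 : s.ireg 2 = N) (hb : s.ireg 3 + s.ireg 25 = base)
    (hf : ∀ a, a < N → s.imem a + 1 < base) :
    Runs scanProg s (54 * N + 5) fun s' => ∃ k, k ≤ N ∧ s'.ireg 25 = s.ireg 25 + k ∧
      (∀ x, x < base → s'.rmem x = s.rmem x) ∧
      ((∀ a b, a < b → b < N → s.rmem (s.imem a) < s.rmem (s.imem b)) → 0 < N →
        Breaks {p | ∃ a, a < N ∧ pt s.rmem (s.imem a) = p}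
          {t | ∃ j, j < k ∧ s'.rmem (base + j) = t}) := by
  refine Runs.pad (T := 3 + ((27 * (2 * N) + 1) + 1)) (by omega) (Runs.wp_seq ?_)
  simp only [block, Prog.wp, Instr.eval]
  refine Runs.seq ((Runs.loop_const (b := .ilt 4 2) (p := scanStep)
    (Q := fun s' => s'.ireg 25 = s.ireg 25 ∧
      ScanInv s.rmem s.imem N base s'.imem s'.rmem N (s'.ireg 5))
    (fun s' => (s'.ireg 1 = 1 ∧ s'.ireg 19 = 0 ∧ s'.ireg 2 = N ∧ s'.ireg 6 = base ∧
      s'.ireg 25 = s.ireg 25) ∧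
      ScanInv s.rmem s.imem N base s'.imem s'.rmem (s'.ireg 4) (s'.ireg 5))
    -- Amortization: a push lowers the first term by two and raises the stack height by one, a pop
    -- lowers the height by one.
    (fun s' => 2 * (N - s'.ireg 4) + s'.ireg 5) 26 ?_ ?_ ?_).mono ?_ ?_)
  · simp only [Function.update_apply]
    norm_num
    refine ⟨⟨h1, h19, h2, hb⟩, by omega, le_rfl, fun _ _ => rfl, fun _ _ => rfl, fun j hj => by omega,
      fun _ => ⟨fun j hj => by omega, fun j hj => by omega, fun j _ hj => by omega⟩,
      fun _ a ha => by omega⟩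
  · rintro s' ⟨⟨e1, e19, e2, e6, e25⟩, hI⟩ hlt
    rw [Test.holds_ilt, e2] at hlt
    have hfi : s'.imem (s'.ireg 4) = s.imem (s'.ireg 4) := hI.same _ le_rfl
    have hki := hI.k_le
    have hri : ∀ a, a < N → s'.rmem (s.imem a) = s.rmem (s.imem a) ∧
        s'.rmem (s.imem a + 1) = s.rmem (s.imem a + 1) := fun a ha =>
      ⟨hI.rsame _ (by have := hf a ha; omega), hI.rsame _ (hf a ha)⟩
    have hrk : 0 < s'.ireg 5 → s'.rmem (s'.imem (s'.ireg 5 - 1)) =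
        s.rmem (s'.imem (s'.ireg 5 - 1)) ∧ s'.rmem (s'.imem (s'.ireg 5 - 1) + 1) =
        s.rmem (s'.imem (s'.ireg 5 - 1) + 1) := fun h => by
      obtain ⟨a, ha, hg⟩ := hI.mem (s'.ireg 5 - 1) (by omega)
      rw [hg]
      exact hri a (by omega)
    refine Runs.pad (T := scanStep.cost) (by simp [scanStep, block, Prog.cost]) (Runs.of_wp ?_)
    simp [scanStep, block, Prog.wp, Instr.eval, e1, e19, e2, e6, e25, Test.Holds, hfi,
      (hri _ hlt).1, (hri _ hlt).2]
    refine ⟨fun hk => ?_, fun hk => ?_⟩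
    · simp only [(hrk hk).1, (hrk hk).2]
      refine ⟨fun hk1 => ⟨fun hm => ⟨hI.push hlt (fun _ => rfl) fun _ => hm, by omega⟩,
        fun hm => ⟨hI.pop hlt hk1 hm, by omega⟩⟩,
        fun hk1 => ⟨hI.push hlt (fun _ => rfl) fun h => by omega, by omega⟩⟩
    · exact ⟨hI.push hlt (fun h => by omega) fun h => by omega, by omega⟩
  · rintro s' ⟨⟨e1, e19, e2, e6, e25⟩, hI⟩ hlt
    rw [Test.holds_ilt, e2] at hlt
    have := hI.i_le
    rw [show s'.ireg 4 = N by omega] at hI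
    exact ⟨e25, hI⟩
  · simp
  · rintro s' ⟨e25, hI⟩
    refine Runs.of_wp ?_
    simp only [Prog.wp, Instr.eval, Function.update_apply]
    norm_num
    refine ⟨s'.ireg 5, hI.k_le, by rw [e25], hI.rsame, fun hs hN => ?_⟩
    refine (hI.chain hs).breaks ⟨_, 0, hN, rfl⟩ (fun j hj => ?_) ?_
    · obtain ⟨a, ha, hg⟩ := hI.mem j hj
      exact ⟨a, ha, by rw [hg]⟩
    · rintro _ ⟨a, ha, rfl⟩ τ
      exact (hI.dominated hs a ha τ).resolve_right fun h => by omega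

end RealRAM

namespace RealRAM

open CanonicalHull

/-! ### Parameters -/

/-- Compute `L = ⌊log₂ n⌋` in register `27`, `L ^ 2` in register `28`, `n / L ^ 2` in register `26`,
`L ^ 6` in register `20`, `2 * n` in register `21`, the number of real cells of a group of
`L ^ 6 + 1` samples in register `24`, and that of `L ^ 2` groups in register `3`. -/
def initProg : Prog :=
  -- Register 29 holds n + 1, so that the strict tests below mean `≤ n`. Register 19 is never
  -- written and serves as the constant zero.
  .seq (block [.iconst 1 1, .iadd 29 0 1, .iconst 4 2, .iconst 27 0])
  (.seq (.loop (.ilt 4 29) (block [.iadd 4 4 4, .iadd 27 27 1]))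
  (.seq (mulProg 28 27 27 5)
  (.seq (block [.iconst 26 0, .iadd 4 28 19])
  (.seq (.loop (.ilt 4 29) (block [.iadd 4 4 28, .iadd 26 26 1]))
  (.seq (mulProg 6 28 28 5)
  (.seq (mulProg 20 6 28 5)
  (.seq (block [.iadd 21 0 0, .iadd 7 20 1])
  (.seq (mulProg 24 21 7 5)
  (.seq (mulProg 3 24 28 5) (block [.iconst 22 0, .iconst 25 0]))))))))))

/-- The values of the registers after `initProg`. -/
structure Params (n : ℕ) (s : Store) : Prop where
  r0 : s.ireg 0 = n
  r1 : s.ireg 1 = 1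
  r3 : s.ireg 3 = 2 * n * (Nat.log 2 n ^ 6 + 1) * Nat.log 2 n ^ 2
  r19 : s.ireg 19 = 0
  r20 : s.ireg 20 = Nat.log 2 n ^ 6
  r21 : s.ireg 21 = 2 * n
  r24 : s.ireg 24 = 2 * n * (Nat.log 2 n ^ 6 + 1)
  r26 : s.ireg 26 = n / Nat.log 2 n ^ 2

theorem runs_logLoop {s : Store} {n : ℕ} (hn : n ≠ 0) (h1 : s.ireg 1 = 1) (h29 : s.ireg 29 = n + 1)
    (h4 : s.ireg 4 = 2) (h27 : s.ireg 27 = 0) :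
    Runs (.loop (.ilt 4 29) (block [.iadd 4 4 4, .iadd 27 27 1])) s (3 * n + 4) fun s' =>
      s'.ireg 27 = Nat.log 2 n := by
  have key := Runs.loop_const (s := s) (b := .ilt 4 29)
    (p := block [.iadd 4 4 4, .iadd 27 27 1]) (Q := fun s' => s'.ireg 27 = Nat.log 2 n)
    (fun s' => s'.ireg 1 = 1 ∧ s'.ireg 29 = n + 1 ∧ s'.ireg 4 = 2 ^ (s'.ireg 27 + 1) ∧
      2 ^ s'.ireg 27 ≤ n) (fun s' => n + 1 - s'.ireg 4) 2
    ⟨h1, h29, by rw [h4, h27]; rfl, by rw [h27]; omega⟩ ?_ ?_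
  · refine key.pad (by omega)
  · rintro s' ⟨e1, e29, e4, hle⟩ hlt
    rw [Test.holds_ilt, e29] at hlt
    refine Runs.of_wp ?_
    simp [block, Prog.wp, Instr.eval, e1, e29, e4]
    rw [e4] at hlt
    have : 2 ^ (s'.ireg 27 + 1 + 1) = 2 ^ (s'.ireg 27 + 1) + 2 ^ (s'.ireg 27 + 1) := by ring
    have : 0 < 2 ^ (s'.ireg 27 + 1) := by positivity
    refine ⟨⟨by omega, by omega⟩, by omega⟩
  · rintro s' ⟨e1, e29, e4, hle⟩ hlt
    rw [Test.holds_ilt, e29, e4] at hlt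
    exact ((Nat.log_eq_iff (.inr ⟨by norm_num, hn⟩)).2 ⟨hle, by omega⟩).symm

theorem runs_divLoop {s : Store} {n d : ℕ} (hd : 0 < d) (h1 : s.ireg 1 = 1)
    (h29 : s.ireg 29 = n + 1) (h28 : s.ireg 28 = d) (h4 : s.ireg 4 = d) (h26 : s.ireg 26 = 0) :
    Runs (.loop (.ilt 4 29) (block [.iadd 4 4 28, .iadd 26 26 1])) s (3 * n + 4) fun s' =>
      s'.ireg 26 = n / d := by
  have key := Runs.loop_const (s := s) (b := .ilt 4 29)
    (p := block [.iadd 4 4 28, .iadd 26 26 1]) (Q := fun s' => s'.ireg 26 = n / d)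
    (fun s' => s'.ireg 1 = 1 ∧ s'.ireg 29 = n + 1 ∧ s'.ireg 28 = d ∧
      s'.ireg 4 = d * (s'.ireg 26 + 1) ∧ d * s'.ireg 26 ≤ n) (fun s' => n + 1 - s'.ireg 4) 2
    ⟨h1, h29, h28, by rw [h4, h26]; ring, by rw [h26]; omega⟩ ?_ ?_
  · refine key.pad (by omega)
  · rintro s' ⟨e1, e29, e28, e4, hle⟩ hlt
    rw [Test.holds_ilt, e29] at hlt
    refine Runs.of_wp ?_
    simp [block, Prog.wp, Instr.eval, e1, e29, e4, e28]
    rw [e4] at hlt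
    refine ⟨⟨by ring, by omega⟩, by omega⟩
  · rintro s' ⟨e1, e29, e28, e4, hle⟩ hlt
    rw [Test.holds_ilt, e29, e4] at hlt
    exact (Nat.div_eq_of_lt_le (by linarith) (by linarith)).symm

theorem runs_initProg {s : Store} {n : ℕ} (hn : 2 ≤ n) (h0 : s.ireg 0 = n)
    (h : ∀ r, r ≠ 0 → s.ireg r = 0) :
    Runs initProg s (6 * n + 3 * Nat.log 2 n ^ 6 + 12 * Nat.log 2 n ^ 2 + 40) fun s' =>
      Params n s' ∧ s'.ireg 22 = 0 ∧ s'.ireg 25 = 0 ∧ s'.rmem = s.rmem := by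
  set L := Nat.log 2 n with hL
  have hL1 : 0 < L := Nat.log_pos (by norm_num) hn
  have hLL : L ≤ L ^ 2 := by nlinarith
  suffices H : Runs initProg s (4 + ((3 * n + 4) + ((3 * L + 3) + (2 + ((3 * n + 4) +
      ((3 * L ^ 2 + 3) + ((3 * L ^ 2 + 3) + (2 + ((3 * (L ^ 6 + 1) + 3) +
      ((3 * L ^ 2 + 3) + 2)))))))))) fun s' =>
      Params n s' ∧ s'.ireg 22 = 0 ∧ s'.ireg 25 = 0 by
    refine (H.frame fun s' t he hq => ⟨hq.1, hq.2.1, hq.2.2, he.rmem_eq ?_⟩).pad (by omega)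
    simp [initProg, mulProg, block, Prog.All, Instr.KeepsRmem]
  refine Runs.wp_seq ?_
  simp only [block, Prog.wp, Instr.eval]
  refine Runs.seq (((runs_logLoop (n := n) (by omega) ?_ ?_ ?_ ?_).frame (Q' := fun s' =>
    s'.ireg 0 = n ∧ s'.ireg 1 = 1 ∧ s'.ireg 29 = n + 1 ∧ s'.ireg 19 = 0 ∧ s'.ireg 27 = L) ?_).mono
    le_rfl ?_)
  iterate 4 simp [h0]
  · intro s' t he hq
    rw [he.ireg_eq (r := 0), he.ireg_eq (r := 1), he.ireg_eq (r := 29), he.ireg_eq (r := 19)]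
    · simp [h0, hq, h, hL]
    all_goals simp [block, Prog.All, Instr.KeepsI]
  rintro s1 ⟨a0, a1, a29, a19, a27⟩
  refine Runs.seq (((runs_mulProg (d := 28) (a := 27) (b := 27) (c := 5) (by norm_num) (by norm_num)
    (by norm_num) (by norm_num) (by norm_num) (by norm_num) (by norm_num) s1 a1).mono ?_ ?_))
  · rw [a27]
  rintro s2 ⟨b28, hb⟩
  replace b28 : s2.ireg 28 = L ^ 2 := by rw [b28, a27, sq]
  refine Runs.wp_seq ?_
  simp only [Prog.wp, Instr.eval]
  refine Runs.seq (((runs_divLoop (n := n) (d := L ^ 2) (by positivity) ?_ ?_ ?_ ?_ ?_).frame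
    (Q' := fun s' => s'.ireg 0 = n ∧ s'.ireg 1 = 1 ∧ s'.ireg 28 = L ^ 2 ∧ s'.ireg 19 = 0 ∧
      s'.ireg 26 = n / L ^ 2) ?_).mono le_rfl ?_)
  · simp [hb, a1]
  · simp [hb, a29]
  · simp [b28]
  · simp [b28, hb, a19]
  · simp
  · intro s' t he hq
    rw [he.ireg_eq (r := 0), he.ireg_eq (r := 1), he.ireg_eq (r := 28), he.ireg_eq (r := 19)]
    · simp [hb, a0, a1, b28, a19, hq]
    all_goals simp [block, Prog.All, Instr.KeepsI]
  rintro s3 ⟨c0, c1, c28, c19, c26⟩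
  refine Runs.seq (((runs_mulProg (d := 6) (a := 28) (b := 28) (c := 5) (by norm_num) (by norm_num)
    (by norm_num) (by norm_num) (by norm_num) (by norm_num) (by norm_num) s3 c1).mono ?_ ?_))
  · rw [c28]
  rintro s4 ⟨d6, hd⟩
  refine Runs.seq (((runs_mulProg (d := 20) (a := 6) (b := 28) (c := 5) (by norm_num) (by norm_num)
    (by norm_num) (by norm_num) (by norm_num) (by norm_num) (by norm_num) s4
    (by rw [hd 1 (by norm_num) (by norm_num), c1])).mono ?_ ?_))
  · rw [hd 28 (by norm_num) (by norm_num), c28]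
  rintro s5 ⟨e20, he⟩
  replace e20 : s5.ireg 20 = L ^ 6 := by
    rw [e20, d6, hd 28 (by norm_num) (by norm_num), c28]; ring
  refine Runs.wp_seq ?_
  simp only [Prog.wp, Instr.eval]
  refine Runs.seq (((runs_mulProg (d := 24) (a := 21) (b := 7) (c := 5) (by norm_num) (by norm_num)
    (by norm_num) (by norm_num) (by norm_num) (by norm_num) (by norm_num) _ ?_).mono ?_ ?_))
  · simp [he, hd, c1]
  · simp [he, hd, c1, e20]
  rintro s6 ⟨f24, hf⟩
  replace f24 : s6.ireg 24 = 2 * n * (L ^ 6 + 1) := by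
    rw [f24]; simp [he, hd, c1, c0, e20]; ring
  refine Runs.seq (((runs_mulProg (d := 3) (a := 24) (b := 28) (c := 5) (by norm_num) (by norm_num)
    (by norm_num) (by norm_num) (by norm_num) (by norm_num) (by norm_num) s6 ?_).mono ?_ ?_))
  · rw [hf 1 (by norm_num) (by norm_num)]
    simp [he, hd, c1]
  · rw [hf 28 (by norm_num) (by norm_num)]
    simp [he, hd, c28]
  rintro s7 ⟨g3, hg⟩
  replace g3 : s7.ireg 3 = 2 * n * (L ^ 6 + 1) * L ^ 2 := by
    rw [g3, f24, hf 28 (by norm_num) (by norm_num)]; simp [he, hd, c28]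
  refine Runs.of_wp ?_
  simp only [Prog.wp, Instr.eval, Function.update_apply]
  refine ⟨⟨?_, ?_, ?_, ?_, ?_, ?_, ?_, ?_⟩, by simp, by simp⟩
  · simp [hg, hf, he, hd, c0]
  · simp [hg, hf, he, hd, c1]
  · simp [g3, hL]
  · simp [hg, hf, he, hd, c19]
  · simp [hg, hf, e20, hL]
  · simp [hg, hf, he, hd, c0]; ring
  · simp [hg, f24, hL]
  · simp [hg, hf, he, hd, c26, hL]

end RealRAM

namespace RealRAM

open CanonicalHull

/-! ### The hulls of the thinned samples -/

open Classical in
/-- The indices of the retained points of the sample of `n` points at address `p`. -/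
noncomputable def retained (f : ℕ → ℝ) (n k p : ℕ) : Finset ℕ :=
  (Finset.range n).filter fun j => Coin f (2 * n) k (p + 2 * j)

theorem mem_retained {f : ℕ → ℝ} {n k p j : ℕ} :
    j ∈ retained f n k p ↔ j < n ∧ Coin f (2 * n) k (p + 2 * j) := by
  simp [retained]

theorem card_retained_le (f : ℕ → ℝ) (n k p : ℕ) : (retained f n k p).card ≤ n := by
  classical
  exact (Finset.card_filter_le _ _).trans_eq (Finset.card_range n)

theorem lt_of_mem_retained {f : ℕ → ℝ} {n k p j : ℕ} (h : j ∈ retained f n k p) : j < n :=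
  (mem_retained.1 h).1

/-- The coins of a group read only cells of that group, so slopes appended behind the input do not
affect them. -/
theorem retained_congr {f g : ℕ → ℝ} {n k p : ℕ}
    (h : ∀ x, x < p + 2 * n * (k + 1) → f x = g x) (hk : 1 ≤ k) :
    retained f n k p = retained g n k p := by
  ext j
  rw [mem_retained, mem_retained]
  refine and_congr_right fun hj => ?_
  have : 2 * n * (k + 1) = k * (2 * n) + 2 * n := by ring
  have h1 : 1 * (2 * n) ≤ k * (2 * n) := Nat.mul_le_mul_right _ hk
  refine forall₃_congr fun t ht htk => ?_
  have h2 : (t + 1) * (2 * n) ≤ k * (2 * n) := Nat.mul_le_mul_right _ htk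
  rw [h _ (by omega), h _ (by omega)]

/-- Process the group of samples at address `ireg 22`. -/
def groupProg : Prog :=
  .seq gatherProg (.seq sortProg (.seq scanProg (block [.iadd 22 22 24])))

/-- The running time of `groupProg`. -/
def groupTime (n : ℕ) : ℕ :=
  ((6 * Nat.log 2 n ^ 6 + 12) * n + 4) + (((65 * n + 8) * (Nat.log 2 n + 1) + 2) +
    ((54 * n + 5) + 1))

/-- The retained points of the sample at address `p` have different first coordinates. -/
def DistinctFst (f : ℕ → ℝ) (n k p : ℕ) : Prop :=
  ∀ i ∈ retained f n k p, ∀ j ∈ retained f n k p, i ≠ j → f (p + 2 * i) ≠ f (p + 2 * j)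

/-- The retained points of the sample at address `p`. -/
def retainedPts (f : ℕ → ℝ) (n k p : ℕ) : Set (ℝ × ℝ) :=
  {q | ∃ j ∈ retained f n k p, pt f (p + 2 * j) = q}

theorem Params.of_exec {n t : ℕ} {p : Prog} {s s' : Store} (h : Params n s) (he : Exec p s s' t)
    (hp : ∀ r, r = 0 ∨ r = 1 ∨ r = 3 ∨ r = 19 ∨ r = 20 ∨ r = 21 ∨ r = 24 ∨ r = 26 →
      p.All (Instr.KeepsI r)) : Params n s' := by
  obtain ⟨h1, h2, h3, h4, h5, h6, h7, h8⟩ := h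
  constructor <;> rw [he.ireg_eq (hp _ (by simp))] <;> assumption

/-- `R` is the memory of the original input. The current memory agrees with it only below `ireg 3`,
since earlier groups have already appended their slopes. -/
theorem runs_groupProg {s : Store} {n p base : ℕ} {R : ℕ → ℝ} (hn : 2 ≤ n) (hP : Params n s)
    (hp : s.ireg 22 = p) (hpW : p + 2 * n * (Nat.log 2 n ^ 6 + 1) ≤ s.ireg 3)
    (hb : s.ireg 3 + s.ireg 25 = base) (hR : ∀ x, x < s.ireg 3 → s.rmem x = R x) :
    Runs groupProg s (groupTime n) fun s' => Params n s' ∧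
      s'.ireg 22 = p + 2 * n * (Nat.log 2 n ^ 6 + 1) ∧
      ∃ k, k ≤ (retained R n (Nat.log 2 n ^ 6) p).card ∧ s'.ireg 25 = s.ireg 25 + k ∧
      (∀ x, x < base → s'.rmem x = s.rmem x) ∧
      (DistinctFst R n (Nat.log 2 n ^ 6) p → (retained R n (Nat.log 2 n ^ 6) p).Nonempty →
        Breaks (retainedPts R n (Nat.log 2 n ^ 6) p) {t | ∃ j, j < k ∧ s'.rmem (base + j) = t}) := by
  set L := Nat.log 2 n with hL
  have hL1 : 0 < L := Nat.log_pos (by norm_num) hn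
  have hk : 1 ≤ L ^ 6 := Nat.one_le_pow _ _ hL1
  have hret : retained s.rmem n (L ^ 6) p = retained R n (L ^ 6) p :=
    retained_congr (fun x hx => hR x (by omega)) hk
  have hcard := card_retained_le R n (L ^ 6) p
  have h2n : 2 * n ≤ 2 * n * (L ^ 6 + 1) := Nat.le_mul_of_pos_right _ (by omega)
  refine Runs.seq (((runs_gatherProg (n := n) hk hP.r1 hP.r19 hP.r20 hP.r21 hp).frame
    (Q' := fun s1 => Params n s1 ∧ s1.ireg 22 = p ∧ s1.ireg 25 = s.ireg 25 ∧ s1.rmem = s.rmem ∧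
      cells s1.imem 0 (s1.ireg 2) = (retained R n (L ^ 6) p).val.map fun j => p + 2 * j) ?_).mono
    le_rfl ?_)
  · rintro s1 t he hq
    rw [he.ireg_eq (r := 22), he.ireg_eq (r := 25), he.rmem_eq, ← hret]
    · refine ⟨hP.of_exec he ?_, hp, rfl, rfl, hq⟩
      rintro r (rfl | rfl | rfl | rfl | rfl | rfl | rfl | rfl) <;>
      simp [gatherProg, coinProg, block, Prog.All, Instr.KeepsI]
    all_goals simp [gatherProg, coinProg, block, Prog.All, Instr.KeepsI, Instr.KeepsRmem]
  rintro s1 ⟨hP1, h22, h25, hr1, hc1⟩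
  have hN : s1.ireg 2 = (retained R n (L ^ 6) p).card := by
    have := congrArg Multiset.card hc1
    simpa [cells] using this
  set N := s1.ireg 2 with hNdef
  have hNK : N ≤ 2 ^ (L + 1) := by
    have := Nat.lt_pow_succ_log_self (b := 2) (by norm_num) n
    rw [← hL] at this
    omega
  have h3 : s1.ireg 3 = s.ireg 3 := hP1.r3.trans hP.r3.symm
  refine Runs.seq (((runs_sortProg (N := N) (M := s1.ireg 3) (K := L + 1) (by omega) hNK hP1.r1
    hP1.r19 rfl rfl).frame (Q' := fun s2 => Params n s2 ∧ s2.ireg 22 = p ∧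
      s2.ireg 25 = s.ireg 25 ∧ s2.rmem = s.rmem ∧ s2.ireg 2 = N ∧
      cells s2.imem 0 N = ((retained R n (L ^ 6) p).val.map fun j => p + 2 * j) ∧
      SortedOn s.rmem s2.imem 0 N) ?_).mono ?_ ?_)
  · rintro s2 t he ⟨hq1, hq2⟩
    rw [he.ireg_eq (r := 22), he.ireg_eq (r := 25), he.ireg_eq (r := 2), he.rmem_eq]
    · refine ⟨hP1.of_exec he ?_, h22, h25, hr1, rfl, hq1.trans hc1, hr1 ▸ hq2⟩
      rintro r (rfl | rfl | rfl | rfl | rfl | rfl | rfl | rfl) <;>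
      simp [sortProg, mergeBlocks, mergeProg, mergeStep, copyProg, block, Prog.All, Instr.KeepsI]
    all_goals simp [sortProg, mergeBlocks, mergeProg, mergeStep, copyProg, block, Prog.All,
      Instr.KeepsI, Instr.KeepsRmem]
  · have : (65 * N + 8) * (L + 1) ≤ (65 * n + 8) * (L + 1) := Nat.mul_le_mul_right _ (by omega)
    rw [← hL]
    omega
  rintro s2 ⟨hP2, g22, g25, hr2, g2, hc2, hs2⟩
  have hmem : ∀ a, a < N → ∃ j ∈ retained R n (L ^ 6) p, s2.imem a = p + 2 * j := fun a ha => by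
    have : s2.imem a ∈ cells s2.imem 0 N := mem_cells.2 ⟨a, Nat.zero_le _, ha, rfl⟩
    rw [hc2, Multiset.mem_map] at this
    obtain ⟨j, hj, hj'⟩ := this
    exact ⟨j, hj, hj'.symm⟩
  have hmem' : ∀ j ∈ retained R n (L ^ 6) p, ∃ a, a < N ∧ s2.imem a = p + 2 * j := fun j hj => by
    have : p + 2 * j ∈ cells s2.imem 0 N := by
      rw [hc2]; exact Multiset.mem_map_of_mem (fun j => p + 2 * j) hj
    obtain ⟨a, -, ha, h⟩ := mem_cells.1 this
    exact ⟨a, ha, h⟩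
  have hinj : ∀ a b, a < N → b < N → s2.imem a = s2.imem b → a = b := fun a b ha hb hab => by
    have hnd : (cells s2.imem 0 N).Nodup := by
      rw [hc2]
      exact (Multiset.nodup_map_iff_of_injective fun a b h => by simpa using h).2
        (retained R n (L ^ 6) p).nodup
    exact Multiset.inj_on_of_nodup_map hnd a (by simpa using ha) b (by simpa using hb) hab
  have hRpt : ∀ j, j < n → s.rmem (p + 2 * j) = R (p + 2 * j) ∧
      s.rmem (p + 2 * j + 1) = R (p + 2 * j + 1) :=
    fun j hj => ⟨hR _ (by omega), hR _ (by omega)⟩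
  refine Runs.seq (((runs_scanProg (N := N) (base := base) hP2.r1 hP2.r19 g2
    (by rw [hP2.r3, ← hP.r3, g25, hb]) ?_).frame (Q' := fun s3 => Params n s3 ∧ s3.ireg 22 = p ∧
      ∃ k, k ≤ N ∧ s3.ireg 25 = s.ireg 25 + k ∧ (∀ x, x < base → s3.rmem x = s.rmem x) ∧
      ((∀ a b, a < b → b < N → s.rmem (s2.imem a) < s.rmem (s2.imem b)) → 0 < N →
        Breaks {p | ∃ a, a < N ∧ pt s.rmem (s2.imem a) = p}
          {t | ∃ j, j < k ∧ s3.rmem (base + j) = t})) ?_).mono ?_ ?_)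
  · intro a ha
    obtain ⟨j, hj, h⟩ := hmem a ha
    have := lt_of_mem_retained hj
    omega
  · rintro s3 t he ⟨k, hk1, hk2, hk3, hk4⟩
    rw [he.ireg_eq (r := 22)]
    · refine ⟨hP2.of_exec he ?_, g22, k, hk1, by rw [hk2, g25], by rwa [hr2] at hk3,
        by rwa [hr2] at hk4⟩
      rintro r (rfl | rfl | rfl | rfl | rfl | rfl | rfl | rfl) <;>
      simp [scanProg, scanStep, block, Prog.All, Instr.KeepsI]
    all_goals simp [scanProg, scanStep, block, Prog.All, Instr.KeepsI]
  · omega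
  rintro s3 ⟨hP3, f22, k, hk1, hk2, hk3, hk4⟩
  refine Runs.of_wp ?_
  have hpre : Params n ((Instr.iadd 22 22 24).eval s3) := by
    obtain ⟨h1, h2, h3, h4, h5, h6, h7, h8⟩ := hP3
    constructor <;> simpa [Instr.eval]
  refine ⟨hpre, ?_, k, hN ▸ hk1, ?_, ?_, fun hd hne => ?_⟩
  · simp [Instr.eval, f22, hP3.r24, hL]
  · simpa [Instr.eval] using hk2
  · exact hk3
  · have hpos : 0 < N := by rw [hN]; exact Finset.card_pos.2 hne
    have hset : {p | ∃ a, a < N ∧ pt s.rmem (s2.imem a) = p} = retainedPts R n (L ^ 6) p := by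
      ext q
      constructor
      · rintro ⟨a, ha, rfl⟩
        obtain ⟨j, hj, h⟩ := hmem a ha
        refine ⟨j, hj, ?_⟩
        rw [h, pt, pt, (hRpt j (lt_of_mem_retained hj)).1, (hRpt j (lt_of_mem_retained hj)).2]
      · rintro ⟨j, hj, rfl⟩
        obtain ⟨a, ha, h⟩ := hmem' j hj
        refine ⟨a, ha, ?_⟩
        rw [h, pt, pt, (hRpt j (lt_of_mem_retained hj)).1, (hRpt j (lt_of_mem_retained hj)).2]
    rw [← hset]
    -- Sorting gives weak inequalities only; distinct first coordinates make them strict, as the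
    -- scan requires.
    refine hk4 (fun a b hab hbN => lt_of_le_of_ne (hs2 a b (Nat.zero_le _) hab hbN) ?_) hpos
    obtain ⟨i, hi, hia⟩ := hmem a (by omega)
    obtain ⟨j, hj, hjb⟩ := hmem b hbN
    rw [hia, hjb, (hRpt i (lt_of_mem_retained hi)).1, (hRpt j (lt_of_mem_retained hj)).1]
    refine hd i hi j hj fun hij => ?_
    have := hinj a b (by omega) hbN (by rw [hia, hjb, hij])
    omega

/-- After all groups have been processed, the slopes of the hulls of all thinned samples are stored
from the real address `ireg 3` on. -/
theorem runs_groups {s : Store} {n : ℕ} {R : ℕ → ℝ} (hn : 2 ≤ n) (hP : Params n s)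
    (h22 : s.ireg 22 = 0) (h25 : s.ireg 25 = 0) (hR : s.rmem = R) :
    Runs (.loop (.ilt 22 3) groupProg) s ((groupTime n + 1) * Nat.log 2 n ^ 2 + 1) fun s' =>
      Params n s' ∧ s'.ireg 25 ≤ ∑ b ∈ Finset.range (Nat.log 2 n ^ 2),
        (retained R n (Nat.log 2 n ^ 6) (2 * n * (Nat.log 2 n ^ 6 + 1) * b)).card ∧
      ∀ b, b < Nat.log 2 n ^ 2 →
        DistinctFst R n (Nat.log 2 n ^ 6) (2 * n * (Nat.log 2 n ^ 6 + 1) * b) →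
        (retained R n (Nat.log 2 n ^ 6) (2 * n * (Nat.log 2 n ^ 6 + 1) * b)).Nonempty →
        Breaks (retainedPts R n (Nat.log 2 n ^ 6) (2 * n * (Nat.log 2 n ^ 6 + 1) * b))
          {t | ∃ j, j < s'.ireg 25 ∧ s'.rmem (s'.ireg 3 + j) = t} := by
  set L := Nat.log 2 n with hL
  set W := 2 * n * (L ^ 6 + 1) with hW
  have hWpos : 0 < W := by positivity
  have h3 : ∀ s' : Store, Params n s' → s'.ireg 3 = W * L ^ 2 := fun s' h => h.r3
  have key := Runs.loop_const (s := s) (b := .ilt 22 3) (p := groupProg)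
    (Q := fun s' => Params n s' ∧ s'.ireg 25 ≤ ∑ b ∈ Finset.range (L ^ 2),
        (retained R n (L ^ 6) (W * b)).card ∧
      ∀ b, b < L ^ 2 → DistinctFst R n (L ^ 6) (W * b) → (retained R n (L ^ 6) (W * b)).Nonempty →
        Breaks (retainedPts R n (L ^ 6) (W * b))
          {t | ∃ j, j < s'.ireg 25 ∧ s'.rmem (s'.ireg 3 + j) = t})
    (fun s' => Params n s' ∧ (∀ x, x < s'.ireg 3 → s'.rmem x = R x) ∧ ∃ b, b ≤ L ^ 2 ∧
      s'.ireg 22 = W * b ∧ s'.ireg 25 ≤ ∑ b ∈ Finset.range b, (retained R n (L ^ 6) (W * b)).card ∧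
      ∀ a, a < b → DistinctFst R n (L ^ 6) (W * a) → (retained R n (L ^ 6) (W * a)).Nonempty →
        Breaks (retainedPts R n (L ^ 6) (W * a))
          {t | ∃ j, j < s'.ireg 25 ∧ s'.rmem (s'.ireg 3 + j) = t})
    (fun s' => L ^ 2 - s'.ireg 22 / W) (groupTime n) ?_ ?_ ?_
  · refine key.pad ?_
    rw [h22]; simp
  · refine ⟨hP, fun x _ => by rw [hR], 0, by omega, by rw [h22]; simp, by simp [h25],
      fun a ha => by omega⟩
  · rintro s' ⟨hP', hR', b, hb, h22', h25', hall⟩ hlt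
    rw [Test.holds_ilt, h22', h3 s' hP'] at hlt
    have hbL : b < L ^ 2 := lt_of_mul_lt_mul_left hlt (Nat.zero_le _)
    have hle : W * (b + 1) ≤ W * L ^ 2 := Nat.mul_le_mul_left _ hbL
    refine (runs_groupProg (R := R) hn hP' h22' ?_ rfl hR').mono le_rfl ?_
    · rw [h3 s' hP']; simp only [← hL, ← hW]; linarith
    rintro s2 ⟨hP2, g22, k, hk1, hk2, hk3, hk4⟩
    simp only [← hL, ← hW] at g22 hk1 hk4
    have e3 : s2.ireg 3 = s'.ireg 3 := (h3 _ hP2).trans (h3 _ hP').symm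
    refine ⟨⟨hP2, fun x hx => by rw [hk3 x (by omega), hR' x (by omega)], b + 1, hbL,
      by rw [g22]; ring, ?_, fun a ha hd hne => ?_⟩, ?_⟩
    · rw [Finset.sum_range_succ, hk2]; omega
    · rcases Nat.lt_succ_iff_lt_or_eq.1 ha with ha | rfl
      · refine (hall a ha hd hne).mono ?_
        rintro _ ⟨j, hj, rfl⟩
        exact ⟨j, by omega, by rw [e3, hk3 _ (by omega)]⟩
      · refine (hk4 hd hne).mono ?_
        rintro _ ⟨j, hj, rfl⟩
        exact ⟨s'.ireg 25 + j, by omega, by rw [e3, add_assoc]⟩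
    · rw [g22, h22', ← Nat.mul_succ, Nat.mul_div_cancel_left _ hWpos,
        Nat.mul_div_cancel_left _ hWpos]
      omega
  · rintro s' ⟨hP', hR', b, hb, h22', h25', hall⟩ hlt
    rw [Test.holds_ilt, h22', h3 s' hP', not_lt] at hlt
    obtain rfl : b = L ^ 2 := le_antisymm hb (Nat.le_of_mul_le_mul_left hlt hWpos)
    exact ⟨hP', h25', hall⟩

end RealRAM

namespace RealRAM

open CanonicalHull

/-! ### Sorting the slopes and writing the output -/

/-- Fill the index memory with the addresses of the slopes. -/
def fillProg : Prog :=
  .seq (block [.iadd 2 25 19, .iconst 4 0])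
    (.loop (.ilt 4 2) (block [.iadd 8 3 4, .istore 4 8, .iadd 4 4 1]))

theorem runs_fillProg {s : Store} {n : ℕ} (hP : Params n s) :
    Runs fillProg s (4 * s.ireg 25 + 3) fun s' =>
      s'.ireg 2 = s.ireg 25 ∧ ∀ x, x < s.ireg 25 → s'.imem x = s.ireg 3 + x := by
  refine Runs.pad (T := 2 + (4 * s.ireg 25 + 1)) (by omega) (Runs.wp_seq ?_)
  simp only [block, Prog.wp, Instr.eval]
  refine (Runs.loop_const
    (fun s' => s'.ireg 1 = 1 ∧ s'.ireg 2 = s.ireg 25 ∧ s'.ireg 3 = s.ireg 3 ∧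
      s'.ireg 4 ≤ s.ireg 25 ∧ ∀ x, x < s'.ireg 4 → s'.imem x = s.ireg 3 + x)
    (fun s' => s.ireg 25 - s'.ireg 4) 3 ?_ ?_ ?_).pad ?_
  · simp [hP.r1, hP.r19]
  · rintro s' ⟨e1, e2, e3, h4, hx⟩ hlt
    rw [Test.holds_ilt, e2] at hlt
    refine Runs.of_wp ?_
    simp [Prog.wp, Instr.eval, e1, e2, e3]
    refine ⟨⟨by omega, fun x hx' => ?_⟩, by omega⟩
    rcases eq_or_ne x (s'.ireg 4) with rfl | hne
    · rw [Function.update_self]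
    · rw [Function.update_of_ne hne, hx x (by omega)]
  · rintro s' ⟨e1, e2, e3, h4, hx⟩ hlt
    rw [Test.holds_ilt, e2] at hlt
    exact ⟨e2, fun x hx' => hx x (by omega)⟩
  · simp

/-- The unit vector in the direction of `(τ, 1)`. -/
noncomputable def dirOf (τ : ℝ) : ℝ × ℝ := (τ / √(τ * τ + 1), (√(τ * τ + 1))⁻¹)

/-- Append the direction of `(rreg 1, 1)` to the output. -/
def emitBlock : Prog :=
  block [.rmul 2 1 1, .radd 2 2 7, .rsqrt 2 2, .rdiv 3 1 2, .rstore 6 3, .iadd 6 6 1, .rdiv 3 7 2,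
    .rstore 6 3, .iadd 6 6 1, .iadd 5 5 1, .rsub 4 1 1, .radd 0 1 4]

/-- The slopes `τ 0 < ⋯ < τ (j - 1)` have been written to the output. -/
structure OutInv (τ : ℕ → ℝ) (R : ℕ → ℝ) (j : ℕ) (last : ℝ) : Prop where
  fst : ∀ i, i < j → R (2 * i) = (dirOf (τ i)).1
  snd : ∀ i, i < j → R (2 * i + 1) = (dirOf (τ i)).2
  mono : ∀ i i', i < i' → i' < j → τ i < τ i'
  le_last : ∀ i, i < j → τ i ≤ last

theorem OutInv.emit {τ : ℕ → ℝ} {R : ℕ → ℝ} {j : ℕ} {last t : ℝ} (h : OutInv τ R j last)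
    (ht : last < t) :
    OutInv (Function.update τ j t)
      (Function.update (Function.update R (2 * j) (dirOf t).1) (2 * j + 1) (dirOf t).2)
      (j + 1) t := by
  obtain ⟨h1, h2, h3, h4⟩ := h
  have hτ : ∀ i, i < j → Function.update τ j t i = τ i :=
    fun i hi => Function.update_of_ne (by omega) _ _
  refine ⟨fun i hi => ?_, fun i hi => ?_, fun i i' hii hi => ?_, fun i hi => ?_⟩
  · rcases Nat.lt_succ_iff_lt_or_eq.1 hi with hi | rfl
    · rw [hτ i hi, Function.update_of_ne (by omega), Function.update_of_ne (by omega), h1 i hi]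
    · rw [Function.update_of_ne (by omega), Function.update_self, Function.update_self]
  · rcases Nat.lt_succ_iff_lt_or_eq.1 hi with hi | rfl
    · rw [hτ i hi, Function.update_of_ne (by omega), Function.update_of_ne (by omega), h2 i hi]
    · rw [Function.update_self, Function.update_self]
  · rcases Nat.lt_succ_iff_lt_or_eq.1 hi with hi | rfl
    · rw [hτ i (by omega), hτ i' hi]; exact h3 i i' hii hi
    · rw [hτ i (by omega), Function.update_self]; exact (h4 i (by omega)).trans_lt ht
  · rcases Nat.lt_succ_iff_lt_or_eq.1 hi with hi | rfl
    · rw [hτ i hi]; exact (h4 i hi).trans ht.le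
    · rw [Function.update_self]

/-- Write the directions of the sorted slopes to the output, without repetitions and at most
`ireg 26` of them. -/
def emitProg : Prog :=
  -- The last slope written is initialized to the smallest slope minus one, so the strict test that
  -- removes duplicates lets the first slope pass.
  .seq (block [.rcast 7 1, .iload 8 19, .rload 0 8, .rsub 0 0 7, .iconst 4 0, .iconst 5 0,
      .iconst 6 0])
    (.loop (.ilt 4 2) (.seq (block [.iload 8 4, .rload 1 8])
      (.seq (.branch (.rlt 0 1) (.branch (.ilt 5 26) emitBlock .skip) .skip)
        (block [.iadd 4 4 1]))))

/-- Fill up the output to `ireg 26` directions. -/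
def padProg : Prog :=
  .seq (.loop (.ilt 5 26) (.seq (block [.radd 1 0 7]) emitBlock)) (block [.iadd 0 26 19])

/-- The output overwrites the input, but 2k ≤ `base` keeps the slopes intact. The written slopes
increase strictly in any case; only their completeness needs N ≤ k. -/
theorem runs_emitProg {s : Store} {n N k base : ℕ} (hP : Params n s) (hN : s.ireg 2 = N)
    (hk : s.ireg 26 = k) (hbase : 2 * k ≤ base) (hmem : ∀ a, a < N → base ≤ s.imem a)
    (hs : SortedOn s.rmem s.imem 0 N) :
    Runs emitProg s (18 * N + 8) fun s' => s'.rreg 7 = 1 ∧ s'.ireg 5 ≤ k ∧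
      s'.ireg 6 = 2 * s'.ireg 5 ∧ ∃ τ, OutInv τ s'.rmem (s'.ireg 5) (s'.rreg 0) ∧
        (N ≤ k → ∀ a, a < N → ∃ j, j < s'.ireg 5 ∧ τ j = s.rmem (s.imem a)) := by
  refine Runs.pad (T := 7 + (18 * N + 1)) (by omega) (Runs.wp_seq ?_)
  simp only [block, Prog.wp, Instr.eval]
  refine (Runs.loop_const
    (fun s' => (s'.ireg 1 = 1 ∧ s'.ireg 2 = N ∧ s'.ireg 26 = k ∧ s'.imem = s.imem ∧
      s'.rreg 7 = 1 ∧ s'.ireg 6 = 2 * s'.ireg 5 ∧ s'.ireg 5 ≤ k ∧ s'.ireg 5 ≤ s'.ireg 4 ∧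
      s'.ireg 4 ≤ N ∧ ∀ x, base ≤ x → s'.rmem x = s.rmem x) ∧
      ∃ τ, OutInv τ s'.rmem (s'.ireg 5) (s'.rreg 0) ∧
        (N ≤ k → (s'.ireg 4 = 0 → s'.rreg 0 < s.rmem (s.imem 0)) ∧
          (0 < s'.ireg 4 → s'.rreg 0 = s.rmem (s.imem (s'.ireg 4 - 1))) ∧
          ∀ a, a < s'.ireg 4 → ∃ j, j < s'.ireg 5 ∧ τ j = s.rmem (s.imem a)))
    (fun s' => N - s'.ireg 4) 17 ?_ ?_ ?_).pad ?_
  · simp [hP.r1, hP.r19, hN, hk]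
    exact ⟨fun _ => 0, fun i hi => by omega, fun i hi => by omega, fun i _ _ hi => by omega,
      fun i hi => by omega⟩
  · rintro s' ⟨⟨e1, e2, e26, em, e7, e6, h5, h54, h4, hr⟩, τ, hO, hc⟩ hlt
    rw [Test.holds_ilt, e2] at hlt
    have hrt : s'.rmem (s.imem (s'.ireg 4)) = s.rmem (s.imem (s'.ireg 4)) := hr _ (hmem _ hlt)
    set t := s.rmem (s.imem (s'.ireg 4)) with ht
    have hO1 : (dirOf t).1 = t / √(t * t + 1) := rfl
    have hO2 : (dirOf t).2 = (√(t * t + 1))⁻¹ := rfl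
    refine Runs.pad (T := Prog.cost _) ?_ (Runs.of_wp ?_)
    · simp [emitBlock, block, Prog.cost]
    · simp [emitBlock, block, Prog.wp, Instr.eval, Test.Holds, e1, e2, e26, em, e7, e6, hrt]
      refine ⟨fun hlt' => ⟨fun hk5 => ?_, fun hk5 => ?_⟩, fun hle => ?_⟩
      · refine ⟨⟨⟨by ring, by omega, by omega, by omega, fun x hx => ?_⟩,
          Function.update τ (s'.ireg 5) t, ?_, fun hNk => ⟨ht, fun a ha => ?_⟩⟩, by omega⟩
        · rw [Function.update_of_ne (by omega), Function.update_of_ne (by omega), hr x hx]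
        · rw [← hO1, ← hO2]; exact hO.emit hlt'
        · rcases Nat.lt_or_eq_of_le ha with ha | rfl
          · obtain ⟨j, hj, hj'⟩ := (hc hNk).2.2 a ha
            exact ⟨j, by omega, by rw [Function.update_of_ne (by omega), hj']⟩
          · exact ⟨s'.ireg 5, by omega, Function.update_self ..⟩
      · exact ⟨⟨⟨by omega, by omega, by omega, hr⟩, τ, hO, fun hNk => by omega⟩, by omega⟩
      · refine ⟨⟨⟨by omega, by omega, by omega, hr⟩, τ, hO, fun hNk => ?_⟩, by omega⟩
        obtain ⟨c1, c2, c3⟩ := hc hNk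
        rcases Nat.eq_zero_or_pos (s'.ireg 4) with h0 | h0
        · have := c1 h0
          rw [ht, h0] at hle
          exact absurd hle (not_le.2 this)
        · have hlast : s'.rreg 0 = t := by
            refine le_antisymm ?_ hle
            rw [c2 h0]
            exact hs _ _ (Nat.zero_le _) (by omega) hlt
          refine ⟨hlast, fun a ha => ?_⟩
          rcases Nat.lt_or_eq_of_le ha with ha | rfl
          · exact c3 a ha
          · obtain ⟨j, hj, hj'⟩ := c3 (s'.ireg 4 - 1) (by omega)
            exact ⟨j, hj, by rw [hj', ← c2 h0, hlast]⟩
  · rintro s' ⟨⟨e1, e2, e26, em, e7, e6, h5, h54, h4, hr⟩, τ, hO, hc⟩ hlt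
    rw [Test.holds_ilt, e2] at hlt
    refine ⟨e7, h5, e6, τ, hO, fun hNk a ha => (hc hNk).2.2 a (by omega)⟩
  · simp

/-- Each padding slope is the previous slope plus one, so the sequence remains strictly increasing.
-/
theorem runs_padProg {s : Store} {k : ℕ} {τ : ℕ → ℝ} (h1 : s.ireg 1 = 1) (h19 : s.ireg 19 = 0)
    (hk : s.ireg 26 = k) (h7 : s.rreg 7 = 1) (h5 : s.ireg 5 ≤ k) (h6 : s.ireg 6 = 2 * s.ireg 5)
    (hO : OutInv τ s.rmem (s.ireg 5) (s.rreg 0)) :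
    Runs padProg s (14 * k + 2) fun s' => s'.ireg 0 = k ∧
      ∃ τ', (∀ j, j < s.ireg 5 → τ' j = τ j) ∧ OutInv τ' s'.rmem k (s'.rreg 0) := by
  refine Runs.pad (T := (14 * (k - s.ireg 5) + 1) + 1) (by omega) (Runs.seq ?_)
  refine (Runs.loop_const (Q := fun s' => s'.ireg 19 = 0 ∧ s'.ireg 26 = k ∧
      ∃ τ', (∀ j, j < s.ireg 5 → τ' j = τ j) ∧ OutInv τ' s'.rmem k (s'.rreg 0))
    (fun s' => (s'.ireg 1 = 1 ∧ s'.ireg 19 = 0 ∧ s'.ireg 26 = k ∧ s'.rreg 7 = 1 ∧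
      s'.ireg 5 ≤ k ∧ s.ireg 5 ≤ s'.ireg 5 ∧ s'.ireg 6 = 2 * s'.ireg 5) ∧
      ∃ τ', (∀ j, j < s.ireg 5 → τ' j = τ j) ∧ OutInv τ' s'.rmem (s'.ireg 5) (s'.rreg 0))
    (fun s' => k - s'.ireg 5) 13 ?_ ?_ ?_).mono le_rfl ?_
  · exact ⟨⟨h1, h19, hk, h7, h5, le_rfl, h6⟩, τ, fun _ _ => rfl, hO⟩
  · rintro s' ⟨⟨e1, e19, e26, e7, e5, e5', e6⟩, τ', hτ, hO'⟩ hlt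
    rw [Test.holds_ilt, e26] at hlt
    set t := s'.rreg 0 + 1 with ht
    have hO1 : (dirOf t).1 = t / √(t * t + 1) := rfl
    have hO2 : (dirOf t).2 = (√(t * t + 1))⁻¹ := rfl
    refine Runs.pad (T := Prog.cost _) ?_ (Runs.of_wp ?_)
    · simp [emitBlock, block, Prog.cost]
    · simp [emitBlock, block, Prog.wp, Instr.eval, e1, e19, e26, e7, e6, ← ht]
      refine ⟨⟨⟨by omega, by omega, by ring⟩, Function.update τ' (s'.ireg 5) t, fun j hj => ?_, ?_⟩,
        by omega⟩
      · rw [Function.update_of_ne (by omega), hτ j hj]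
      · rw [← hO1, ← hO2]; exact hO'.emit (by rw [ht]; linarith)
  · rintro s' ⟨⟨e1, e19, e26, e7, e5, e5', e6⟩, τ', hτ, hO'⟩ hlt
    rw [Test.holds_ilt, e26] at hlt
    rw [show s'.ireg 5 = k by omega] at hO'
    exact ⟨e19, e26, τ', hτ, hO'⟩
  · rintro s' ⟨e19, e26, hτ⟩
    refine Runs.of_wp ?_
    simpa [Prog.wp, block, Instr.eval, e19, e26] using hτ

end RealRAM

namespace RealRAM

open CanonicalHull

/-! ### The whole program -/

/-- The program that computes the canonical directions. -/
def mainProg : Prog :=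
  .seq initProg (.seq (.loop (.ilt 22 3) groupProg)
    (.seq fillProg (.seq sortProg (.seq emitProg padProg))))

/-- The running time of `mainProg`. -/
def mainTime (n : ℕ) : ℕ :=
  let L := Nat.log 2 n
  (6 * n + 3 * L ^ 6 + 12 * L ^ 2 + 40) + (((groupTime n + 1) * L ^ 2 + 1) +
    ((4 * (L ^ 2 * n) + 3) + (((65 * (L ^ 2 * n) + 8) * (3 * L + 1) + 2) +
      ((18 * (L ^ 2 * n) + 8) + (14 * n + 2)))))

/-- The leading term n * L^8 comes from the coins: L^2 groups of n points, each with L^6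
comparisons. -/
theorem mainTime_le {n : ℕ} (hn : 2 ≤ n) : mainTime n ≤ 1000 * (n * Nat.log 2 n ^ 8) := by
  have hL1 : 0 < Nat.log 2 n := Nat.log_pos (by norm_num) hn
  simp only [mainTime, groupTime]
  generalize Nat.log 2 n = L at *
  have key : ∀ i, i ≤ 8 → n * L ^ i ≤ n * L ^ 8 := fun i hi =>
    Nat.mul_le_mul_left _ (Nat.pow_le_pow_right hL1 hi)
  have h0 := key 0 (by norm_num)
  have h1 := key 1 (by norm_num)
  have h2 := key 2 (by norm_num)
  have h3 := key 3 (by norm_num)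
  have h6 := key 6 (by norm_num)
  have e2 : L ^ 2 ≤ n * L ^ 2 := Nat.le_mul_of_pos_left _ (by omega)
  have e3 : L ^ 3 ≤ n * L ^ 3 := Nat.le_mul_of_pos_left _ (by omega)
  have e1 : L ≤ n * L ^ 1 := by rw [pow_one]; exact Nat.le_mul_of_pos_left _ (by omega)
  have e6 : L ^ 6 ≤ n * L ^ 6 := Nat.le_mul_of_pos_left _ (by omega)
  have : 6 * n + 3 * L ^ 6 + 12 * L ^ 2 + 40 + (((6 * L ^ 6 + 12) * n + 4 +
      ((65 * n + 8) * (L + 1) + 2 + (54 * n + 5 + 1)) + 1) * L ^ 2 + 1 + (4 * (L ^ 2 * n) + 3 +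
      ((65 * (L ^ 2 * n) + 8) * (3 * L + 1) + 2 + (18 * (L ^ 2 * n) + 8 + (14 * n + 2))))) =
      6 * (n * L ^ 8) + 260 * (n * L ^ 3) + 218 * (n * L ^ 2) + 20 * (n * L ^ 0) + 3 * L ^ 6 +
      8 * L ^ 3 + 33 * L ^ 2 + 24 * L + 64 := by ring
  rw [this]
  rw [pow_zero, mul_one] at h0
  simp only [pow_zero, mul_one]
  omega

/-- Time and shape of the output are guaranteed for every input. Overlong or degenerate thinned
samples only void the statement about breakpoints. -/
theorem runs_mainProg {s : Store} {n : ℕ} {R : ℕ → ℝ} (hn : 2 ≤ n) (h0 : s.ireg 0 = n)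
    (h : ∀ r, r ≠ 0 → s.ireg r = 0) (hR : s.rmem = R) :
    Runs mainProg s (mainTime n) fun s' => s'.ireg 0 = numDirections n ∧
      ∃ τ last, OutInv τ s'.rmem (numDirections n) last ∧
        (∑ b ∈ Finset.range (Nat.log 2 n ^ 2),
          (retained R n (Nat.log 2 n ^ 6) (2 * n * (Nat.log 2 n ^ 6 + 1) * b)).card ≤
            numDirections n →
        ∀ b, b < Nat.log 2 n ^ 2 →
          DistinctFst R n (Nat.log 2 n ^ 6) (2 * n * (Nat.log 2 n ^ 6 + 1) * b) →
          (retained R n (Nat.log 2 n ^ 6) (2 * n * (Nat.log 2 n ^ 6 + 1) * b)).Nonempty →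
          Breaks (retainedPts R n (Nat.log 2 n ^ 6) (2 * n * (Nat.log 2 n ^ 6 + 1) * b))
            {t | ∃ j, j < numDirections n ∧ τ j = t}) := by
  have hL1 : 0 < Nat.log 2 n := Nat.log_pos (by norm_num) hn
  refine Runs.seq ((runs_initProg hn h0 h).mono le_rfl ?_)
  rintro s1 ⟨hP1, h22, h25, hr1⟩
  refine Runs.seq ((runs_groups hn hP1 h22 h25 (hr1.trans hR)).mono le_rfl ?_)
  rintro s2 ⟨hP2, hcnt, hall⟩
  set L := Nat.log 2 n with hL
  set W := 2 * n * (L ^ 6 + 1) with hW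
  set M := s2.ireg 3 with hM
  set N := s2.ireg 25 with hN
  have hMW : M = W * L ^ 2 := hP2.r3
  have hNn : N ≤ L ^ 2 * n := hcnt.trans ((Finset.sum_le_card_nsmul _ _ n fun b _ =>
    card_retained_le _ _ _ _).trans_eq (by simp))
  have hWn : 2 * n ≤ W := Nat.le_mul_of_pos_right _ (by omega)
  have hMn : 2 * n * L ^ 2 ≤ M := by rw [hMW]; exact Nat.mul_le_mul_right _ hWn
  have hL2 : 0 < L ^ 2 := by positivity
  have hM2 : 2 * n ≤ M := (Nat.le_mul_of_pos_right _ hL2).trans hMn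
  have hNM : N ≤ M := hNn.trans (le_trans (by rw [mul_comm]; gcongr; omega) hMn)
  refine Runs.seq (((runs_fillProg hP2).frame (Q' := fun s3 => Params n s3 ∧ s3.rmem = s2.rmem ∧
    s3.ireg 2 = N ∧ ∀ x, x < N → s3.imem x = M + x) ?_).mono ?_ ?_)
  · rintro s3 t he ⟨hq1, hq2⟩
    refine ⟨hP2.of_exec he ?_, he.rmem_eq ?_, hq1, hq2⟩
    · rintro r (rfl | rfl | rfl | rfl | rfl | rfl | rfl | rfl) <;>
      simp [fillProg, block, Prog.All, Instr.KeepsI]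
    · simp [fillProg, block, Prog.All, Instr.KeepsRmem]
  · omega
  rintro s3 ⟨hP3, hr3, g2, hfill⟩
  -- There are at most L^2 * n slopes, and L^2 ≤ 2^(2L), n < 2^(L+1).
  have hK : N ≤ 2 ^ (3 * L + 1) := by
    have h1 : n < 2 ^ (L + 1) := Nat.lt_pow_succ_log_self (by norm_num) n
    have h2 : L ^ 2 ≤ (2 ^ L) ^ 2 := Nat.pow_le_pow_left (Nat.lt_two_pow_self).le 2
    calc N ≤ L ^ 2 * n := hNn
      _ ≤ (2 ^ L) ^ 2 * 2 ^ (L + 1) := Nat.mul_le_mul h2 h1.le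
      _ = 2 ^ (3 * L + 1) := by ring
  refine Runs.seq (((runs_sortProg (N := N) (M := M) (K := 3 * L + 1) hNM hK hP3.r1 hP3.r19 g2
    (hP3.r3.trans hP2.r3.symm)).frame (Q' := fun s4 => Params n s4 ∧ s4.rmem = s2.rmem ∧
      s4.ireg 2 = N ∧ cells s4.imem 0 N = cells s3.imem 0 N ∧ SortedOn s2.rmem s4.imem 0 N)
      ?_).mono ?_ ?_)
  · rintro s4 t he ⟨hq1, hq2⟩
    rw [he.ireg_eq (r := 2), he.rmem_eq]
    · refine ⟨hP3.of_exec he ?_, hr3, g2, hq1, hr3 ▸ hq2⟩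
      rintro r (rfl | rfl | rfl | rfl | rfl | rfl | rfl | rfl) <;>
      simp [sortProg, mergeBlocks, mergeProg, mergeStep, copyProg, block, Prog.All, Instr.KeepsI]
    all_goals simp [sortProg, mergeBlocks, mergeProg, mergeStep, copyProg, block, Prog.All,
      Instr.KeepsI, Instr.KeepsRmem]
  · have : (65 * N + 8) * (3 * L + 1) ≤ (65 * (L ^ 2 * n) + 8) * (3 * L + 1) :=
      Nat.mul_le_mul_right _ (by omega)
    exact Nat.add_le_add_right this 2
  rintro s4 ⟨hP4, hr4, f2, hc4, hs4⟩
  have hmem : ∀ a, a < N → M ≤ s4.imem a := fun a ha => by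
    have : s4.imem a ∈ cells s4.imem 0 N := mem_cells.2 ⟨a, Nat.zero_le _, ha, rfl⟩
    rw [hc4] at this
    obtain ⟨x, -, hx, hx'⟩ := mem_cells.1 this
    rw [← hx', hfill x hx]
    omega
  have hmem' : ∀ j, j < N → ∃ a, a < N ∧ s4.imem a = M + j := fun j hj => by
    have : M + j ∈ cells s4.imem 0 N := by
      rw [hc4]; exact mem_cells.2 ⟨j, Nat.zero_le _, hj, hfill j hj⟩
    obtain ⟨a, -, ha, h⟩ := mem_cells.1 this
    exact ⟨a, ha, h⟩
  have hk : numDirections n ≤ n := Nat.div_le_self _ _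
  refine Runs.seq (((runs_emitProg (N := N) (k := numDirections n) (base := M) hP4 f2 hP4.r26
    (by omega) hmem (hr4 ▸ hs4)).frame (Q' := fun s5 => Params n s5 ∧ s5.rreg 7 = 1 ∧
      s5.ireg 5 ≤ numDirections n ∧ s5.ireg 6 = 2 * s5.ireg 5 ∧
      ∃ τ, OutInv τ s5.rmem (s5.ireg 5) (s5.rreg 0) ∧
        (N ≤ numDirections n → ∀ a, a < N → ∃ j, j < s5.ireg 5 ∧ τ j = s4.rmem (s4.imem a)))
      ?_).mono ?_ ?_)
  · rintro s5 t he hq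
    refine ⟨hP4.of_exec he ?_, hq⟩
    rintro r (rfl | rfl | rfl | rfl | rfl | rfl | rfl | rfl) <;>
    simp [emitProg, emitBlock, block, Prog.All, Instr.KeepsI]
  · omega
  rintro s5 ⟨hP5, e7, e5, e6, τ, hO, hτ⟩
  refine (runs_padProg hP5.r1 hP5.r19 hP5.r26 e7 e5 e6 hO).mono (by simp only [numDirections] at *; omega) ?_
  rintro s6 ⟨hk6, τ', hττ, hO'⟩
  refine ⟨hk6, τ', _, hO', fun hsum b hb hd hne => (hall b hb hd hne).mono ?_⟩
  rintro _ ⟨j, hj, rfl⟩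
  obtain ⟨a, ha, hja⟩ := hmem' j hj
  obtain ⟨i, hi, hia⟩ := hτ (hcnt.trans hsum) a ha
  exact ⟨i, by omega, by rw [hττ i hi, hia, hja, hr4]⟩

end RealRAM

/-! ### The specification in terms of the samples -/

namespace CanonicalHull

open RealRAM

/-- Whether a point is retained, in terms of `k + 1` samples of the point: sample `1` has the unique
largest first coordinate among the samples `1, …, k`. -/
def Retains {k : ℕ} (z : Fin (k + 1) → ℝ × ℝ) : Prop :=
  ∀ t u : Fin (k + 1), (t : ℕ) = 1 → 2 ≤ (u : ℕ) → (z u).1 < (z t).1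

/-- Group `b` of the samples, indexed by the points. -/
def group {B k n : ℕ} (S : Fin (B * (k + 1)) → Fin n → ℝ × ℝ) (b : Fin B) :
    Fin n → Fin (k + 1) → ℝ × ℝ :=
  fun i t => S (finProdFinEquiv (b, t)) i

/-- The thinned sample of a group. -/
def thinned {k n : ℕ} (Z : Fin n → Fin (k + 1) → ℝ × ℝ) : Set (ℝ × ℝ) :=
  {q | ∃ i, Retains (Z i) ∧ Z i 0 = q}

open Classical in
/-- The number of points in the thinned sample of a group. -/
noncomputable def thinnedCount {k n : ℕ} (Z : Fin n → Fin (k + 1) → ℝ × ℝ) : ℕ :=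
  (Finset.univ.filter fun i => Retains (Z i)).card

theorem initStore_rmem {m n : ℕ} (S : Fin m → Fin n → ℝ × ℝ) (a : Fin m) (i : Fin n) :
    pt (initStore S).rmem (2 * (a * n + i)) = S a i := by
  have hn : 0 < n := i.pos
  have h1 : (2 * ((a : ℕ) * n + i)) / 2 = a * n + i := by omega
  have h2 : (2 * ((a : ℕ) * n + i) + 1) / 2 = a * n + i := by omega
  have h3 : ((a : ℕ) * n + i) / n = a := by
    rw [add_comm, Nat.add_mul_div_right _ _ hn, Nat.div_eq_of_lt i.2, zero_add]
  have h4 : ((a : ℕ) * n + i) % n = i := by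
    rw [add_comm, Nat.add_mul_mod_self_right, Nat.mod_eq_of_lt i.2]
  have h5 : (2 * ((a : ℕ) * n + i)) % 2 = 0 := by omega
  have h6 : (2 * ((a : ℕ) * n + i) + 1) % 2 = 1 := by omega
  simp only [pt, initStore, h1, h2, h3, h4, h5, h6]
  simp

/-- The cross product of two such unit vectors is a positive multiple of the difference of their
slopes. -/
theorem isDirectionSequence_dirOf {k : ℕ} {τ : Fin k → ℝ} (h : StrictMono τ) :
    IsDirectionSequence fun i => dirOf (τ i) := by
  have hpos : ∀ t : ℝ, 0 < √(t * t + 1) := fun t =>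
    Real.sqrt_pos.2 (by nlinarith [mul_self_nonneg t])
  refine ⟨fun i => ⟨?_, inv_pos.2 (hpos _)⟩, fun i j hij => ?_⟩
  · have := Real.sq_sqrt (show 0 ≤ τ i * τ i + 1 by nlinarith [mul_self_nonneg (τ i)])
    have h' : τ i * τ i + 1 ≠ 0 := by nlinarith [mul_self_nonneg (τ i)]
    simp only [dirOf, div_pow, inv_pow, this]
    field_simp
  · have : (dirOf (τ i)).1 * (dirOf (τ j)).2 - (dirOf (τ i)).2 * (dirOf (τ j)).1 =
        (τ i - τ j) * ((√(τ i * τ i + 1))⁻¹ * (√(τ j * τ j + 1))⁻¹) := by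
      simp only [dirOf]; ring
    rw [this]
    exact mul_neg_of_neg_of_pos (sub_neg.2 (h hij))
      (mul_pos (inv_pos.2 (hpos _)) (inv_pos.2 (hpos _)))

theorem pt_group {B k n : ℕ} (S : Fin (B * (k + 1)) → Fin n → ℝ × ℝ) (b : Fin B)
    (u : Fin (k + 1)) (i : Fin n) :
    pt (initStore S).rmem (2 * n * (k + 1) * b + 2 * i + u * (2 * n)) = group S b i u := by
  rw [group, ← initStore_rmem S, finProdFinEquiv_apply_val]
  congr 1
  ring

theorem pt_group_zero {B k n : ℕ} (S : Fin (B * (k + 1)) → Fin n → ℝ × ℝ) (b : Fin B)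
    (i : Fin n) : pt (initStore S).rmem (2 * n * (k + 1) * b + 2 * i) = group S b i 0 := by
  rw [← pt_group]; simp

theorem mem_retained_iff {B k n : ℕ} (hk : 1 ≤ k) (S : Fin (B * (k + 1)) → Fin n → ℝ × ℝ)
    (b : Fin B) (i : Fin n) :
    (i : ℕ) ∈ retained (initStore S).rmem n k (2 * n * (k + 1) * b) ↔ Retains (group S b i) := by
  rw [mem_retained]
  constructor
  · rintro ⟨-, h⟩ t u ht hu
    have := h (u - 1) (by omega) (by omega)
    rw [Nat.sub_add_cancel (by omega)] at this
    rw [← pt_group, ← pt_group, ht, one_mul]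
    exact this
  · refine fun h => ⟨i.2, fun t ht htk => ?_⟩
    have := h ⟨1, by omega⟩ ⟨t + 1, by omega⟩ rfl (by simpa using ht)
    rw [← pt_group, ← pt_group] at this
    simpa only [pt, one_mul] using this

theorem retainedPts_eq {B k n : ℕ} (hk : 1 ≤ k) (S : Fin (B * (k + 1)) → Fin n → ℝ × ℝ)
    (b : Fin B) :
    retainedPts (initStore S).rmem n k (2 * n * (k + 1) * b) = thinned (group S b) := by
  ext q
  constructor
  · rintro ⟨j, hj, rfl⟩
    have hjn := lt_of_mem_retained hj
    exact ⟨⟨j, hjn⟩, (mem_retained_iff hk S b ⟨j, hjn⟩).1 hj, (pt_group_zero S b ⟨j, hjn⟩).symm⟩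
  · rintro ⟨i, hi, rfl⟩
    exact ⟨i, (mem_retained_iff hk S b i).2 hi, pt_group_zero S b i⟩

theorem card_retained {B k n : ℕ} (hk : 1 ≤ k) (S : Fin (B * (k + 1)) → Fin n → ℝ × ℝ)
    (b : Fin B) :
    (retained (initStore S).rmem n k (2 * n * (k + 1) * b)).card = thinnedCount (group S b) := by
  classical
  rw [thinnedCount, ← Finset.card_map Fin.valEmbedding]
  congr 1
  ext j
  simp only [Finset.mem_map, Finset.mem_filter, Finset.mem_univ, true_and, Fin.valEmbedding_apply]
  constructor
  · intro hj
    exact ⟨⟨j, lt_of_mem_retained hj⟩,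
      (mem_retained_iff hk S b ⟨j, lt_of_mem_retained hj⟩).1 hj, rfl⟩
  · rintro ⟨i, hi, rfl⟩
    exact (mem_retained_iff hk S b i).2 hi

/-- The specification of `mainProg`. -/
theorem exists_output {n : ℕ} (hn : 2 ≤ n)
    (S : Fin (Nat.log 2 n ^ 2 * (Nat.log 2 n ^ 6 + 1)) → Fin n → ℝ × ℝ) :
    ∃ τ : Fin (numDirections n) → ℝ, StrictMono τ ∧
      OutputsWithin mainProg S (fun i => dirOf (τ i)) (mainTime n : ℝ) ∧
      ((∀ b i j, i ≠ j → (group S b i 0).1 ≠ (group S b j 0).1) →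
        ∑ b, thinnedCount (group S b) ≤ numDirections n →
        ∀ b, (thinned (group S b)).Nonempty → Breaks (thinned (group S b)) (Set.range τ)) := by
  have hk1 : 1 ≤ Nat.log 2 n ^ 6 := Nat.one_le_pow _ _ (Nat.log_pos (by norm_num) hn)
  obtain ⟨s', t, he, ht, hk, τ, last, hO, hB⟩ := runs_mainProg (s := initStore S) (R := _) hn rfl
    (fun r hr => by simp [initStore, hr]) rfl
  refine ⟨fun i => τ i, fun i j hij => hO.mono i j hij j.2,
    ⟨s', t, he, by exact_mod_cast ht, hk, fun i => ⟨hO.fst i i.2, hO.snd i i.2⟩⟩,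
    fun hd hsum b hne => ?_⟩
  rw [← retainedPts_eq hk1]
  refine (hB ?_ b b.2 ?_ ?_).mono ?_
  · rw [Finset.sum_range]
    simpa only [card_retained hk1] using hsum
  · intro i hi j hj hij
    have := hd b ⟨i, lt_of_mem_retained hi⟩ ⟨j, lt_of_mem_retained hj⟩ (by simpa using hij)
    rwa [← pt_group_zero, ← pt_group_zero] at this
  · obtain ⟨_, i, hi, rfl⟩ := hne
    exact ⟨i, (mem_retained_iff hk1 S b i).2 hi⟩
  · rintro _ ⟨j, hj, rfl⟩
    exact ⟨⟨j, hj⟩, rfl⟩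

end CanonicalHull

namespace CanonicalHull

/-! ### Extremal points for consecutive directions -/

theorem dot_dirOf (p : ℝ × ℝ) (t : ℝ) :
    dot p (RealRAM.dirOf t) = val t p * (√(t * t + 1))⁻¹ := by
  rw [dot, RealRAM.dirOf, val]; ring

theorem dot_dirOf_le {p q : ℝ × ℝ} {t : ℝ} :
    dot p (RealRAM.dirOf t) ≤ dot q (RealRAM.dirOf t) ↔ val t p ≤ val t q := by
  rw [dot_dirOf, dot_dirOf, mul_le_mul_iff_left₀]
  exact inv_pos.2 (Real.sqrt_pos.2 (by nlinarith [mul_self_nonneg t]))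

/-- The lexicographic tie-break plays no role in the analysis: all that is used is that the extremal
point is an input point that attains the maximum. -/
theorem exists_extremalPoint {n : ℕ} (hn : 0 < n) (P : Fin n → ℝ × ℝ) (v : ℝ × ℝ) :
    ∃ j, extremalPoint P v = P j ∧ ∀ l, dot (P l) v ≤ dot (P j) v := by
  classical
  have : Nonempty (Fin n) := ⟨⟨0, hn⟩⟩
  obtain ⟨j₀, hj₀⟩ := Finite.exists_max fun j => dot (P j) v
  set F : Finset (ℝ ×ₗ ℝ) := (Finset.univ.image fun j => toLex (P j)).filter
    fun q => ∀ j, dot (P j) v ≤ dot (ofLex q) v with hF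
  have hne : F.Nonempty := ⟨toLex (P j₀), by simpa [hF] using hj₀⟩
  have he : extremalPoint P v = ofLex (F.min' hne) := by
    unfold extremalPoint
    convert dif_pos hne using 1
  obtain ⟨hm, hmax⟩ := Finset.mem_filter.1 (F.min'_mem hne)
  obtain ⟨j, -, hj⟩ := Finset.mem_image.1 hm
  refine ⟨j, by rw [he, ← hj, ofLex_toLex], fun l => ?_⟩
  have := hmax l
  rwa [← hj, ofLex_toLex] at this

section Sequence

variable {n K : ℕ} {τ : Fin K → ℝ} {P : Fin n → ℝ × ℝ}

/-- The extremal points for the extended direction sequence with slopes `τ`. -/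
noncomputable def extremalSeq (τ : Fin K → ℝ) (P : Fin n → ℝ × ℝ) (i : Fin (K + 2)) : ℝ × ℝ :=
  extremalPoint P (withHorizontals (fun i => RealRAM.dirOf (τ i)) i)

theorem extremalSeq_mem (hn : 0 < n) (i : Fin (K + 2)) : ∃ j, extremalSeq τ P i = P j := by
  obtain ⟨j, hj, -⟩ := exists_extremalPoint hn P (withHorizontals (fun i => RealRAM.dirOf (τ i)) i)
  exact ⟨j, hj⟩

theorem extremalSeq_zero_le (hn : 0 < n) (l : Fin n) : (extremalSeq τ P 0).1 ≤ (P l).1 := by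
  obtain ⟨j, hj, hmax⟩ := exists_extremalPoint hn P (withHorizontals (fun i => RealRAM.dirOf (τ i)) 0)
  have h0 : withHorizontals (fun i => RealRAM.dirOf (τ i)) 0 = (-1, 0) := by
    rw [withHorizontals, ← Fin.castSucc_zero, Fin.snoc_castSucc, Fin.cons_zero]
  have := hmax l
  rw [h0, dot, dot] at this
  rw [extremalSeq, hj]
  simp only at this
  linarith

theorem le_extremalSeq_last (hn : 0 < n) (l : Fin n) :
    (P l).1 ≤ (extremalSeq τ P (Fin.last (K + 1))).1 := by
  obtain ⟨j, hj, hmax⟩ := exists_extremalPoint hn P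
    (withHorizontals (fun i => RealRAM.dirOf (τ i)) (Fin.last (K + 1)))
  have h0 : withHorizontals (fun i => RealRAM.dirOf (τ i)) (Fin.last (K + 1)) = (1, 0) := by
    rw [withHorizontals, Fin.snoc_last]
  have := hmax l
  rw [h0, dot, dot] at this
  rw [extremalSeq, hj]
  simp only at this
  linarith

theorem val_le_extremalSeq (hn : 0 < n) (i : Fin K) (l : Fin n) :
    val (τ i) (P l) ≤ val (τ i) (extremalSeq τ P i.succ.castSucc) := by
  obtain ⟨j, hj, hmax⟩ := exists_extremalPoint hn P
    (withHorizontals (fun i => RealRAM.dirOf (τ i)) i.succ.castSucc)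
  have h0 : withHorizontals (fun i => RealRAM.dirOf (τ i)) i.succ.castSucc =
      RealRAM.dirOf (τ i) := by
    rw [withHorizontals, Fin.snoc_castSucc, Fin.cons_succ]
  have := hmax l
  rw [h0, dot_dirOf_le] at this
  rwa [extremalSeq, hj]

/-- Adding the two maximality conditions for consecutive slopes gives that the product of the slope
difference and the difference of the first coordinates is nonnegative. The two horizontal directions
give the leftmost and the rightmost point. -/
theorem extremalSeq_mono (hn : 0 < n) (hτ : StrictMono τ) :
    Monotone fun i => (extremalSeq τ P i).1 := by
  refine Fin.monotone_iff_le_succ.2 fun i => ?_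
  refine Fin.cases ?_ (fun i => ?_) i
  · obtain ⟨j, hj⟩ := extremalSeq_mem (τ := τ) (P := P) hn (Fin.succ 0)
    rw [hj]
    exact extremalSeq_zero_le hn j
  · rcases Fin.eq_castSucc_or_eq_last i.succ with ⟨i', hi'⟩ | hl
    · obtain ⟨a, ha⟩ := extremalSeq_mem (τ := τ) (P := P) hn i.succ.castSucc
      have hi'0 : (i' : ℕ) = i + 1 := by
        have := congrArg Fin.val hi'
        simpa using this.symm
      have hsucc : i.succ.succ = i'.succ.castSucc := by
        ext; simp [hi'0]
      obtain ⟨b, hb⟩ := extremalSeq_mem (τ := τ) (P := P) hn i'.succ.castSucc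
      have h1 := val_le_extremalSeq (τ := τ) (P := P) hn i b
      have h2 := val_le_extremalSeq (τ := τ) (P := P) hn i' a
      have hlt : τ i < τ i' := hτ (Fin.lt_def.2 (by omega))
      rw [hsucc]
      rw [← hb] at h1
      rw [← ha] at h2
      simp only [val] at h1 h2
      by_contra! hc
      nlinarith
    · obtain ⟨a, ha⟩ := extremalSeq_mem (τ := τ) (P := P) hn i.succ.castSucc
      rw [ha, hl, Fin.succ_last]
      exact le_extremalSeq_last hn a

theorem fst_mem_of_mem_upperSemislab {p q r : ℝ × ℝ} (h : r ∈ upperSemislab p q)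
    (hpq : p.1 ≤ q.1) : p.1 < r.1 ∧ r.1 < q.1 := by
  obtain ⟨hne, s, ⟨a, b, ha, hb, hab, rfl⟩, hs, -⟩ := h
  have hlt := lt_of_le_of_ne hpq hne
  have : r.1 = a * p.1 + b * q.1 := by rw [← hs]; simp
  obtain rfl : a = 1 - b := by linarith
  constructor <;> nlinarith [mul_pos hb (sub_pos.2 hlt), mul_pos ha (sub_pos.2 hlt)]

/-- The region between consecutive extremal points. -/
def slab (τ : Fin K → ℝ) (P : Fin n → ℝ × ℝ) (i : Fin (K + 1)) : Set (ℝ × ℝ) :=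
  upperSemislab (extremalSeq τ P i.castSucc) (extremalSeq τ P i.succ)

theorem fst_mem_of_mem_slab (hn : 0 < n) (hτ : StrictMono τ) {i : Fin (K + 1)} {r : ℝ × ℝ}
    (h : r ∈ slab τ P i) :
    (extremalSeq τ P i.castSucc).1 < r.1 ∧ r.1 < (extremalSeq τ P i.succ).1 :=
  fst_mem_of_mem_upperSemislab h (extremalSeq_mono hn hτ (Fin.castSucc_lt_succ).le)

theorem pointCount_eq (P : Fin n → ℝ × ℝ) (R : Set (ℝ × ℝ)) [DecidablePred fun j => P j ∈ R] :
    pointCount P R = (Finset.univ.filter fun j => P j ∈ R).card := by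
  rw [pointCount, Nat.card_eq_fintype_card, Fintype.card_subtype]

/-- The slabs have disjoint open x-ranges, so no point is counted twice. -/
theorem sum_pointCount_le (hn : 0 < n) (hτ : StrictMono τ) :
    ∑ i, pointCount P (slab τ P i) ≤ n := by
  classical
  simp only [pointCount_eq]
  rw [← Finset.card_biUnion]
  · exact (Finset.card_le_univ _).trans_eq (Fintype.card_fin n)
  · have key : ∀ i i' : Fin (K + 1), i < i' → ∀ j, P j ∈ slab τ P i → P j ∉ slab τ P i' := by
      intro i i' hii j h h'
      have h1 := (fst_mem_of_mem_slab hn hτ h).2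
      have h2 := (fst_mem_of_mem_slab hn hτ h').1
      have h3 : (extremalSeq τ P i.succ).1 ≤ (extremalSeq τ P i'.castSucc).1 :=
        extremalSeq_mono hn hτ (Fin.le_def.2 (by simp; omega))
      linarith
    intro i _ i' _ hii
    rw [Function.onFun, Finset.disjoint_left]
    intro j hj hj'
    rw [Finset.mem_filter] at hj hj'
    rcases lt_or_gt_of_ne hii with h | h
    · exact key i i' h j hj.2 hj'.2
    · exact key i' i h j hj'.2 hj.2

/-- This reduces the theorem to a uniform bound on the extremal points of one slab; with M = n it
also gives the fallback on bad events. -/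
theorem semislabCost_le (hn : 0 < n) (hτ : StrictMono τ) {M : ℕ}
    (hM : ∀ i, extremalCount P (slab τ P i) ≤ M) :
    semislabCost (fun i => RealRAM.dirOf (τ i)) P ≤ n * Real.log (M + 1) := by
  have hlog : 0 ≤ Real.log ((M : ℝ) + 1) := Real.log_nonneg (by simp)
  calc semislabCost (fun i => RealRAM.dirOf (τ i)) P
      = ∑ i, (pointCount P (slab τ P i) : ℝ) * Real.log (extremalCount P (slab τ P i) + 1) := rfl
    _ ≤ ∑ i, (pointCount P (slab τ P i) : ℝ) * Real.log (M + 1) := by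
        refine Finset.sum_le_sum fun i _ => mul_le_mul_of_nonneg_left
          (Real.log_le_log (by positivity) ?_) (Nat.cast_nonneg _)
        have := hM i
        gcongr
    _ = ((∑ i, pointCount P (slab τ P i) : ℕ) : ℝ) * Real.log (M + 1) := by
        rw [← Finset.sum_mul]; push_cast; rfl
    _ ≤ n * Real.log (M + 1) := by
        refine mul_le_mul_of_nonneg_right ?_ hlog
        exact_mod_cast sum_pointCount_le hn hτ

theorem extremalCount_le_card (P : Fin n → ℝ × ℝ) (R : Set (ℝ × ℝ)) : extremalCount P R ≤ n := by
  rw [extremalCount]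
  exact (Nat.card_le_card_of_injective _ Subtype.val_injective).trans_eq (Nat.card_fin n)

/-! ### Supporting lines -/

/-- A point of the upper hull with points on both sides has a supporting line. -/
theorem exists_val_le {j : Fin n} (hP : P j ∈ upperHull P) {a : Fin n} (ha : (P a).1 < (P j).1) :
    ∃ t, ∀ l, val t (P l) ≤ val t (P j) := by
  classical
  set F := Finset.univ.filter fun l => (P l).1 < (P j).1 with hF
  -- The supporting line is the tangent from `P j` to the points on its left, which passes through
  -- `P m`.
  obtain ⟨m, hm, hmax⟩ := F.exists_max_image
    (fun l => ((P l).2 - (P j).2) / ((P j).1 - (P l).1)) ⟨a, by simp [hF, ha]⟩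
  have hm' : (P m).1 < (P j).1 := by simpa [hF] using hm
  have hdm : 0 < (P j).1 - (P m).1 := sub_pos.2 hm'
  set t := ((P m).2 - (P j).2) / ((P j).1 - (P m).1) with ht
  have htm : t * ((P j).1 - (P m).1) = (P m).2 - (P j).2 := div_mul_cancel₀ _ hdm.ne'
  refine ⟨t, fun l => ?_⟩
  rcases lt_trichotomy (P l).1 (P j).1 with h | h | h
  · have h1 := hmax l (by simp [hF, h])
    rw [div_le_iff₀ (sub_pos.2 h)] at h1
    simp only [val]
    linarith
  · have := hP.2 (P l) (subset_convexHull ℝ _ ⟨l, rfl⟩) h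
    simp only [val, h]
    linarith
  -- If a point on the right were above this tangent, its segment to `P m` would pass strictly above
  -- `P j`, inside the convex hull.
  · by_contra! hc
    simp only [val] at hc
    set d := (P l).1 - (P m).1 with hd
    have hdpos : 0 < d := by linarith
    set α := ((P l).1 - (P j).1) / d with hα
    set β := ((P j).1 - (P m).1) / d with hβ
    have hαβ : α + β = 1 := by
      rw [hα, hβ, ← add_div, div_eq_one_iff_eq hdpos.ne']; ring
    have hα' : α * d = (P l).1 - (P j).1 := div_mul_cancel₀ _ hdpos.ne'
    have hβ' : β * d = (P j).1 - (P m).1 := div_mul_cancel₀ _ hdpos.ne'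
    have hz : α • P m + β • P l ∈ convexHull ℝ (Set.range P) :=
      convex_convexHull ℝ _ (subset_convexHull ℝ _ (Set.mem_range_self m))
        (subset_convexHull ℝ _ (Set.mem_range_self l))
        (div_nonneg (by linarith) hdpos.le) (div_nonneg (by linarith) hdpos.le) hαβ
    have h1 : α * (P m).1 + β * (P l).1 = (P j).1 := by
      have : d * (α * (P m).1 + β * (P l).1) = d * (P j).1 := by
        calc d * (α * (P m).1 + β * (P l).1) = (α * d) * (P m).1 + (β * d) * (P l).1 := by ring
          _ = d * (P j).1 := by rw [hα', hβ', hd]; ring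
      exact mul_left_cancel₀ hdpos.ne' this
    have h2 := hP.2 _ hz (by simpa using h1)
    simp only [Prod.snd_add, Prod.smul_snd, smul_eq_mul] at h2
    have hβpos : 0 < β := div_pos hdm hdpos
    have h3 := mul_pos hβpos (sub_pos.2 hc)
    have h4 : α * ((P m).2 - (P j).2) = α * (t * ((P j).1 - (P m).1)) := by rw [htm]
    have h5 : t * (α * (P m).1 + β * (P l).1) = t * (P j).1 := by rw [h1]
    have h6 : (α + β) * (t * (P j).1 + (P j).2) = t * (P j).1 + (P j).2 := by
      rw [hαβ, one_mul]
    nlinarith [h3, h4, h5, h6]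

end Sequence

end CanonicalHull

namespace CanonicalHull

/-! ### Half-planes spanned by pairs of points -/

section HalfPlanes

variable {n : ℕ} {ι : Type*} {X : ι → ℝ × ℝ}

/-- The sign of a side: `1` on the right and `-1` on the left. -/
def sideSign (σ : Bool) : ℝ := if σ then 1 else -1

theorem sideSign_mul_self (σ : Bool) : sideSign σ * sideSign σ = 1 := by
  cases σ <;> simp [sideSign]

/-- A normal vector to the line through two points, or to a vertical line. -/
def normalVec (X : ι → ℝ × ℝ) (j : ι) (o : Option ι) (σ : Bool) : ℝ × ℝ :=
  match o with
  | none => (sideSign σ, 0)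
  | some l => (sideSign σ * ((X j).2 - (X l).2), sideSign σ * ((X l).1 - (X j).1))

/-- The open half-plane with boundary through `X j` and the inner normal vector
`normalVec X j o σ`. -/
def openHalf (X : ι → ℝ × ℝ) (j : ι) (o : Option ι) (σ : Bool) : Set (ℝ × ℝ) :=
  {q | 0 < (normalVec X j o σ).1 * (q.1 - (X j).1) + (normalVec X j o σ).2 * (q.2 - (X j).2)}

/-- The closed half-plane with boundary through `X j` and the inner normal vector
`normalVec X j o σ`. -/
def closedHalf (X : ι → ℝ × ℝ) (j : ι) (o : Option ι) (σ : Bool) : Set (ℝ × ℝ) :=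
  {q | 0 ≤ (normalVec X j o σ).1 * (q.1 - (X j).1) + (normalVec X j o σ).2 * (q.2 - (X j).2)}

/-- If `X j` maximizes `val t` over `X '' A` for all slopes `t` of an interval, then a half-plane at
`X j` that is avoided by `X '' A` contains, on the side `σ` of `X j`, all points that lie above a
line through `X j` whose slope is in the interval. -/
theorem exists_avoided_half [Finite ι] {A : Set ι} {j : ι} {t₁ t₂ : ℝ} (ht : t₁ ≤ t₂)
    (h₁ : ∀ l ∈ A, val t₁ (X l) ≤ val t₁ (X j)) (h₂ : ∀ l ∈ A, val t₂ (X l) ≤ val t₂ (X j))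
    (σ : Bool) :
    ∃ o, normalVec X j o σ ≠ 0 ∧ (∀ l ∈ A, X l ∉ openHalf X j o σ) ∧
      ∀ τ, t₁ ≤ τ → τ ≤ t₂ → ∀ q : ℝ × ℝ, 0 ≤ sideSign σ * (q.1 - (X j).1) →
        (val τ (X j) ≤ val τ q → q ∈ closedHalf X j o σ) ∧
        ((∃ l ∈ A, 0 < sideSign σ * ((X l).1 - (X j).1)) → val τ (X j) < val τ q →
          q ∈ openHalf X j o σ) := by
  classical
  have := Fintype.ofFinite ι
  have hs := sideSign_mul_self σ
  set s := sideSign σ with hsdef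
  set F := Finset.univ.filter fun l => l ∈ A ∧ 0 < s * ((X l).1 - (X j).1) with hF
  -- Without points of `A` on the side σ the vertical half-plane is avoided. Otherwise the boundary
  -- passes through the point on that side seen from `X j` at the steepest upward angle.
  rcases F.eq_empty_or_nonempty with he | hne
  · have hA : ∀ l ∈ A, s * ((X l).1 - (X j).1) ≤ 0 := by
      intro l hl
      by_contra! hc
      exact Finset.notMem_empty l (he ▸ Finset.mem_filter.2 ⟨Finset.mem_univ _, hl, hc⟩)
    refine ⟨none, ?_, fun l hl => ?_, fun τ _ _ q hq => ⟨fun _ => ?_, ?_⟩⟩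
    · intro h0
      have h1 : s = 0 := congrArg Prod.fst h0
      rw [h1] at hs
      simp at hs
    · simpa [openHalf, normalVec] using hA l hl
    · simpa [closedHalf, normalVec] using hq
    · rintro ⟨l, hl, hl'⟩
      exact absurd (hA l hl) (not_le.2 hl')
  · obtain ⟨m, hm, hmin⟩ := F.exists_min_image
      (fun l => ((X j).2 - (X l).2) / (s * ((X l).1 - (X j).1))) hne
    obtain ⟨-, hmA, hd⟩ := Finset.mem_filter.1 hm
    set d := s * ((X m).1 - (X j).1) with hdd
    set μ := ((X j).2 - (X m).2) / d with hμ
    have hμd : μ * d = (X j).2 - (X m).2 := div_mul_cancel₀ _ hd.ne'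
    have key : ∀ q : ℝ × ℝ, (normalVec X j (some m) σ).1 * (q.1 - (X j).1) +
        (normalVec X j (some m) σ).2 * (q.2 - (X j).2) =
          d * (s * μ * (q.1 - (X j).1) + (q.2 - (X j).2)) := by
      intro q
      simp only [normalVec, ← hμd, ← hsdef]
      rw [hdd]
      ring
    have hτμ : ∀ τ, t₁ ≤ τ → τ ≤ t₂ → s * τ ≤ μ := by
      intro τ h1 h2
      rw [hμ, le_div_iff₀ hd, hdd]
      have h3 := h₁ m hmA
      have h4 := h₂ m hmA
      simp only [val] at h3 h4
      have h5 : s * τ * (s * ((X m).1 - (X j).1)) = (s * s) * (τ * ((X m).1 - (X j).1)) := by ring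
      rw [h5, hs, one_mul]
      rcases le_total ((X m).1 - (X j).1) 0 with h | h
      · nlinarith
      · nlinarith
    -- Height above the chosen boundary is height above the level line of `val τ` plus a term whose
    -- sign, since s * τ ≤ μ, depends only on the side of q.
    have hval : ∀ τ (q : ℝ × ℝ), s * μ * (q.1 - (X j).1) + (q.2 - (X j).2) =
        (val τ q - val τ (X j)) + (μ - s * τ) * (s * (q.1 - (X j).1)) := by
      intro τ q
      simp only [val]
      linear_combination (τ * (q.1 - (X j).1)) * hs
    refine ⟨some m, ?_, fun l hl => ?_, fun τ h1 h2 q hq => ⟨fun hv => ?_, fun _ hv => ?_⟩⟩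
    · intro h0
      have h1 : s * ((X m).1 - (X j).1) = 0 := congrArg Prod.snd h0
      exact hd.ne' h1
    · simp only [openHalf, Set.mem_ofPred_eq, key, not_lt]
      refine mul_nonpos_of_nonneg_of_nonpos hd.le ?_
      rcases lt_or_ge 0 (s * ((X l).1 - (X j).1)) with hp | hp
      · have h1 := hmin l (Finset.mem_filter.2 ⟨Finset.mem_univ _, hl, hp⟩)
        rw [le_div_iff₀ hp] at h1
        linarith
      · rw [hval t₁]
        have h3 := h₁ l hl
        have h4 := hτμ t₁ le_rfl ht
        nlinarith
    · simp only [closedHalf, Set.mem_ofPred_eq, key]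
      rw [hval τ]
      have h4 := hτμ τ h1 h2
      exact mul_nonneg hd.le (add_nonneg (by linarith) (mul_nonneg (by linarith) hq))
    · simp only [openHalf, Set.mem_ofPred_eq, key]
      rw [hval τ]
      have h4 := hτμ τ h1 h2
      exact mul_pos hd (add_pos_of_pos_of_nonneg (by linarith) (mul_nonneg (by linarith) hq))

end HalfPlanes

/-! ### The number of extremal points in a semislab -/

section Count

variable {n K B : ℕ} {τ : Fin K → ℝ} {P : Fin n → ℝ × ℝ}

/-- The slopes of the supporting lines at an extremal point of a slab lie between the slopes of the
slab. -/
theorem slope_of_mem_slab (hn : 0 < n) (hτ : StrictMono τ) {i : Fin (K + 1)} {j : Fin n}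
    (hj : P j ∈ slab τ P i) {t : ℝ} (ht : ∀ l, val t (P l) ≤ val t (P j)) (m : Fin K) :
    ((m : ℕ) < i → τ m ≤ t) ∧ ((i : ℕ) ≤ m → t ≤ τ m) := by
  obtain ⟨hl, hr⟩ := fst_mem_of_mem_slab hn hτ hj
  have hm := val_le_extremalSeq (τ := τ) (P := P) hn m j
  obtain ⟨e, he⟩ := extremalSeq_mem (τ := τ) (P := P) hn m.succ.castSucc
  have h2 := ht e
  rw [← he] at h2
  simp only [val] at hm h2
  constructor
  · intro h
    have h1 : (extremalSeq τ P m.succ.castSucc).1 ≤ (extremalSeq τ P i.castSucc).1 :=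
      extremalSeq_mono hn hτ (Fin.le_def.2 (by simp; omega))
    by_contra! hc
    nlinarith
  · intro h
    have h1 : (extremalSeq τ P i.succ).1 ≤ (extremalSeq τ P m.succ.castSucc).1 :=
      extremalSeq_mono hn hτ (Fin.le_def.2 (by simp; omega))
    by_contra! hc
    nlinarith

theorem exists_slope_of_mem_slab (hn : 0 < n) (hτ : StrictMono τ) {i : Fin (K + 1)} {j : Fin n}
    (hj : P j ∈ slab τ P i) (hP : P j ∈ upperHull P) :
    ∃ t, ∀ l, val t (P l) ≤ val t (P j) := by
  obtain ⟨a, ha⟩ := extremalSeq_mem (τ := τ) (P := P) hn i.castSucc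
  exact exists_val_le hP (a := a) (ha ▸ (fst_mem_of_mem_slab hn hτ hj).1)

/-- Every extremal point of the slab is charged to a sample b that avoids both half-planes at it. It
then lies in one of the two closed half-planes at the common maximizer of that sample. There are B
samples, two sides, and at most c points of `P` in each such half-plane. -/
theorem extremalCount_slab_le (hn : 0 < n) (hτ : StrictMono τ) {X : Fin B → Fin n → ℝ × ℝ}
    {A : Fin B → Set (Fin n)} {c : ℕ}
    (h₁ : ∀ j o₁ o₂, (∀ l, P l ∉ openHalf P j o₁ true) → (∀ l, P l ∉ openHalf P j o₂ false) →
      ∃ b, ∀ l ∈ A b, X b l ∉ openHalf P j o₁ true ∧ X b l ∉ openHalf P j o₂ false)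
    (h₂ : ∀ b j o σ, normalVec (X b) j o σ ≠ 0 → (∀ l ∈ A b, X b l ∉ openHalf (X b) j o σ) →
      Nat.card {l // P l ∈ closedHalf (X b) j o σ} ≤ c)
    (h₃ : ∀ b, Breaks (X b '' A b) (Set.range τ)) (i : Fin (K + 1)) :
    extremalCount P (slab τ P i) ≤ B * (2 * c) := by
  classical
  set E := Finset.univ.filter fun j => P j ∈ slab τ P i ∧ P j ∈ upperHull P with hE
  have hcard : extremalCount P (slab τ P i) = E.card := by
    rw [extremalCount, Nat.card_eq_fintype_card, Fintype.card_subtype]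
  rw [hcard]
  rcases E.eq_empty_or_nonempty with he | hne
  · simp [he]
  have hmem : ∀ j ∈ E, P j ∈ slab τ P i ∧ P j ∈ upperHull P := fun j hj => (Finset.mem_filter.1 hj).2
  have hex : ∀ j, ∃ t, j ∈ E → ∀ l, val t (P l) ≤ val t (P j) := fun j => by
    by_cases hj : j ∈ E
    · obtain ⟨t, ht⟩ := exists_slope_of_mem_slab hn hτ (hmem j hj).1 (hmem j hj).2
      exact ⟨t, fun _ => ht⟩
    · exact ⟨0, fun h => absurd h hj⟩
  choose t ht using hex
  -- No output slope lies strictly between the smallest and the largest supporting slope of the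
  -- slab, so one point of each sample is maximal for both.
  obtain ⟨j₁, hj₁, hmin⟩ := E.exists_min_image t hne
  obtain ⟨j₂, hj₂, hmax⟩ := E.exists_max_image t hne
  have hbreak : ∀ a ∈ Set.range τ, t j₁ < a → t j₂ ≤ a := by
    rintro _ ⟨m, rfl⟩ hlt
    refine (slope_of_mem_slab hn hτ (hmem _ hj₂).1 (ht _ hj₂) m).2 ?_
    by_contra! hc
    exact absurd ((slope_of_mem_slab hn hτ (hmem _ hj₁).1 (ht _ hj₁) m).1 hc) (not_le.2 hlt)
  have hr : ∀ b, ∃ r ∈ A b, ∀ l ∈ A b, val (t j₁) (X b l) ≤ val (t j₁) (X b r) ∧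
      val (t j₂) (X b l) ≤ val (t j₂) (X b r) := by
    intro b
    obtain ⟨_, ⟨r, hr, rfl⟩, hr'⟩ := h₃ b _ _ (hmin _ hj₂) hbreak
    exact ⟨r, hr, fun l hl => hr' _ ⟨l, hl, rfl⟩⟩
  choose r hrA hrmax using hr
  have ho : ∀ b σ, ∃ o, normalVec (X b) (r b) o σ ≠ 0 ∧
      (∀ l ∈ A b, X b l ∉ openHalf (X b) (r b) o σ) ∧
      ∀ u, t j₁ ≤ u → u ≤ t j₂ → ∀ q : ℝ × ℝ, 0 ≤ sideSign σ * (q.1 - (X b (r b)).1) →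
        val u (X b (r b)) ≤ val u q → q ∈ closedHalf (X b) (r b) o σ := by
    intro b σ
    obtain ⟨o, h1, h2, h3⟩ := exists_avoided_half (X := X b) (A := A b) (j := r b)
      (hmin _ hj₂) (fun l hl => (hrmax b l hl).1) (fun l hl => (hrmax b l hl).2) σ
    exact ⟨o, h1, h2, fun u hu hu' q hq => (h3 u hu hu' q hq).1⟩
  choose o ho1 ho2 ho3 using ho
  have hsub : E ⊆ Finset.univ.biUnion fun b : Fin B =>
      (Finset.univ.filter fun l => P l ∈ closedHalf (X b) (r b) (o b true) true) ∪
      (Finset.univ.filter fun l => P l ∈ closedHalf (X b) (r b) (o b false) false) := by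
    intro j hj
    obtain ⟨hslab, hhull⟩ := hmem j hj
    have htj := ht j hj
    obtain ⟨hleft, hright⟩ := fst_mem_of_mem_slab hn hτ hslab
    obtain ⟨a, ha⟩ := extremalSeq_mem (τ := τ) (P := P) hn i.castSucc
    obtain ⟨a', ha'⟩ := extremalSeq_mem (τ := τ) (P := P) hn i.succ
    rw [ha] at hleft
    rw [ha'] at hright
    obtain ⟨o₁, -, h1, h1'⟩ := exists_avoided_half (X := P) (A := Set.univ) (j := j)
      (le_refl (t j)) (fun l _ => htj l) (fun l _ => htj l) true
    obtain ⟨o₂, -, h2, h2'⟩ := exists_avoided_half (X := P) (A := Set.univ) (j := j)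
      (le_refl (t j)) (fun l _ => htj l) (fun l _ => htj l) false
    obtain ⟨b, hb⟩ := h₁ j o₁ o₂ (fun l => h1 l trivial) (fun l => h2 l trivial)
    -- A point strictly above the supporting line lies in the open half-plane on its own side. This
    -- needs input points on both sides of `P j`, which the two extremal points bounding the slab
    -- provide.
    have hv : val (t j) (X b (r b)) ≤ val (t j) (P j) := by
      by_contra! hc
      rcases le_total (P j).1 (X b (r b)).1 with h | h
      · exact (hb _ (hrA b)).1 ((h1' _ le_rfl le_rfl (X b (r b)) (by simpa [sideSign] using h)).2
          ⟨a', trivial, by simpa [sideSign] using hright⟩ hc)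
      · exact (hb _ (hrA b)).2 ((h2' _ le_rfl le_rfl (X b (r b)) (by simpa [sideSign] using h)).2
          ⟨a, trivial, by simpa [sideSign] using hleft⟩ hc)
    refine Finset.mem_biUnion.2 ⟨b, Finset.mem_univ _, Finset.mem_union.2 ?_⟩
    rcases le_total (X b (r b)).1 (P j).1 with h | h
    · exact Or.inl (Finset.mem_filter.2 ⟨Finset.mem_univ _,
        ho3 b true _ (hmin _ hj) (hmax _ hj) _ (by simpa [sideSign] using h) hv⟩)
    · exact Or.inr (Finset.mem_filter.2 ⟨Finset.mem_univ _,
        ho3 b false _ (hmin _ hj) (hmax _ hj) _ (by simpa [sideSign] using h) hv⟩)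
  have hcc : ∀ b σ, (Finset.univ.filter fun l => P l ∈ closedHalf (X b) (r b) (o b σ) σ).card ≤ c := by
    intro b σ
    have := h₂ b (r b) (o b σ) σ (ho1 b σ) (ho2 b σ)
    rwa [Nat.card_eq_fintype_card, Fintype.card_subtype] at this
  refine (Finset.card_le_card hsub).trans ((Finset.card_biUnion_le_card_mul _ _ (2 * c) ?_).trans_eq
    (by rw [Finset.card_univ, Fintype.card_fin]))
  intro b _
  refine (Finset.card_union_le _ _).trans ?_
  have h1 := hcc b true
  have h2 := hcc b false
  omega

end Count

end CanonicalHull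

/-! ### Product measures -/

section Product

variable {α β : Type*} [MeasurableSpace α] [MeasurableSpace β]

theorem prod_le_of_section {μ : Measure α} {ν : Measure β} [IsProbabilityMeasure μ] [SFinite ν]
    {E : Set (α × β)} (hE : MeasurableSet E) {c : ENNReal} (h : ∀ x, ν {y | (x, y) ∈ E} ≤ c) :
    μ.prod ν E ≤ c := by
  rw [Measure.prod_apply hE]
  calc ∫⁻ x, ν (Prod.mk x ⁻¹' E) ∂μ ≤ ∫⁻ _, c ∂μ := lintegral_mono h
    _ = c := by simp

/-- A set of small measure in a product has few sections of large measure. -/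
theorem measure_section_gt_le {μ : Measure α} {ν : Measure β} [SFinite ν] {E : Set (α × β)}
    (hE : MeasurableSet E) {ε : ENNReal} (hε : ε ≠ 0) (hε' : ε ≠ ⊤) :
    μ {x | ε < ν (Prod.mk x ⁻¹' E)} ≤ (μ.prod ν E) / ε := by
  rw [Measure.prod_apply hE]
  have hsub : {x | ε < ν (Prod.mk x ⁻¹' E)} ⊆ {x | ε ≤ ν (Prod.mk x ⁻¹' E)} :=
    fun x (hx : ε < _) => hx.le
  exact (measure_mono hsub).trans
    (meas_ge_le_lintegral_div (measurable_measure_prodMk_left hE).aemeasurable hε hε')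

end Product

section Pi

section Equiv

variable {ι : Type*} {α : ι → Type*} [∀ i, MeasurableSpace (α i)]

theorem piEquivPiSubtypeProd_symm_pos (p : ι → Prop) [DecidablePred p]
    (y : (∀ i : {i // p i}, α i) × ∀ i : {i // ¬ p i}, α i) {i : ι} (hi : p i) :
    (MeasurableEquiv.piEquivPiSubtypeProd α p).symm y i = y.1 ⟨i, hi⟩ := by
  change (Equiv.piEquivPiSubtypeProd p α).symm y i = _
  simp [Equiv.piEquivPiSubtypeProd, hi]

theorem piEquivPiSubtypeProd_symm_neg (p : ι → Prop) [DecidablePred p]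
    (y : (∀ i : {i // p i}, α i) × ∀ i : {i // ¬ p i}, α i) {i : ι} (hi : ¬ p i) :
    (MeasurableEquiv.piEquivPiSubtypeProd α p).symm y i = y.2 ⟨i, hi⟩ := by
  change (Equiv.piEquivPiSubtypeProd p α).symm y i = _
  simp [Equiv.piEquivPiSubtypeProd, hi]

end Equiv

variable {ι : Type*} [Fintype ι] {α : ι → Type*} [∀ i, MeasurableSpace (α i)]
  {ν : ∀ i, Measure (α i)} [∀ i, IsProbabilityMeasure (ν i)]

/-- Conditioning on the coordinates with property `p`: the bound only has to hold for each fixed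
value of them. -/
theorem pi_le_of_section (p : ι → Prop) [DecidablePred p] {E : Set (∀ i, α i)}
    (hE : MeasurableSet E) {c : ENNReal}
    (h : ∀ y : ∀ i : {i // p i}, α i, Measure.pi (fun i : {i // ¬ p i} => ν i)
      {z | (MeasurableEquiv.piEquivPiSubtypeProd α p).symm (y, z) ∈ E} ≤ c) :
    Measure.pi ν E ≤ c := by
  rw [← (measurePreserving_piEquivPiSubtypeProd ν p).symm.measure_preimage hE.nullMeasurableSet]
  exact prod_le_of_section
    ((MeasurableEquiv.piEquivPiSubtypeProd α p).symm.measurable hE) h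

/-- Two independent random variables, one of which has no atoms, are almost surely different. -/
theorem pi_eq_eq_zero {i j : ι} (hij : i ≠ j) {f : ∀ i, α i → ℝ} (hf : ∀ i, Measurable (f i))
    (h : ∀ c, ν j {z | f j z = c} = 0) : Measure.pi ν {x | f i (x i) = f j (x j)} = 0 := by
  classical
  have hE : MeasurableSet {x : ∀ i, α i | f i (x i) = f j (x j)} := measurableSet_eq_fun
    ((hf i).comp (measurable_pi_apply i)) ((hf j).comp (measurable_pi_apply j))
  refine le_antisymm (pi_le_of_section (· ≠ j) hE fun y => ?_) zero_le
  have hj : ¬ (j ≠ j) := fun h => h rfl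
  have : {z : ∀ i : {i // ¬ i ≠ j}, α i |
      (MeasurableEquiv.piEquivPiSubtypeProd α (· ≠ j)).symm (y, z) ∈
        {x : ∀ i, α i | f i (x i) = f j (x j)}} =
      Function.eval (⟨j, hj⟩ : {i // ¬ i ≠ j}) ⁻¹' {z | f j z = f i (y ⟨i, hij⟩)} := by
    ext z
    simp only [Set.mem_ofPred_eq, Set.mem_preimage, Function.eval]
    rw [piEquivPiSubtypeProd_symm_pos (· ≠ j) _ hij, piEquivPiSubtypeProd_symm_neg (· ≠ j) _ hj]
    exact eq_comm
  rw [this, (measurePreserving_eval (fun i : {i // ¬ i ≠ j} => ν i) ⟨j, hj⟩).measure_preimage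
    (measurableSet_eq_fun (hf j) measurable_const).nullMeasurableSet]
  exact (h _).le

/-- If random sets depend only on the coordinates in `J`, then it is unlikely that all other
coordinates avoid them although they have a large total measure. -/
theorem pi_avoid_le (J : Finset ι) {G : (∀ i, α i) → ∀ i, Set (α i)}
    (hG : ∀ i, MeasurableSet {p : (∀ i, α i) × α i | p.2 ∈ G p.1 i})
    (hJ : ∀ x y : ∀ i, α i, (∀ i ∈ J, x i = y i) → G x = G y) (K : ℝ) :
    Measure.pi ν {x | (∀ i ∉ J, x i ∉ G x i) ∧ K ≤ ∑ i, (ν i).real (G x i)} ≤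
      ENNReal.ofReal (Real.exp (J.card - K)) := by
  classical
  have hGx : ∀ x i, MeasurableSet (G x i) := fun x i => measurable_prodMk_left (hG i)
  have hE₁ : MeasurableSet {x | ∀ i ∉ J, x i ∉ G x i} := by
    rw [Set.ofPred_forall]
    refine MeasurableSet.iInter fun i => ?_
    rw [Set.ofPred_forall]
    refine MeasurableSet.iInter fun _ => ?_
    exact ((measurable_id.prodMk (measurable_pi_apply i)) (hG i)).compl
  have hE₂ : MeasurableSet {x | K ≤ ∑ i, (ν i).real (G x i)} :=
    measurableSet_le measurable_const (Finset.measurable_sum _ fun i _ =>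
      (measurable_measure_prodMk_left (hG i)).ennreal_toReal)
  refine pi_le_of_section (· ∈ J) (hE₁.inter hE₂) fun y => ?_
  · set e := (MeasurableEquiv.piEquivPiSubtypeProd α (· ∈ J)).symm with he
    rcases isEmpty_or_nonempty (∀ i : {i // i ∉ J}, α i) with hem | ⟨⟨z₀⟩⟩
    · rw [Set.eq_empty_of_isEmpty {z | _}, measure_empty]
      exact zero_le
    -- Once the coordinates in `J` are fixed, the sets are deterministic and the remaining
    -- coordinates avoid them independently.
    have hconst : ∀ z, G (e (y, z)) = G (e (y, z₀)) := fun z => hJ _ _ fun i hi => by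
      rw [he, piEquivPiSubtypeProd_symm_pos (· ∈ J) _ hi,
        piEquivPiSubtypeProd_symm_pos (· ∈ J) _ hi]
    set H := G (e (y, z₀)) with hH
    by_cases hK : K ≤ ∑ i, (ν i).real (H i)
    · have hsub : {z | e (y, z) ∈ {x | (∀ i ∉ J, x i ∉ G x i) ∧ K ≤ ∑ i, (ν i).real (G x i)}} ⊆
          Set.pi Set.univ fun i : {i // i ∉ J} => (H i)ᶜ := by
        rintro z ⟨hz, -⟩ i -
        have := hz i i.2
        rwa [hconst z, he, piEquivPiSubtypeProd_symm_neg (· ∈ J) _ i.2] at this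
      refine (measure_mono hsub).trans ?_
      rw [Measure.pi_pi]
      have h1 : ∀ i : {i // i ∉ J}, ν i (H i)ᶜ ≤ ENNReal.ofReal (Real.exp (-(ν i).real (H i))) := by
        intro i
        rw [← ofReal_measureReal, probReal_compl_eq_one_sub (hGx _ _)]
        exact ENNReal.ofReal_le_ofReal (by linarith [Real.add_one_le_exp (-(ν i).real (H i))])
      refine (Finset.prod_le_prod' fun i _ => h1 i).trans ?_
      rw [← ENNReal.ofReal_prod_of_nonneg fun i _ => (Real.exp_pos _).le, ← Real.exp_sum]
      refine ENNReal.ofReal_le_ofReal (Real.exp_le_exp.2 ?_)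
      have h2 : ∑ i, (ν i).real (H i) = ∑ i ∈ J, (ν i).real (H i) +
          ∑ i : {i // i ∉ J}, (ν i).real (H i) := by
        rw [← Finset.sum_add_sum_compl J]
        congr 1
        exact (Finset.sum_subtype _ (by simp) _)
      -- The coordinates in `J` are not required to avoid anything; each costs at most one unit of
      -- mass, hence the summand `J.card` in the exponent.
      have h3 : ∑ i ∈ J, (ν i).real (H i) ≤ J.card := by
        refine (Finset.sum_le_card_nsmul J _ 1 fun i _ => measureReal_le_one).trans_eq (by simp)
      rw [Finset.sum_neg_distrib]
      linarith
    · refine le_of_eq_of_le ?_ (zero_le)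
      rw [← nonpos_iff_eq_zero, ← measure_empty (μ := Measure.pi fun i : {i // i ∉ J} => ν i)]
      refine measure_mono ?_
      rintro z ⟨-, hz⟩
      rw [Set.mem_ofPred_eq, hconst z] at hz
      exact hK hz

open Classical in
/-- A Chernoff bound: the number of events that happen rarely exceeds its expectation by far. -/
theorem pi_card_ge_le {G : ∀ i, Set (α i)} (hG : ∀ i, MeasurableSet (G i)) (N : ℕ) :
    Measure.pi ν {x | N ≤ (Finset.univ.filter fun i => x i ∈ G i).card} ≤
      ENNReal.ofReal (Real.exp (∑ i, (ν i).real (G i)) * (1 / 2) ^ N) := by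
  -- The factor is 2 on the event and 1 off it, so the product is two to the number of events; its
  -- mean is at most exp of the expected number, and Markov's inequality concludes.
  set f : ∀ i, α i → ENNReal := fun i => 1 + (G i).indicator 1 with hf
  have hfm : ∀ i, Measurable (f i) := fun i =>
    measurable_const.add (measurable_one.indicator (hG i))
  have hX : ∀ i, Measurable fun x : ∀ i, α i => f i (x i) := fun i =>
    (hfm i).comp (measurable_pi_apply i)
  have hint : ∀ i, ∫⁻ x, f i (x i) ∂Measure.pi ν ≤ ENNReal.ofReal (Real.exp ((ν i).real (G i))) := by
    intro i
    rw [(measurePreserving_eval ν i).lintegral_comp (hfm i), hf]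
    simp only [Pi.add_apply, Pi.one_apply]
    rw [lintegral_add_left measurable_const, lintegral_indicator_one (hG i), lintegral_const,
      measure_univ, one_mul, ← ofReal_measureReal, ← ENNReal.ofReal_one,
      ← ENNReal.ofReal_add zero_le_one measureReal_nonneg]
    exact ENNReal.ofReal_le_ofReal (by linarith [Real.add_one_le_exp ((ν i).real (G i))])
  have hprod : ∫⁻ x, ∏ i, f i (x i) ∂Measure.pi ν ≤
      ENNReal.ofReal (Real.exp (∑ i, (ν i).real (G i))) := by
    have hind : ProbabilityTheory.iIndepFun (fun i (x : ∀ i, α i) => f i (x i)) (Measure.pi ν) :=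
      ProbabilityTheory.iIndepFun_pi fun i => (hfm i).aemeasurable
    rw [ProbabilityTheory.lintegral_prod_eq_prod_lintegral_of_indepFun Finset.univ _ hind hX]
    refine (Finset.prod_le_prod' fun i _ => hint i).trans_eq ?_
    rw [← ENNReal.ofReal_prod_of_nonneg fun i _ => (Real.exp_pos _).le, ← Real.exp_sum]
  have hsub : {x : ∀ i, α i | N ≤ (Finset.univ.filter fun i => x i ∈ G i).card} ⊆
      {x | 2 ^ N ≤ ∏ i, f i (x i)} := by
    intro x hx
    have h1 : ∏ i, f i (x i) = 2 ^ (Finset.univ.filter fun i => x i ∈ G i).card := by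
      rw [← Finset.prod_const, Finset.prod_filter]
      refine Finset.prod_congr rfl fun i _ => ?_
      by_cases h : x i ∈ G i <;> simp [hf, h, one_add_one_eq_two]
    simp only [Set.mem_ofPred_eq] at hx ⊢
    rw [h1]
    exact pow_le_pow_right₀ one_le_two hx
  refine (measure_mono hsub).trans ((meas_ge_le_lintegral_div
    (Finset.measurable_prod _ fun i _ => hX i).aemeasurable (by simp) (by simp)).trans ?_)
  rw [ENNReal.ofReal_mul (Real.exp_pos _).le, ENNReal.div_eq_inv_mul, mul_comm]
  refine mul_le_mul' hprod (le_of_eq ?_)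
  rw [ENNReal.ofReal_pow (by norm_num), one_div, ENNReal.ofReal_inv_of_pos two_pos,
    ENNReal.ofReal_ofNat, ENNReal.inv_pow]

end Pi

namespace CanonicalHull

/-! ### Grouping of the samples -/

theorem measurable_group {B k n : ℕ} :
    Measurable fun (S : Fin (B * (k + 1)) → Fin n → ℝ × ℝ) b => group S b := by
  unfold group
  fun_prop

/-- The groups of independent samples are independent, with independent points. -/
theorem measurePreserving_group {B k n : ℕ} (D : Fin n → Measure (ℝ × ℝ))
    [∀ i, IsProbabilityMeasure (D i)] :
    MeasurePreserving (fun (S : Fin (B * (k + 1)) → Fin n → ℝ × ℝ) b => group S b)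
      (Measure.pi fun _ => Measure.pi D)
      (Measure.pi fun _ => Measure.pi fun i => Measure.pi fun _ => D i) := by
  -- Both iterated products are pushed to the flat product over pairs of sample and point, where the
  -- laws are compared on boxes.
  set u : (Fin (B * (k + 1)) → Fin n → ℝ × ℝ) → (Fin (B * (k + 1)) × Fin n → ℝ × ℝ) :=
    fun S p => S p.1 p.2 with hu
  set v : (Fin B → Fin n → Fin (k + 1) → ℝ × ℝ) → (Fin (B * (k + 1)) × Fin n → ℝ × ℝ) :=
    fun W p => W (finProdFinEquiv.symm p.1).1 p.2 (finProdFinEquiv.symm p.1).2 with hv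
  set r : (Fin (B * (k + 1)) × Fin n → ℝ × ℝ) → (Fin B → Fin n → Fin (k + 1) → ℝ × ℝ) :=
    fun f b i t => f (finProdFinEquiv (b, t), i) with hr
  have hum : Measurable u := by rw [hu]; fun_prop
  have hvm : Measurable v := by rw [hv]; fun_prop
  have hrm : Measurable r := by rw [hr]; fun_prop
  have hru : r ∘ u = fun S b => group S b := rfl
  have hrv : r ∘ v = id := by
    funext W b i t
    change W (finProdFinEquiv.symm (finProdFinEquiv (b, t))).1 i
      (finProdFinEquiv.symm (finProdFinEquiv (b, t))).2 = W b i t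
    rw [Equiv.symm_apply_apply]
  have hmu : (Measure.pi fun _ => Measure.pi D).map u = Measure.pi fun p => D p.2 := by
    refine (Measure.pi_eq fun s hs => ?_).symm
    have : u ⁻¹' Set.pi Set.univ s =
        Set.pi Set.univ fun a => Set.pi Set.univ fun i => s (a, i) := by
      ext S
      simp [hu]
    rw [Measure.map_apply hum (MeasurableSet.univ_pi hs), this, Measure.pi_pi]
    simp_rw [Measure.pi_pi]
    rw [Fintype.prod_prod_type]
  have hmv : (Measure.pi fun _ => Measure.pi fun i => Measure.pi fun _ => D i).map v =
      Measure.pi fun p => D p.2 := by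
    refine (Measure.pi_eq fun s hs => ?_).symm
    have : v ⁻¹' Set.pi Set.univ s = Set.pi Set.univ fun b => Set.pi Set.univ fun i =>
        Set.pi Set.univ fun t => s (finProdFinEquiv (b, t), i) := by
      ext W
      simp only [hv, Set.mem_preimage, Set.mem_univ_pi, Prod.forall]
      constructor
      · intro h b i t
        simpa using h (finProdFinEquiv (b, t)) i
      · intro h a i
        have := h (finProdFinEquiv.symm a).1 i (finProdFinEquiv.symm a).2
        rwa [Prod.mk.eta, Equiv.apply_symm_apply] at this
    rw [Measure.map_apply hvm (MeasurableSet.univ_pi hs), this, Measure.pi_pi]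
    simp_rw [Measure.pi_pi]
    rw [Fintype.prod_prod_type, ← finProdFinEquiv.prod_comp, Fintype.prod_prod_type]
    exact Finset.prod_congr rfl fun b _ => Finset.prod_comm
  refine ⟨measurable_group, ?_⟩
  rw [← hru, ← Measure.map_map hrm hum, hmu, ← hmv, Measure.map_map hrm hvm, hrv, Measure.map_id]

/-! ### The probability of retaining a point -/

theorem measurableSet_retains {k : ℕ} : MeasurableSet {z : Fin (k + 1) → ℝ × ℝ | Retains z} := by
  unfold Retains
  simp only [Set.ofPred_forall]
  refine MeasurableSet.iInter fun t => MeasurableSet.iInter fun u => MeasurableSet.iInter fun _ =>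
    MeasurableSet.iInter fun _ => measurableSet_lt ?_ ?_ <;> fun_prop

theorem IsContinuousDistribution.fst_eq {D : Measure (ℝ × ℝ)} (hD : IsContinuousDistribution D)
    (c : ℝ) : D {p | p.1 = c} = 0 := by
  simpa using hD.line_null 1 0 c (by simp)

/-- A point in `U` is retained with probability `D U / k`, for samples of `k` further points. -/
theorem pi_retains {D : Measure (ℝ × ℝ)} (hD : IsContinuousDistribution D) {k : ℕ} (hk : 0 < k)
    {U : Set (ℝ × ℝ)} (hU : MeasurableSet U) :
    (Measure.pi fun _ : Fin (k + 1) => D).real {z | Retains z ∧ z 0 ∈ U} = D.real U / k := by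
  have := hD.isProbabilityMeasure
  set ν := Measure.pi fun _ : Fin (k + 1) => D with hν
  -- `E r` is the event that copy r + 1 is the strict maximum. These k events are disjoint, equally
  -- likely, and almost surely cover the event that copy 0 lies in `U`.
  set E : Fin k → Set (Fin (k + 1) → ℝ × ℝ) := fun r =>
    {z | z 0 ∈ U ∧ ∀ u : Fin k, u ≠ r → (z u.succ).1 < (z r.succ).1} with hE
  have hEm : ∀ r, MeasurableSet (E r) := fun r => by
    refine MeasurableSet.inter (measurable_pi_apply 0 hU) ?_
    have : {z : Fin (k + 1) → ℝ × ℝ | ∀ u : Fin k, u ≠ r → (z u.succ).1 < (z r.succ).1} =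
        ⋂ u : Fin k, ⋂ _ : u ≠ r, {z | (z u.succ).1 < (z r.succ).1} := by
      ext z; simp
    change MeasurableSet {z : Fin (k + 1) → ℝ × ℝ | _}
    rw [this]
    refine MeasurableSet.iInter fun u => MeasurableSet.iInter fun _ => measurableSet_lt ?_ ?_ <;>
      fun_prop
  have hE0 : {z | Retains z ∧ z 0 ∈ U} = E ⟨0, hk⟩ := by
    ext z
    constructor
    · rintro ⟨h, h0⟩
      refine ⟨h0, fun u hu => h _ _ rfl ?_⟩
      have : (u : ℕ) ≠ 0 := fun h => hu (Fin.ext h)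
      simp; omega
    · rintro ⟨h0, h⟩
      refine ⟨fun t u ht hu => ?_, h0⟩
      have h1 := h ⟨u - 1, by omega⟩ (by simp [Fin.ext_iff]; omega)
      have h2 : Fin.succ ⟨(u : ℕ) - 1, by omega⟩ = u := by ext; simp; omega
      have h3 : Fin.succ ⟨0, hk⟩ = t := by ext; simp [ht]
      rwa [h2, h3] at h1
  have hsymm : ∀ r, ν (E r) = ν (E ⟨0, hk⟩) := by
    intro r
    -- The swap fixes coordinate 0, so the condition on `U` is unaffected.
    set e : Equiv.Perm (Fin (k + 1)) := Equiv.swap r.succ (Fin.succ ⟨0, hk⟩) with he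
    have hmp := measurePreserving_piCongrLeft (fun _ : Fin (k + 1) => D) e
    have happ : ∀ z u, (MeasurableEquiv.piCongrLeft (fun _ : Fin (k + 1) => ℝ × ℝ) e) z u =
        z (e u) := by
      intro z u
      have h1 : u = e (e u) := by simp [he]
      conv_lhs => rw [h1]
      exact Equiv.piCongrLeft_apply_apply (fun _ : Fin (k + 1) => ℝ × ℝ) e z (e u)
    rw [← hmp.measure_preimage (hEm ⟨0, hk⟩).nullMeasurableSet]
    congr 1
    ext z
    simp only [hE, Set.mem_preimage, Set.mem_ofPred_eq, happ]
    have h0 : e 0 = 0 := Equiv.swap_apply_of_ne_of_ne (Fin.succ_ne_zero _).symm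
      (Fin.succ_ne_zero _).symm
    have h1 : e (Fin.succ ⟨0, hk⟩) = r.succ := Equiv.swap_apply_right _ _
    rw [h0, h1]
    refine and_congr_right fun _ => ?_
    have hsucc : ∀ u : Fin k, e u.succ = (Equiv.swap r ⟨0, hk⟩ u).succ := fun u =>
      (Fin.succ_injective k).swap_apply r ⟨0, hk⟩ u
    simp only [hsucc]
    set w := Equiv.swap r ⟨0, hk⟩ with hw
    have hww : ∀ u, w (w u) = u := fun u => by simp [hw]
    have hwr : w r = ⟨0, hk⟩ := Equiv.swap_apply_left _ _
    have hw0 : w ⟨0, hk⟩ = r := Equiv.swap_apply_right _ _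
    constructor
    · intro h u hu
      exact h _ fun hc => hu (by rw [← hww u, hc, hwr])
    · intro h u hu
      have := h (w u) fun hc => hu (by rw [← hww u, hc, hw0])
      rwa [hww] at this
  have hdisj : Pairwise (Function.onFun Disjoint E) := by
    intro r r' hrr
    refine Set.disjoint_left.2 fun z hz hz' => ?_
    exact lt_asymm (hz.2 r' hrr.symm) (hz'.2 r hrr)
  have hunion : ν (⋃ r, E r) = D U := by
    have h1 : ν (Function.eval 0 ⁻¹' U) = D U :=
      (measurePreserving_eval (fun _ : Fin (k + 1) => D) 0).measure_preimage hU.nullMeasurableSet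
    rw [← h1]
    refine measure_congr ?_
    have hties : ∀ᵐ z ∂ν, ∀ u u' : Fin (k + 1), u ≠ u' → (z u).1 ≠ (z u').1 := by
      refine ae_all_iff.2 fun u => ae_all_iff.2 fun u' => ?_
      by_cases h : u = u'
      · simp [h]
      · have := pi_eq_eq_zero (ν := fun _ : Fin (k + 1) => D) h (f := fun _ => Prod.fst)
          (fun _ => measurable_fst) hD.fst_eq
        filter_upwards [compl_mem_ae_iff.2 this] with z hz _ using hz
    filter_upwards [hties] with z hz
    refine propext ⟨fun h => ?_, fun h => ?_⟩
    · obtain ⟨r, hr⟩ := Set.mem_iUnion.1 h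
      exact hr.1
    · have : Nonempty (Fin k) := ⟨⟨0, hk⟩⟩
      obtain ⟨r, hr⟩ := Finite.exists_max fun r : Fin k => (z r.succ).1
      exact Set.mem_iUnion.2 ⟨r, h, fun u hu => lt_of_le_of_ne (hr u)
        (hz _ _ fun hc => hu (Fin.succ_injective k hc))⟩
  rw [measure_iUnion hdisj hEm, tsum_fintype, Finset.sum_congr rfl fun r _ => hsymm r,
    Finset.sum_const, Finset.card_univ, Fintype.card_fin, nsmul_eq_mul, ← hE0] at hunion
  rw [eq_div_iff (by positivity), mul_comm, measureReal_def, measureReal_def, ← hunion,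
    ENNReal.toReal_mul, ENNReal.toReal_natCast]

end CanonicalHull

/-! ### Fubini bounds with an exceptional set of sections -/

theorem prod_le_add_of_section_left {α β : Type*} [MeasurableSpace α] [MeasurableSpace β]
    {μ : Measure α} {ν : Measure β} [IsProbabilityMeasure μ] [SFinite ν] {E : Set (α × β)}
    (hE : MeasurableSet E) {A : Set α} {c : ENNReal} (hν : ν Set.univ ≤ 1)
    (h : ∀ x ∉ A, ν {y | (x, y) ∈ E} ≤ c) : μ.prod ν E ≤ μ A + c := by
  rw [Measure.prod_apply hE]
  calc ∫⁻ x, ν (Prod.mk x ⁻¹' E) ∂μ ≤ ∫⁻ x, (A.indicator (fun _ => 1) x + c) ∂μ := by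
        refine lintegral_mono fun x => ?_
        by_cases hx : x ∈ A
        · rw [Set.indicator_of_mem hx]
          exact ((measure_mono (Set.subset_univ _)).trans hν).trans le_self_add
        · exact (h x hx).trans le_add_self
    _ = ∫⁻ x, A.indicator (fun _ => 1) x ∂μ + c := by
        rw [lintegral_add_right _ measurable_const, lintegral_const, measure_univ, mul_one]
    -- Only an upper bound for the integral of the indicator is used, so `A` need not be measurable.
    _ ≤ μ A + c := by
        gcongr
        exact (lintegral_indicator_const_le A 1).trans_eq (one_mul _)

theorem prod_le_add_of_section_right {α β : Type*} [MeasurableSpace α] [MeasurableSpace β]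
    {μ : Measure α} {ν : Measure β} [IsProbabilityMeasure μ] [IsProbabilityMeasure ν]
    {E : Set (α × β)} (hE : MeasurableSet E) {A : Set β} {c : ENNReal}
    (h : ∀ y ∉ A, μ {x | (x, y) ∈ E} ≤ c) : μ.prod ν E ≤ ν A + c := by
  rw [← Measure.prod_swap, Measure.map_apply measurable_swap hE]
  exact prod_le_add_of_section_left (measurable_swap hE) prob_le_one h

namespace CanonicalHull

/-! ### Measurability and locality of the half-planes -/

section Measurability

variable {n : ℕ}

theorem measurable_normalVec (j : Fin n) (o : Option (Fin n)) (σ : Bool) :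
    Measurable fun X : Fin n → ℝ × ℝ => normalVec X j o σ := by
  cases o <;> simp only [normalVec] <;> fun_prop

theorem measurableSet_openHalf (j : Fin n) (o : Option (Fin n)) (σ : Bool) :
    MeasurableSet {p : (Fin n → ℝ × ℝ) × (ℝ × ℝ) | p.2 ∈ openHalf p.1 j o σ} := by
  have := (measurable_normalVec j o σ).comp
    (measurable_fst : Measurable (Prod.fst : (Fin n → ℝ × ℝ) × (ℝ × ℝ) → _))
  simp only [Function.comp_def] at this
  have h : Measurable fun p : (Fin n → ℝ × ℝ) × (ℝ × ℝ) =>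
      (normalVec p.1 j o σ).1 * (p.2.1 - (p.1 j).1) +
        (normalVec p.1 j o σ).2 * (p.2.2 - (p.1 j).2) := by fun_prop
  exact measurableSet_lt measurable_const h

theorem measurableSet_closedHalf (j : Fin n) (o : Option (Fin n)) (σ : Bool) :
    MeasurableSet {p : (Fin n → ℝ × ℝ) × (ℝ × ℝ) | p.2 ∈ closedHalf p.1 j o σ} := by
  have := (measurable_normalVec j o σ).comp
    (measurable_fst : Measurable (Prod.fst : (Fin n → ℝ × ℝ) × (ℝ × ℝ) → _))
  simp only [Function.comp_def] at this
  have h : Measurable fun p : (Fin n → ℝ × ℝ) × (ℝ × ℝ) =>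
      (normalVec p.1 j o σ).1 * (p.2.1 - (p.1 j).1) +
        (normalVec p.1 j o σ).2 * (p.2.2 - (p.1 j).2) := by fun_prop
  exact measurableSet_le measurable_const h

/-- A half-plane depends on at most two of the points. This locality is what permits conditioning on
few coordinates. -/
theorem openHalf_congr {X Y : Fin n → ℝ × ℝ} {j : Fin n} {o : Option (Fin n)} (hj : X j = Y j)
    (ho : ∀ l ∈ o, X l = Y l) (σ : Bool) : openHalf X j o σ = openHalf Y j o σ := by
  cases o with
  | none => simp [openHalf, normalVec, hj]
  | some l => simp [openHalf, normalVec, hj, ho l rfl]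

/-- A nonzero normal vector makes the boundary a genuine line, which has mass zero. -/
theorem IsContinuousDistribution.closedHalf_eq {D : Measure (ℝ × ℝ)}
    (hD : IsContinuousDistribution D) {X : Fin n → ℝ × ℝ} {j : Fin n} {o : Option (Fin n)}
    {σ : Bool} (hne : normalVec X j o σ ≠ 0) :
    D.real (closedHalf X j o σ) = D.real (openHalf X j o σ) := by
  have h0 := hD.line_null (normalVec X j o σ).1 (normalVec X j o σ).2
    ((normalVec X j o σ).1 * (X j).1 + (normalVec X j o σ).2 * (X j).2) hne
  have hae : closedHalf X j o σ =ᵐ[D] openHalf X j o σ := by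
    filter_upwards [compl_mem_ae_iff.2 h0] with q hq
    refine propext ⟨fun h => ?_, fun h => le_of_lt h⟩
    refine lt_of_le_of_ne h fun hc => hq ?_
    change _ = _
    linarith
  rw [measureReal_def, measureReal_def, measure_congr hae]

end Measurability

/-! ### The unlikely events -/

section Events

variable {n B k : ℕ}

/-- The first samples of the points. -/
def firsts (Z : Fin n → Fin (k + 1) → ℝ × ℝ) (i : Fin n) : ℝ × ℝ := Z i 0

/-- The union of a right and a left half-plane at the point `P j`. -/
def twoHalves (P : Fin n → ℝ × ℝ) (j : Fin n) (o : Option (Fin n) × Option (Fin n)) :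
    Set (ℝ × ℝ) :=
  openHalf P j o.1 true ∪ openHalf P j o.2 false

/-- All points avoid two half-planes at `P j`, but all thinned samples hit them. -/
def missEvent (B k : ℕ) (j : Fin n) (o : Option (Fin n) × Option (Fin n)) :
    Set ((Fin B → Fin n → Fin (k + 1) → ℝ × ℝ) × (Fin n → ℝ × ℝ)) :=
  {p | (∀ l, p.2 l ∉ twoHalves p.2 j o) ∧
    ∀ b, ∃ l, Retains (p.1 b l) ∧ p.1 b l 0 ∈ twoHalves p.2 j o}

open Classical in
/-- A thinned sample avoids a half-plane that contains many of the points. -/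
def crowdEvent (B k N : ℕ) (b : Fin B) (j : Fin n) (o : Option (Fin n) × Bool) :
    Set ((Fin B → Fin n → Fin (k + 1) → ℝ × ℝ) × (Fin n → ℝ × ℝ)) :=
  {p | normalVec (firsts (p.1 b)) j o.1 o.2 ≠ 0 ∧
    (∀ l, Retains (p.1 b l) → p.1 b l 0 ∉ openHalf (firsts (p.1 b)) j o.1 o.2) ∧
    N ≤ (Finset.univ.filter fun l => p.2 l ∈ closedHalf (firsts (p.1 b)) j o.1 o.2).card}

theorem measurable_firsts : Measurable (firsts (n := n) (k := k)) := by
  unfold firsts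
  fun_prop

theorem measurableSet_twoHalves (j : Fin n) (o : Option (Fin n) × Option (Fin n)) :
    MeasurableSet {p : (Fin n → ℝ × ℝ) × (ℝ × ℝ) | p.2 ∈ twoHalves p.1 j o} :=
  (measurableSet_openHalf j o.1 true).union (measurableSet_openHalf j o.2 false)

theorem measurableSet_missEvent (j : Fin n) (o : Option (Fin n) × Option (Fin n)) :
    MeasurableSet (missEvent B k j o) := by
  have h₁ : MeasurableSet {p : (Fin B → Fin n → Fin (k + 1) → ℝ × ℝ) × (Fin n → ℝ × ℝ) |
      ∀ l, p.2 l ∉ twoHalves p.2 j o} := by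
    rw [Set.ofPred_forall]
    refine MeasurableSet.iInter fun l => ?_
    exact ((by fun_prop : Measurable fun p : (Fin B → Fin n → Fin (k + 1) → ℝ × ℝ) × (Fin n → ℝ × ℝ) =>
      (p.2, p.2 l)) (measurableSet_twoHalves j o)).compl
  have h₂ : MeasurableSet {p : (Fin B → Fin n → Fin (k + 1) → ℝ × ℝ) × (Fin n → ℝ × ℝ) |
      ∀ b, ∃ l, Retains (p.1 b l) ∧ p.1 b l 0 ∈ twoHalves p.2 j o} := by
    simp only [Set.ofPred_forall, Set.ofPred_exists]
    refine MeasurableSet.iInter fun b => MeasurableSet.iUnion fun l => MeasurableSet.inter ?_ ?_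
    · exact (by fun_prop : Measurable fun p : (Fin B → Fin n → Fin (k + 1) → ℝ × ℝ) × (Fin n → ℝ × ℝ) =>
        p.1 b l) measurableSet_retains
    · exact (by fun_prop : Measurable fun p : (Fin B → Fin n → Fin (k + 1) → ℝ × ℝ) × (Fin n → ℝ × ℝ) =>
        (p.2, p.1 b l 0)) (measurableSet_twoHalves j o)
  exact h₁.inter h₂

theorem measurableSet_crowdEvent {N : ℕ} (b : Fin B) (j : Fin n) (o : Option (Fin n) × Bool) :
    MeasurableSet (crowdEvent B k N b j o) := by
  classical
  have hf : Measurable fun p : (Fin B → Fin n → Fin (k + 1) → ℝ × ℝ) × (Fin n → ℝ × ℝ) =>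
      firsts (p.1 b) := measurable_firsts.comp (by fun_prop)
  have h₁ : MeasurableSet {p : (Fin B → Fin n → Fin (k + 1) → ℝ × ℝ) × (Fin n → ℝ × ℝ) |
      normalVec (firsts (p.1 b)) j o.1 o.2 ≠ 0} :=
    (((measurable_normalVec j o.1 o.2).comp hf) (measurableSet_singleton 0)).compl
  have h₂ : MeasurableSet {p : (Fin B → Fin n → Fin (k + 1) → ℝ × ℝ) × (Fin n → ℝ × ℝ) |
      ∀ l, Retains (p.1 b l) → p.1 b l 0 ∉ openHalf (firsts (p.1 b)) j o.1 o.2} := by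
    rw [Set.ofPred_forall]
    refine MeasurableSet.iInter fun l => ?_
    have h1 : MeasurableSet {p : (Fin B → Fin n → Fin (k + 1) → ℝ × ℝ) × (Fin n → ℝ × ℝ) |
        Retains (p.1 b l)} := (by fun_prop : Measurable fun p : (Fin B → Fin n → Fin (k + 1) →
          ℝ × ℝ) × (Fin n → ℝ × ℝ) => p.1 b l) measurableSet_retains
    have h2 : MeasurableSet {p : (Fin B → Fin n → Fin (k + 1) → ℝ × ℝ) × (Fin n → ℝ × ℝ) |
        p.1 b l 0 ∈ openHalf (firsts (p.1 b)) j o.1 o.2} :=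
      (hf.prodMk (by fun_prop : Measurable fun p : (Fin B → Fin n → Fin (k + 1) →
          ℝ × ℝ) × (Fin n → ℝ × ℝ) => p.1 b l 0)) (measurableSet_openHalf j o.1 o.2)
    exact h1.imp h2.compl
  have h₃ : Measurable fun p : (Fin B → Fin n → Fin (k + 1) → ℝ × ℝ) × (Fin n → ℝ × ℝ) =>
        (Finset.univ.filter fun l => p.2 l ∈ closedHalf (firsts (p.1 b)) j o.1 o.2).card := by
    simp only [Finset.card_filter]
    refine Finset.measurable_sum _ fun l _ => Measurable.ite ?_ measurable_const measurable_const
    exact (hf.prodMk (by fun_prop : Measurable fun p : (Fin B → Fin n → Fin (k + 1) →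
          ℝ × ℝ) × (Fin n → ℝ × ℝ) => p.2 l)) (measurableSet_closedHalf j o.1 o.2)
  exact h₁.inter (h₂.inter (measurableSet_le measurable_const h₃))

variable {D : Fin n → Measure (ℝ × ℝ)}

/-- The law of a group of samples. -/
noncomputable def groupLaw (k : ℕ) (D : Fin n → Measure (ℝ × ℝ)) :
    Measure (Fin n → Fin (k + 1) → ℝ × ℝ) :=
  Measure.pi fun i => Measure.pi fun _ => D i

section

variable [∀ i, IsProbabilityMeasure (D i)]

instance : IsProbabilityMeasure (groupLaw k D) := by
  unfold groupLaw
  infer_instance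

/-- The two half-planes are determined by `P j` and at most one further point each, hence the 3 in
the exponent. -/
theorem pi_avoid_twoHalves_le (j : Fin n) (o : Option (Fin n) × Option (Fin n)) (K : ℝ) :
    Measure.pi D {P | (∀ l, P l ∉ twoHalves P j o) ∧ K ≤ ∑ i, (D i).real (twoHalves P j o)} ≤
      ENNReal.ofReal (Real.exp (3 - K)) := by
  classical
  set J : Finset (Fin n) := {j} ∪ (o.1.toFinset ∪ o.2.toFinset) with hJ
  have hcard : J.card ≤ 3 := by
    refine (Finset.card_union_le _ _).trans ?_
    have h1 := Finset.card_union_le o.1.toFinset o.2.toFinset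
    have h2 : o.1.toFinset.card ≤ 1 := by cases o.1 <;> simp
    have h3 : o.2.toFinset.card ≤ 1 := by cases o.2 <;> simp
    rw [Finset.card_singleton]
    omega
  refine (measure_mono ?_).trans ((pi_avoid_le (ν := D) J (G := fun P _ => twoHalves P j o)
    (fun _ => measurableSet_twoHalves j o) ?_ K).trans ?_)
  · exact fun P hP => ⟨fun l _ => hP.1 l, hP.2⟩
  · intro x y hxy
    funext _
    rw [twoHalves, twoHalves, openHalf_congr (hxy j (by simp [hJ])) (fun l hl => hxy l ?_),
      openHalf_congr (hxy j (by simp [hJ])) (fun l hl => hxy l ?_)]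
    · simp [hJ, Option.mem_def.1 hl]
    · simp [hJ, Option.mem_def.1 hl]
  · refine ENNReal.ofReal_le_ofReal (Real.exp_le_exp.2 ?_)
    have : (J.card : ℝ) ≤ 3 := by exact_mod_cast hcard
    linarith

end

variable (hD : ∀ i, IsContinuousDistribution (D i)) (hk : 0 < k)

include hD hk

/-- Fix `P`. If the half-planes have mass at least K, it is already unlikely that `P` avoids them.
Otherwise one thinned sample hits them with probability at most K/k, and the B groups are
independent. -/
theorem pi_missEvent_le (j : Fin n) (o : Option (Fin n) × Option (Fin n)) {K : ℝ} :
    ((Measure.pi fun _ : Fin B => groupLaw k D).prod (Measure.pi D)) (missEvent B k j o) ≤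
      ENNReal.ofReal (Real.exp (3 - K)) + ENNReal.ofReal (K / k) ^ B := by
  have := fun i => (hD i).isProbabilityMeasure
  refine (prod_le_add_of_section_right (measurableSet_missEvent j o) (c := ENNReal.ofReal (K / k) ^ B)
    (A := {P | (∀ l, P l ∉ twoHalves P j o) ∧ K ≤ ∑ i, (D i).real (twoHalves P j o)})
    fun P hP => ?_).trans (by gcongr; exact pi_avoid_twoHalves_le j o K)
  by_cases h1 : ∀ l, P l ∉ twoHalves P j o
  swap
  · refine le_of_eq_of_le ?_ zero_le
    rw [← nonpos_iff_eq_zero, ← measure_empty (μ := Measure.pi fun _ : Fin B => groupLaw k D)]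
    exact measure_mono fun W hW => absurd hW.1 h1
  have hK : ∑ i, (D i).real (twoHalves P j o) < K := by
    by_contra! hc
    exact hP ⟨h1, hc⟩
  set H := twoHalves P j o with hH
  have hHm : MeasurableSet H := measurable_prodMk_left (measurableSet_twoHalves j o)
  set Q : Set (Fin n → Fin (k + 1) → ℝ × ℝ) :=
    ⋃ l, Function.eval l ⁻¹' {z | Retains z ∧ z 0 ∈ H} with hQ
  have hsub : {W | (W, P) ∈ missEvent B k j o} ⊆ Set.pi Set.univ fun _ : Fin B => Q := by
    rintro W ⟨-, hW⟩ b -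
    obtain ⟨l, hl⟩ := hW b
    exact Set.mem_iUnion.2 ⟨l, hl⟩
  refine (measure_mono hsub).trans ?_
  rw [Measure.pi_pi, Finset.prod_const, Finset.card_univ, Fintype.card_fin]
  gcongr
  refine (measure_iUnion_fintype_le _ _).trans ?_
  have hE : MeasurableSet {z : Fin (k + 1) → ℝ × ℝ | Retains z ∧ z 0 ∈ H} :=
    measurableSet_retains.inter (measurable_pi_apply 0 hHm)
  have h2 : ∀ l, groupLaw k D (Function.eval l ⁻¹' {z | Retains z ∧ z 0 ∈ H}) =
      ENNReal.ofReal ((D l).real H / k) := by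
    intro l
    rw [groupLaw, (measurePreserving_eval (fun i => Measure.pi fun _ : Fin (k + 1) => D i)
      l).measure_preimage hE.nullMeasurableSet, ← pi_retains (hD l) hk hHm, ofReal_measureReal]
  simp_rw [h2]
  rw [← ENNReal.ofReal_sum_of_nonneg fun i _ => div_nonneg measureReal_nonneg (Nat.cast_nonneg _),
    ← Finset.sum_div]
  exact ENNReal.ofReal_le_ofReal (by gcongr)

/-- A point is retained and falls into the half-plane with its mass divided by k, so mass K * k
makes K hits expected; two points determine the half-plane. -/
theorem groupLaw_avoid_le (j : Fin n) (o : Option (Fin n) × Bool) (K : ℝ) :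
    groupLaw k D {Z | (∀ l, Retains (Z l) → Z l 0 ∉ openHalf (firsts Z) j o.1 o.2) ∧
      K * k ≤ ∑ i, (D i).real (openHalf (firsts Z) j o.1 o.2)} ≤
      ENNReal.ofReal (Real.exp (2 - K)) := by
  classical
  have := fun i => (hD i).isProbabilityMeasure
  set J : Finset (Fin n) := {j} ∪ o.1.toFinset with hJ
  have hcard : J.card ≤ 2 := by
    refine (Finset.card_union_le _ _).trans ?_
    have h2 : o.1.toFinset.card ≤ 1 := by cases o.1 <;> simp
    rw [Finset.card_singleton]
    omega
  have hHm : ∀ Z : Fin n → Fin (k + 1) → ℝ × ℝ, MeasurableSet (openHalf (firsts Z) j o.1 o.2) :=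
    fun Z => measurable_prodMk_left (measurableSet_openHalf j o.1 o.2)
  refine (measure_mono ?_).trans ((pi_avoid_le (ν := fun i => Measure.pi fun _ : Fin (k + 1) => D i)
    J (G := fun Z _ => {z | Retains z ∧ z 0 ∈ openHalf (firsts Z) j o.1 o.2}) ?_ ?_ K).trans ?_)
  · rintro Z ⟨h1, h2⟩
    refine ⟨fun l _ h => h1 l h.1 h.2, ?_⟩
    simp_rw [fun i => pi_retains (hD i) hk (hHm Z)]
    rwa [← Finset.sum_div, le_div_iff₀ (by positivity)]
  · intro i
    refine MeasurableSet.inter (measurable_snd measurableSet_retains) ?_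
    exact ((measurable_firsts.comp measurable_fst).prodMk (by fun_prop :
      Measurable fun p : (Fin n → Fin (k + 1) → ℝ × ℝ) × (Fin (k + 1) → ℝ × ℝ) => p.2 0))
      (measurableSet_openHalf j o.1 o.2)
  · intro x y hxy
    funext _
    rw [openHalf_congr (X := firsts x) (Y := firsts y) (congrFun (hxy j (by simp [hJ])) 0)
      (fun l hl => congrFun (hxy l ?_) 0)]
    simp [hJ, Option.mem_def.1 hl]
  · refine ENNReal.ofReal_le_ofReal (Real.exp_le_exp.2 ?_)
    have : (J.card : ℝ) ≤ 2 := by exact_mod_cast hcard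
    linarith

/-- Now the groups are fixed. Either the avoided half-plane has mass at least K * k, which is
unlikely, or the expected number of points of `P` in it is below K * k and the Chernoff bound
applies. Closed and open half-planes have equal mass here. -/
theorem pi_crowdEvent_le {N : ℕ} (b : Fin B) (j : Fin n) (o : Option (Fin n) × Bool) (K : ℝ) :
    ((Measure.pi fun _ : Fin B => groupLaw k D).prod (Measure.pi D)) (crowdEvent B k N b j o) ≤
      ENNReal.ofReal (Real.exp (2 - K)) + ENNReal.ofReal (Real.exp (K * k) * (1 / 2) ^ N) := by
  classical
  have := fun i => (hD i).isProbabilityMeasure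
  set A' : Set (Fin n → Fin (k + 1) → ℝ × ℝ) :=
    {Z | (∀ l, Retains (Z l) → Z l 0 ∉ openHalf (firsts Z) j o.1 o.2) ∧
      K * k ≤ ∑ i, (D i).real (openHalf (firsts Z) j o.1 o.2)} with hA'
  have hA : (Measure.pi fun _ : Fin B => groupLaw k D) (Function.eval b ⁻¹' A') ≤
      ENNReal.ofReal (Real.exp (2 - K)) := by
    have hb := measurePreserving_eval (fun _ : Fin B => groupLaw k D) b
    refine (Measure.le_map_apply hb.measurable.aemeasurable A').trans ?_
    rw [hb.map_eq]
    exact groupLaw_avoid_le hD hk j o K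
  refine (prod_le_add_of_section_left (measurableSet_crowdEvent b j o) prob_le_one
    (A := Function.eval b ⁻¹' A') fun W hW => ?_).trans (by gcongr)
  by_cases h1 : normalVec (firsts (W b)) j o.1 o.2 ≠ 0 ∧
    ∀ l, Retains (W b l) → W b l 0 ∉ openHalf (firsts (W b)) j o.1 o.2
  swap
  · refine le_of_eq_of_le ?_ zero_le
    rw [← nonpos_iff_eq_zero, ← measure_empty (μ := Measure.pi D)]
    exact measure_mono fun P hP => absurd ⟨hP.1, hP.2.1⟩ h1
  have hK : ∑ i, (D i).real (openHalf (firsts (W b)) j o.1 o.2) < K * k := by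
    by_contra! hc
    exact hW ⟨h1.2, hc⟩
  refine (measure_mono fun P hP => hP.2.2).trans ((pi_card_ge_le (ν := D)
    (G := fun _ => closedHalf (firsts (W b)) j o.1 o.2)
    (fun _ => measurable_prodMk_left (measurableSet_closedHalf j o.1 o.2)) N).trans ?_)
  refine ENNReal.ofReal_le_ofReal ?_
  gcongr
  simp_rw [fun i => (hD i).closedHalf_eq h1.1]
  exact hK.le

theorem groupLaw_thinnedCount_le (N : ℕ) :
    groupLaw k D {Z | N ≤ thinnedCount Z} ≤
      ENNReal.ofReal (Real.exp (n / k) * (1 / 2) ^ N) := by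
  classical
  have := fun i => (hD i).isProbabilityMeasure
  have h := pi_card_ge_le (ν := fun i => Measure.pi fun _ : Fin (k + 1) => D i)
    (G := fun _ => {z | Retains z}) (fun _ => measurableSet_retains) N
  have h1 : ∀ i, (Measure.pi fun _ : Fin (k + 1) => D i).real {z | Retains z} = 1 / k := by
    intro i
    have := pi_retains (hD i) hk MeasurableSet.univ
    simpa using this
  simp_rw [h1] at h
  rw [Finset.sum_const, Finset.card_univ, Fintype.card_fin, nsmul_eq_mul, mul_one_div] at h
  refine le_of_eq_of_le ?_ h
  simp only [thinnedCount, Set.mem_ofPred_eq]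
  rfl

/-- An empty thinned sample would have no maximizer, so this has to be excluded; it is the avoidance
bound with no conditioned coordinates. -/
theorem groupLaw_forall_not_retains_le :
    groupLaw k D {Z | ∀ l, ¬ Retains (Z l)} ≤ ENNReal.ofReal (Real.exp (-(n / k))) := by
  classical
  have := fun i => (hD i).isProbabilityMeasure
  have h1 : ∀ i, (Measure.pi fun _ : Fin (k + 1) => D i).real {z | Retains z} = 1 / k := by
    intro i
    have := pi_retains (hD i) hk MeasurableSet.univ
    simpa using this
  have h := pi_avoid_le (ν := fun i => Measure.pi fun _ : Fin (k + 1) => D i) ∅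
    (G := fun _ _ => {z | Retains z}) (fun _ => measurable_snd measurableSet_retains)
    (fun _ _ _ => rfl) (n / k)
  rw [Finset.card_empty, Nat.cast_zero, zero_sub] at h
  refine le_trans (measure_mono ?_) h
  intro Z hZ
  refine ⟨fun l _ => hZ l, ?_⟩
  simp_rw [h1]
  rw [Finset.sum_const, Finset.card_univ, Fintype.card_fin, nsmul_eq_mul, mul_one_div]

omit hk in
theorem groupLaw_ties :
    groupLaw k D {Z | ∃ i j, i ≠ j ∧ (Z i 0).1 = (Z j 0).1} = 0 := by
  have := fun i => (hD i).isProbabilityMeasure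
  simp only [Set.ofPred_exists]
  refine measure_iUnion_null fun i => measure_iUnion_null fun j => ?_
  by_cases hij : i = j
  · simp [hij]
  refine measure_mono_null (t := {Z | (Z i 0).1 = (Z j 0).1}) (fun Z hZ => hZ.2) (pi_eq_eq_zero hij
    (ν := fun i => Measure.pi fun _ : Fin (k + 1) => D i) (f := fun _ z => (z 0).1)
    (fun _ => by fun_prop) fun c => ?_)
  exact ((measurePreserving_eval (fun _ : Fin (k + 1) => D j) 0).measure_preimage
    (measurableSet_eq_fun measurable_fst measurable_const).nullMeasurableSet).trans
    ((hD j).fst_eq c)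

end Events

end CanonicalHull

namespace CanonicalHull

/-! ### Union bounds over half-planes and groups -/

section Union

variable {n B k : ℕ}

/-- Some thinned sample misses the points, or avoids a crowded half-plane. -/
def pairEvent (n B k N : ℕ) :
    Set ((Fin B → Fin n → Fin (k + 1) → ℝ × ℝ) × (Fin n → ℝ × ℝ)) :=
  (⋃ x : Fin n × (Option (Fin n) × Option (Fin n)), missEvent B k x.1 x.2) ∪
    ⋃ x : Fin B × Fin n × (Option (Fin n) × Bool), crowdEvent B k N x.1 x.2.1 x.2.2

/-- Some thinned sample is too large or empty, or some group has two points on a vertical line. -/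
def groupEvent (n B k M : ℕ) : Set (Fin B → Fin n → Fin (k + 1) → ℝ × ℝ) :=
  ⋃ b, Function.eval b ⁻¹' ({Z | ∃ i j, i ≠ j ∧ (Z i 0).1 = (Z j 0).1} ∪
    ({Z | M ≤ thinnedCount Z} ∪ {Z | ∀ l, ¬ Retains (Z l)}))

theorem measurableSet_pairEvent {N : ℕ} : MeasurableSet (pairEvent n B k N) := by
  refine MeasurableSet.union (MeasurableSet.iUnion ?_) (MeasurableSet.iUnion ?_)
  · exact fun x => measurableSet_missEvent x.1 x.2
  · exact fun x => measurableSet_crowdEvent x.1 x.2.1 x.2.2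

variable {D : Fin n → Measure (ℝ × ℝ)} (hD : ∀ i, IsContinuousDistribution (D i)) (hk : 0 < k)

include hD hk

/-- There are n (n + 1)^2 pairs of half-planes at a point of `P`, and 2Bn (n + 1) single half-planes
at points of the B groups; the choice `none` accounts for n + 1 in place of n. -/
theorem pi_pairEvent_le {N : ℕ} {K : ℝ} (hK : 0 ≤ K) :
    ((Measure.pi fun _ : Fin B => groupLaw k D).prod (Measure.pi D)) (pairEvent n B k N) ≤
      ENNReal.ofReal (n * (n + 1) ^ 2 * (Real.exp (3 - K) + (K / k) ^ B) +
        2 * B * n * (n + 1) * (Real.exp (2 - K) + Real.exp (K * k) * (1 / 2) ^ N)) := by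
  rw [ENNReal.ofReal_add (by positivity) (by positivity)]
  refine (measure_union_le _ _).trans (add_le_add ?_ ?_)
  · refine (measure_iUnion_fintype_le _ _).trans ((Finset.sum_le_card_nsmul _ _ _ fun x _ =>
      pi_missEvent_le hD hk x.1 x.2 (K := K)).trans_eq ?_)
    rw [← ENNReal.ofReal_pow (by positivity), ← ENNReal.ofReal_add (by positivity) (by positivity),
      nsmul_eq_mul, ← ENNReal.ofReal_natCast, ← ENNReal.ofReal_mul (by positivity)]
    simp only [Finset.card_univ, Fintype.card_prod, Fintype.card_fin, Fintype.card_option]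
    push_cast
    ring_nf
  · refine (measure_iUnion_fintype_le _ _).trans ((Finset.sum_le_card_nsmul _ _ _ fun x _ =>
      pi_crowdEvent_le hD hk x.1 x.2.1 x.2.2 K).trans_eq ?_)
    rw [← ENNReal.ofReal_add (by positivity) (by positivity),
      nsmul_eq_mul, ← ENNReal.ofReal_natCast, ← ENNReal.ofReal_mul (by positivity)]
    simp only [Finset.card_univ, Fintype.card_prod, Fintype.card_fin, Fintype.card_option,
      Fintype.card_bool]
    push_cast
    ring_nf

theorem pi_groupEvent_le (M : ℕ) :
    (Measure.pi fun _ : Fin B => groupLaw k D) (groupEvent n B k M) ≤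
      ENNReal.ofReal (B * (Real.exp (n / k) * (1 / 2) ^ M + Real.exp (-(n / k)))) := by
  have := fun i => (hD i).isProbabilityMeasure
  refine (measure_iUnion_fintype_le _ _).trans ((Finset.sum_le_card_nsmul _ _
    (ENNReal.ofReal (Real.exp (n / k) * (1 / 2) ^ M + Real.exp (-(n / k)))) fun b _ => ?_).trans_eq ?_)
  · have hb := measurePreserving_eval (fun _ : Fin B => groupLaw k D) b
    refine (Measure.le_map_apply hb.measurable.aemeasurable _).trans ?_
    rw [hb.map_eq, ENNReal.ofReal_add (by positivity) (by positivity)]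
    refine (measure_union_le _ _).trans ?_
    rw [groupLaw_ties hD, zero_add]
    exact (measure_union_le _ _).trans
      (add_le_add (groupLaw_thinnedCount_le hD hk M) (groupLaw_forall_not_retains_le hD hk))
  · rw [nsmul_eq_mul, Finset.card_univ, Fintype.card_fin, ← ENNReal.ofReal_natCast,
      ← ENNReal.ofReal_mul (by positivity)]

end Union

/-! ### Numerical estimates -/

section Numerical

/-- This ensures that the expected size n / L^6 of a thinned sample is at least L^2. -/
theorem log_pow_eight_le {n : ℕ} (hn : n ≠ 0) (hL : 64 ≤ Nat.log 2 n) : Nat.log 2 n ^ 8 ≤ n := by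
  have key : ∀ q : ℕ, 8 ≤ q → 8 * q + 8 ≤ 2 ^ q := by
    intro q hq
    induction q, hq using Nat.le_induction with
    | base => norm_num
    | succ q hq ih => rw [pow_succ]; omega
  set L := Nat.log 2 n
  calc L ^ 8 ≤ (2 ^ (L / 8)) ^ 8 := by
        refine Nat.pow_le_pow_left (le_trans ?_ (key (L / 8) (by omega))) 8
        omega
    _ = 2 ^ (L / 8 * 8) := by rw [← pow_mul]
    _ ≤ 2 ^ L := Nat.pow_le_pow_right two_pos (by omega)
    _ ≤ n := Nat.pow_log_le_self 2 hn

variable {L : ℝ} (hL : 64 ≤ L)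

include hL

theorem sq_le_exp : L ^ 2 ≤ Real.exp L := by
  have h1 : L / 4 ≤ Real.exp (L / 4) := by linarith [Real.add_one_le_exp (L / 4)]
  have h2 : L ≤ Real.exp (L / 4) ^ 2 := by nlinarith
  calc L ^ 2 ≤ (Real.exp (L / 4) ^ 2) ^ 2 := by gcongr
    _ = Real.exp L := by
        rw [← pow_mul, ← Real.exp_nat_mul]
        congr 1
        push_cast
        ring

/-- At most e^(3L) pairs of half-planes are available. Each group hits with probability at most 12 /
L^5 ≤ 1/e, so all L^2 of them do with probability at most e^(-L^2). -/
theorem miss_numeric {x : ℝ} (hx0 : 0 ≤ x) (hx : x + 1 ≤ Real.exp L) {B : ℕ} (hB : (B : ℝ) = L ^ 2) :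
    x * (x + 1) ^ 2 * (Real.exp (3 - 12 * L) + (12 * L / L ^ 6) ^ B) ≤ 2 * Real.exp (-(6 * L)) := by
  have h1 : x * (x + 1) ^ 2 ≤ Real.exp (3 * L) := by
    calc x * (x + 1) ^ 2 ≤ Real.exp L * Real.exp L ^ 2 := by gcongr; linarith
      _ = Real.exp (3 * L) := by
        rw [← Real.exp_nat_mul, ← Real.exp_add]
        congr 1
        push_cast
        ring
  have h2 : (12 * L / L ^ 6) ^ B ≤ Real.exp (-(9 * L)) := by
    have h3 : 12 * L / L ^ 6 ≤ Real.exp (-1) := by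
      have h4 : (1 : ℝ) / 3 ≤ Real.exp (-1) := by
        rw [Real.exp_neg, one_div]
        exact inv_anti₀ (Real.exp_pos _) (by linarith [Real.exp_one_lt_d9])
      refine le_trans ?_ h4
      have h5 : (64 : ℝ) ^ 5 ≤ L ^ 5 := by gcongr
      rw [div_le_div_iff₀ (by positivity) (by norm_num)]
      nlinarith
    calc (12 * L / L ^ 6) ^ B ≤ Real.exp (-1) ^ B := by gcongr
      _ = Real.exp (-L ^ 2) := by
        rw [← Real.exp_nat_mul, hB]
        congr 1
        ring
      _ ≤ Real.exp (-(9 * L)) := Real.exp_le_exp.2 (by nlinarith)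
  have h3 : Real.exp (3 - 12 * L) ≤ Real.exp (-(9 * L)) := Real.exp_le_exp.2 (by linarith)
  calc x * (x + 1) ^ 2 * (Real.exp (3 - 12 * L) + (12 * L / L ^ 6) ^ B)
      ≤ Real.exp (3 * L) * (Real.exp (-(9 * L)) + Real.exp (-(9 * L))) := by gcongr
    _ = 2 * Real.exp (-(6 * L)) := by
        rw [← two_mul, mul_left_comm, ← Real.exp_add]
        congr 2
        ring

/-- The threshold 36L^7 is three times the bound 12L^7 on the mean, and 36 log 2 exceeds 12, so the
Chernoff bound beats the factor e^(4L). -/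
theorem crowd_numeric {x : ℝ} (hx0 : 0 ≤ x) (hx : x + 1 ≤ Real.exp L) {N : ℕ}
    (hN : (N : ℝ) = 36 * L ^ 7) :
    2 * L ^ 2 * x * (x + 1) * (Real.exp (2 - 12 * L) + Real.exp (12 * L * L ^ 6) * (1 / 2) ^ N) ≤
      2 * Real.exp (-(6 * L)) := by
  have h0 : (2 : ℝ) ≤ Real.exp L := by linarith [Real.add_one_le_exp L]
  have h1 : 2 * L ^ 2 * x * (x + 1) ≤ Real.exp (4 * L) := by
    calc 2 * L ^ 2 * x * (x + 1) ≤ Real.exp L * Real.exp L * Real.exp L * Real.exp L := by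
          gcongr
          · exact sq_le_exp hL
          · linarith
      _ = Real.exp (4 * L) := by
        rw [← Real.exp_add, ← Real.exp_add, ← Real.exp_add]
        congr 1
        ring
  have h2 : Real.exp (12 * L * L ^ 6) * (1 / 2) ^ N ≤ Real.exp (-(10 * L)) := by
    have h3 : ((1 : ℝ) / 2) ^ N = Real.exp (-(N * Real.log 2)) := by
      rw [Real.exp_neg, mul_comm, Real.exp_mul, Real.exp_log two_pos, Real.rpow_natCast, one_div,
        inv_pow]
    rw [h3, ← Real.exp_add, hN]
    refine Real.exp_le_exp.2 ?_
    have h4 := Real.log_two_gt_d9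
    have h5 : (64 : ℝ) ^ 6 ≤ L ^ 6 := by gcongr
    have h6 : L ≤ L ^ 7 := by nlinarith
    have h7 : 0 ≤ L ^ 7 := by positivity
    nlinarith
  have h3 : Real.exp (2 - 12 * L) ≤ Real.exp (-(10 * L)) := Real.exp_le_exp.2 (by linarith)
  calc _ ≤ Real.exp (4 * L) * (Real.exp (-(10 * L)) + Real.exp (-(10 * L))) := by gcongr
    _ = 2 * Real.exp (-(6 * L)) := by
        rw [← two_mul, mul_left_comm, ← Real.exp_add]
        congr 2
        ring

/-- The mean size y of a thinned sample is at least L^2, and the cap is at least L^2 * y, far above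
the mean; emptiness has probability at most e^(-y). -/
theorem group_numeric {x : ℝ} (hx : L ^ 8 ≤ x) {M : ℕ} (hM : x / L ^ 4 ≤ M) :
    L ^ 2 * (Real.exp (x / L ^ 6) * (1 / 2) ^ M + Real.exp (-(x / L ^ 6))) ≤
      2 * Real.exp (-(6 * L)) := by
  set y := x / L ^ 6 with hy
  have hy2 : L ^ 2 ≤ y := by
    rw [hy, le_div_iff₀ (by positivity)]
    calc L ^ 2 * L ^ 6 = L ^ 8 := by ring
      _ ≤ x := hx
  have hyM : y * L ^ 2 ≤ M := by
    refine le_trans (le_of_eq ?_) hM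
    rw [hy]
    field_simp
  have h1 : Real.exp y * (1 / 2) ^ M ≤ Real.exp (-(7 * L)) := by
    have h3 : ((1 : ℝ) / 2) ^ M = Real.exp (-(M * Real.log 2)) := by
      rw [Real.exp_neg, mul_comm, Real.exp_mul, Real.exp_log two_pos, Real.rpow_natCast, one_div,
        inv_pow]
    rw [h3, ← Real.exp_add]
    refine Real.exp_le_exp.2 ?_
    have h4 := Real.log_two_gt_d9
    have h5 : (M : ℝ) * (1 / 2) ≤ M * Real.log 2 := by gcongr; linarith
    have h6 : y * 4 ≤ y * L ^ 2 := by
      have : (0 : ℝ) ≤ y := by nlinarith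
      gcongr
      nlinarith
    nlinarith
  have h2 : Real.exp (-y) ≤ Real.exp (-(7 * L)) := Real.exp_le_exp.2 (by nlinarith)
  calc _ ≤ Real.exp L * (Real.exp (-(7 * L)) + Real.exp (-(7 * L))) := by
        gcongr
        exact sq_le_exp hL
    _ = 2 * Real.exp (-(6 * L)) := by
        rw [← two_mul, mul_left_comm, ← Real.exp_add]
        congr 2
        ring

end Numerical

end CanonicalHull

namespace CanonicalHull

/-! ### The expected cost -/

section Cost

variable {n B k K N : ℕ} {τ : Fin K → ℝ} {W : Fin B → Fin n → Fin (k + 1) → ℝ × ℝ}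

theorem extremalCount_le_of_notMem_pairEvent (hn : 0 < n) (hτ : StrictMono τ)
    (hW : ∀ b, Breaks (thinned (W b)) (Set.range τ)) {P : Fin n → ℝ × ℝ}
    (hP : (W, P) ∉ pairEvent n B k N) (i : Fin (K + 1)) :
    extremalCount P (slab τ P i) ≤ B * (2 * N) := by
  classical
  have hmiss : ∀ j o, (W, P) ∉ missEvent B k j o := fun j o h =>
    hP (Or.inl (Set.mem_iUnion.2 ⟨(j, o), h⟩))
  have hcrowd : ∀ b j o, (W, P) ∉ crowdEvent B k N b j o := fun b j o h =>
    hP (Or.inr (Set.mem_iUnion.2 ⟨(b, j, o), h⟩))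
  refine extremalCount_slab_le hn hτ (X := fun b => firsts (W b))
    (A := fun b => {l | Retains (W b l)}) ?_ ?_ hW i
  · intro j o₁ o₂ h₁ h₂
    by_contra! hc
    refine hmiss j (o₁, o₂) ⟨fun l h => h.elim (h₁ l) (h₂ l), fun b => ?_⟩
    obtain ⟨l, hl, h⟩ := hc b
    by_cases h' : firsts (W b) l ∈ openHalf P j o₁ true
    · exact ⟨l, hl, Or.inl h'⟩
    · exact ⟨l, hl, Or.inr (h h')⟩
  · intro b j o σ hne hav
    by_contra! hc
    refine hcrowd b j (o, σ) ⟨hne, fun l hl => hav l hl, ?_⟩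
    rw [Nat.card_eq_fintype_card, Fintype.card_subtype] at hc
    exact hc.le

/-- Off the bad section every slab has at most 2BN extremal points; on it the trivial count n is
used. The cost is compared with a measurable bound, so its own measurability is not needed. -/
theorem lintegral_semislabCost_le (hn : 0 < n) (hτ : StrictMono τ)
    (hW : ∀ b, Breaks (thinned (W b)) (Set.range τ)) (μ : Measure (Fin n → ℝ × ℝ))
    [IsProbabilityMeasure μ] :
    ∫⁻ P, ENNReal.ofReal (semislabCost (fun i => RealRAM.dirOf (τ i)) P) ∂μ ≤
      ENNReal.ofReal (n * Real.log ((B * (2 * N) : ℕ) + 1)) +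
        ENNReal.ofReal (n * Real.log (n + 1)) * μ (Prod.mk W ⁻¹' pairEvent n B k N) := by
  classical
  set E := Prod.mk W ⁻¹' pairEvent n B k N with hE
  have hEm : MeasurableSet E := measurable_prodMk_left measurableSet_pairEvent
  calc _ ≤ ∫⁻ P, (ENNReal.ofReal (n * Real.log ((B * (2 * N) : ℕ) + 1)) +
        E.indicator (fun _ => ENNReal.ofReal (n * Real.log (n + 1))) P) ∂μ := by
        refine lintegral_mono fun P => ?_
        by_cases hP : P ∈ E
        · rw [Set.indicator_of_mem hP]
          exact le_add_left (ENNReal.ofReal_le_ofReal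
            (semislabCost_le hn hτ fun i => extremalCount_le_card P _))
        · exact le_add_right (ENNReal.ofReal_le_ofReal
            (semislabCost_le hn hτ (extremalCount_le_of_notMem_pairEvent hn hτ hW hP)))
    _ = _ := by
        rw [lintegral_add_left measurable_const, lintegral_const, measure_univ, mul_one,
          lintegral_indicator_const hEm]

end Cost

/-! ### The probability of failure -/

/-- Since log 2 < 1, rounding the logarithm down is made up for by passing from base 2 to base e: (L
+ 1) log 2 ≤ L. -/
theorem add_one_le_exp_log {n : ℕ} (hL : 64 ≤ Nat.log 2 n) :
    (n : ℝ) + 1 ≤ Real.exp (Nat.log 2 n) := by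
  have h1 : n + 1 ≤ 2 ^ (Nat.log 2 n + 1) := Nat.lt_pow_succ_log_self one_lt_two n
  have h2 : (n : ℝ) + 1 ≤ 2 ^ (Nat.log 2 n + 1) := by exact_mod_cast h1
  refine h2.trans ?_
  rw [← Real.exp_log (two_pos : (0 : ℝ) < 2), ← Real.exp_nat_mul]
  refine Real.exp_le_exp.2 ?_
  have h3 : (64 : ℝ) ≤ Nat.log 2 n := by exact_mod_cast hL
  push_cast
  nlinarith [Real.log_two_lt_d9]

theorem pi_failure_le {n : ℕ} (hn : 0 < n) (hL : 64 ≤ Nat.log 2 n) {D : Fin n → Measure (ℝ × ℝ)}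
    (hD : ∀ i, IsContinuousDistribution (D i)) :
    (Measure.pi fun _ : Fin (Nat.log 2 n ^ 2 * (Nat.log 2 n ^ 6 + 1)) => Measure.pi D)
      {S | (fun b => group S b) ∈ groupEvent n (Nat.log 2 n ^ 2) (Nat.log 2 n ^ 6)
          (numDirections n / Nat.log 2 n ^ 2 + 1) ∨
        ENNReal.ofReal (1 / n) < Measure.pi D (Prod.mk (fun b => group S b) ⁻¹'
          pairEvent n (Nat.log 2 n ^ 2) (Nat.log 2 n ^ 6) (36 * Nat.log 2 n ^ 7))} ≤
      ENNReal.ofReal (1 / (n : ℝ) ^ 4) := by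
  have := fun i => (hD i).isProbabilityMeasure
  have hpow := log_pow_eight_le hn.ne' hL
  have hexp := add_one_le_exp_log hL
  have hL' : (64 : ℝ) ≤ (Nat.log 2 n : ℕ) := by exact_mod_cast hL
  have hmp := measurePreserving_group (B := Nat.log 2 n ^ 2) (k := Nat.log 2 n ^ 6) D
  have hM : (n : ℝ) / (Nat.log 2 n : ℕ) ^ 4 ≤ ((numDirections n / Nat.log 2 n ^ 2 + 1 : ℕ) : ℝ) := by
    rw [numDirections, Nat.div_div_eq_div_mul, ← pow_add]
    rw [div_le_iff₀ (by positivity)]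
    have h1 := Nat.lt_mul_div_succ n (b := Nat.log 2 n ^ (2 + 2)) (by positivity)
    have h2 : n ≤ (n / Nat.log 2 n ^ (2 + 2) + 1) * Nat.log 2 n ^ 4 := by
      rw [mul_comm]; exact h1.le
    exact_mod_cast h2
  generalize hLL : Nat.log 2 n = L at *
  set W := Measure.pi fun _ : Fin (L ^ 2) => groupLaw (L ^ 6) D with hW
  set M := numDirections n / L ^ 2 + 1 with hMM
  have hk : 0 < L ^ 6 := by positivity
  set G := groupEvent n (L ^ 2) (L ^ 6) M with hG
  set E := pairEvent n (L ^ 2) (L ^ 6) (36 * L ^ 7) with hE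
  have hn' : (0 : ℝ) < n := by exact_mod_cast hn
  have hGle : W G ≤ ENNReal.ofReal (2 * Real.exp (-(6 * L))) := by
    refine (pi_groupEvent_le hD hk M).trans (ENNReal.ofReal_le_ofReal ?_)
    push_cast
    exact group_numeric hL' (by exact_mod_cast hpow) (by exact_mod_cast hM)
  have hEle : (W.prod (Measure.pi D)) E ≤ ENNReal.ofReal (4 * Real.exp (-(6 * L))) := by
    refine (pi_pairEvent_le hD hk (K := 12 * L) (by positivity)).trans
      (ENNReal.ofReal_le_ofReal ?_)
    have h1 := miss_numeric hL' hn'.le hexp (B := L ^ 2) (by push_cast; rfl)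
    have h2 := crowd_numeric hL' hn'.le hexp (N := 36 * L ^ 7) (by push_cast; rfl)
    push_cast
    linarith
  -- Markov's inequality over the samples: the threshold 1/n costs a factor n.
  have hT : W {w | ENNReal.ofReal (1 / n) < Measure.pi D (Prod.mk w ⁻¹' E)} ≤
      ENNReal.ofReal (4 * Real.exp (-(6 * L)) * n) := by
    refine (measure_section_gt_le measurableSet_pairEvent (by simpa using hn.ne')
      ENNReal.ofReal_ne_top).trans ?_
    refine (ENNReal.div_le_div_right hEle _).trans_eq ?_
    rw [← ENNReal.ofReal_div_of_pos (by positivity), one_div, div_inv_eq_mul]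
  calc _ ≤ W (G ∪ {w | ENNReal.ofReal (1 / n) < Measure.pi D (Prod.mk w ⁻¹' E)}) := by
        -- This inequality holds for arbitrary sets, so the failure event need not be shown
        -- measurable.
        have h1 := Measure.le_map_apply (μ := Measure.pi fun _ : Fin (L ^ 2 * (L ^ 6 + 1)) =>
          Measure.pi D) hmp.measurable.aemeasurable
          (G ∪ {w | ENNReal.ofReal (1 / n) < Measure.pi D (Prod.mk w ⁻¹' E)})
        rw [hmp.map_eq] at h1
        exact h1
    _ ≤ ENNReal.ofReal (2 * Real.exp (-(6 * L))) + ENNReal.ofReal (4 * Real.exp (-(6 * L)) * n) :=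
        (measure_union_le _ _).trans (add_le_add hGle hT)
    _ ≤ ENNReal.ofReal (1 / (n : ℝ) ^ 4) := by
        rw [← ENNReal.ofReal_add (by positivity) (by positivity)]
        refine ENNReal.ofReal_le_ofReal ?_
        rw [le_div_iff₀ (by positivity)]
        have h1 : (n : ℝ) ≤ Real.exp L := by linarith
        have h0 : (64 : ℝ) ≤ Real.exp L := by linarith [Real.add_one_le_exp (L : ℝ)]
        -- With n ≤ e^L, the factors n and n^4 use up e^(5L) of the e^(-6L), leaving 6 e^(-L) ≤ 1.
        calc (2 * Real.exp (-(6 * L)) + 4 * Real.exp (-(6 * L)) * n) * (n : ℝ) ^ 4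
            ≤ (2 * Real.exp (-(6 * L)) + 4 * Real.exp (-(6 * L)) * Real.exp L) *
              Real.exp L ^ 4 := by gcongr
          _ ≤ (6 * Real.exp (-(6 * L)) * Real.exp L) * Real.exp L ^ 4 := by
              gcongr
              nlinarith [Real.exp_pos (-(6 * (L : ℝ)))]
          _ = 6 * (Real.exp L)⁻¹ := by
              rw [Real.exp_neg, mul_comm (6 : ℝ) (L : ℝ), Real.exp_mul]
              have : Real.exp (L : ℝ) ≠ 0 := (Real.exp_pos _).ne'
              have h6 : Real.exp (L : ℝ) ^ (6 : ℝ) = Real.exp L ^ 6 := by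
                rw [← Real.rpow_natCast]; norm_num
              rw [h6]
              field_simp
          _ ≤ 1 := by
              rw [← div_eq_mul_inv, div_le_one (by positivity)]
              linarith

/-- The cost of the output, outside of an unlikely event. -/
theorem lintegral_semislabCost_le_of_group {n : ℕ} (hn : 2 ≤ n) {K : ℕ} {τ : Fin K → ℝ}
    (hτ : StrictMono τ) {S : Fin (Nat.log 2 n ^ 2 * (Nat.log 2 n ^ 6 + 1)) → Fin n → ℝ × ℝ}
    (hout : (∀ b i j, i ≠ j → (group S b i 0).1 ≠ (group S b j 0).1) →
      ∑ b, thinnedCount (group S b) ≤ numDirections n →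
        ∀ b, (thinned (group S b)).Nonempty → Breaks (thinned (group S b)) (Set.range τ))
    {D : Fin n → Measure (ℝ × ℝ)} [∀ i, IsProbabilityMeasure (D i)]
    (hS : ¬ ((fun b => group S b) ∈ groupEvent n (Nat.log 2 n ^ 2) (Nat.log 2 n ^ 6)
          (numDirections n / Nat.log 2 n ^ 2 + 1) ∨
        ENNReal.ofReal (1 / n) < Measure.pi D (Prod.mk (fun b => group S b) ⁻¹'
          pairEvent n (Nat.log 2 n ^ 2) (Nat.log 2 n ^ 6) (36 * Nat.log 2 n ^ 7)))) :
    ∫⁻ P, ENNReal.ofReal (semislabCost (fun i => RealRAM.dirOf (τ i)) P) ∂(Measure.pi D) ≤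
      ENNReal.ofReal (n * Real.log ((Nat.log 2 n ^ 2 * (2 * (36 * Nat.log 2 n ^ 7)) : ℕ) + 1) +
        Real.log (n + 1)) := by
  rw [not_or, not_lt] at hS
  obtain ⟨hG, hE⟩ := hS
  have hG' : ∀ b, (¬ ∃ i j, i ≠ j ∧ (group S b i 0).1 = (group S b j 0).1) ∧
      ¬ (numDirections n / Nat.log 2 n ^ 2 + 1 ≤ thinnedCount (group S b)) ∧
      ¬ ∀ l, ¬ Retains (group S b l) := by
    intro b
    have h : ¬ (_ ∨ _ ∨ _) := fun h => hG (Set.mem_iUnion.2 ⟨b, h⟩)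
    rwa [not_or, not_or] at h
  have hW : ∀ b, Breaks (thinned (group S b)) (Set.range τ) := by
    intro b
    refine hout (fun b i j hij h => (hG' b).1 ⟨i, j, hij, h⟩) ?_ b ?_
    -- Each of the L^2 thinned samples stays within its share of the available directions, so no
    -- slope is cut off in the output.
    · refine (Finset.sum_le_card_nsmul _ _ (numDirections n / Nat.log 2 n ^ 2) fun b _ => ?_).trans ?_
      · have := (hG' b).2.1
        omega
      · rw [Finset.card_univ, Fintype.card_fin, smul_eq_mul]
        exact Nat.mul_div_le _ _
    · have := (hG' b).2.2
      push Not at this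
      obtain ⟨l, hl⟩ := this
      exact ⟨_, l, hl, rfl⟩
  refine (lintegral_semislabCost_le (N := 36 * Nat.log 2 n ^ 7) (by omega) hτ hW _).trans ?_
  have hn' : (0 : ℝ) < n := by exact_mod_cast (by omega : 0 < n)
  have hlog : 0 ≤ Real.log ((n : ℝ) + 1) := Real.log_nonneg (by linarith)
  rw [ENNReal.ofReal_add (mul_nonneg hn'.le
    (Real.log_nonneg (le_add_of_nonneg_left (Nat.cast_nonneg _)))) hlog]
  gcongr
  refine (mul_le_mul_right hE _).trans_eq ?_
  rw [← ENNReal.ofReal_mul (mul_nonneg hn'.le hlog)]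
  congr 1
  field_simp

end CanonicalHull

/-! ### Final numerical bounds and assembly -/

namespace CanonicalHull

theorem log_two_le_two_mul_log {n : ℕ} (hn : n ≠ 0) :
    ((Nat.log 2 n : ℕ) : ℝ) ≤ 2 * Real.log n := by
  have h1 : ((2 : ℝ) ^ Nat.log 2 n) ≤ n := by exact_mod_cast Nat.pow_log_le_self 2 hn
  have h2 := Real.log_le_log (by positivity) h1
  rw [Real.log_pow] at h2
  have h3 : ((Nat.log 2 n : ℕ) : ℝ) * (1 / 2) ≤ (Nat.log 2 n : ℕ) * Real.log 2 := by
    gcongr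
    linarith [Real.log_two_gt_d9]
  linarith

/-- The polylogarithmic bound is below L^11, and log L ≤ 2 log log n, which gives 22; the bad
event's log(n + 1) fits into the remaining 2. -/
theorem cost_numeric {n : ℕ} (hn : n ≠ 0) (hL : 64 ≤ Nat.log 2 n) :
    n * Real.log ((Nat.log 2 n ^ 2 * (2 * (36 * Nat.log 2 n ^ 7)) : ℕ) + 1) + Real.log (n + 1) ≤
      24 * (n * Real.log (Real.log n)) := by
  have hL' : (64 : ℝ) ≤ (Nat.log 2 n : ℕ) := by exact_mod_cast hL
  have hle := log_two_le_two_mul_log hn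
  have hn' : (0 : ℝ) < n := by exact_mod_cast Nat.pos_of_ne_zero hn
  push_cast
  generalize ((Nat.log 2 n : ℕ) : ℝ) = L at *
  have hll : Real.log 2 ≤ Real.log (Real.log n) := Real.log_le_log two_pos (by linarith)
  have hlogL : Real.log L ≤ 2 * Real.log (Real.log n) := by
    have := Real.log_le_log (by linarith) hle
    rw [Real.log_mul two_ne_zero (by linarith)] at this
    linarith
  have h1 : Real.log (L ^ 2 * (2 * (36 * L ^ 7)) + 1) ≤ 11 * Real.log L := by
    have h2 : L ^ 2 * (2 * (36 * L ^ 7)) + 1 ≤ L ^ 11 := by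
      have h3 : 1 ≤ L ^ 9 := one_le_pow₀ (by linarith)
      have h4 : (64 : ℝ) ^ 2 ≤ L ^ 2 := by gcongr
      calc L ^ 2 * (2 * (36 * L ^ 7)) + 1 ≤ 73 * L ^ 9 := by
            have : L ^ 2 * (2 * (36 * L ^ 7)) = 72 * L ^ 9 := by ring
            linarith
        _ ≤ L ^ 2 * L ^ 9 := by gcongr; linarith
        _ = L ^ 11 := by ring
    refine (Real.log_le_log (by positivity) h2).trans_eq ?_
    rw [Real.log_pow]
    norm_num
  have h2 : Real.log ((n : ℝ) + 1) ≤ n * (2 * Real.log (Real.log n)) := by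
    have h3 := Real.log_le_sub_one_of_pos (by linarith : (0 : ℝ) < n + 1)
    have h4 : (n : ℝ) * 1 ≤ n * (2 * Real.log (Real.log n)) := by
      gcongr
      linarith [Real.log_two_gt_d9]
    linarith
  have h3 : Real.log (L ^ 2 * (2 * (36 * L ^ 7)) + 1) ≤ 11 * (2 * Real.log (Real.log n)) := by
    linarith
  calc _ ≤ n * (11 * (2 * Real.log (Real.log n))) + n * (2 * Real.log (Real.log n)) := by
        exact add_le_add (mul_le_mul_of_nonneg_left h3 hn'.le) h2
    _ = 24 * (n * Real.log (Real.log n)) := by ring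

end CanonicalHull

theorem mainTheorem6 :
    ∃ (prog : RealRAM.Prog) (m : ℕ → ℕ) (c : ℕ) (C : ℝ),
      ∀ n : ℕ, 3 ≤ n →
        (m n : ℝ) ≤ C * Real.log n ^ c ∧
        ∃ V : (Fin (m n) → Fin n → ℝ × ℝ) → Fin (CanonicalHull.numDirections n) → ℝ × ℝ,
          (∀ S : Fin (m n) → Fin n → ℝ × ℝ,
            RealRAM.OutputsWithin prog S (V S) (C * n * Real.log n ^ c) ∧
            CanonicalHull.IsDirectionSequence (V S)) ∧
          ∀ D : Fin n → Measure (ℝ × ℝ),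
            (∀ i, CanonicalHull.IsContinuousDistribution (D i)) →
              Measure.pi (fun _ : Fin (m n) => Measure.pi D)
                {S | ¬ ∫⁻ P, ENNReal.ofReal (CanonicalHull.semislabCost (V S) P) ∂(Measure.pi D)
                  ≤ ENNReal.ofReal (C * (n * Real.log (Real.log n)))}
                ≤ ENNReal.ofReal (1 / (n : ℝ) ^ 4) := by
  have hlog3 : 0 < Real.log (Real.log 3) := by
    refine Real.log_pos ?_
    rw [Real.lt_log_iff_exp_lt (by norm_num)]
    linarith [Real.exp_one_lt_d9]
  have hc0 : 0 ≤ 64 / Real.log (Real.log 3) := by positivity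
  refine ⟨RealRAM.mainProg, fun n => Nat.log 2 n ^ 2 * (Nat.log 2 n ^ 6 + 1), 8,
    -- 256000 = 1000 * 2^8 converts the running time from L ≤ 2 log n; the second summand covers the
    -- cost for small n, where log log n may be close to zero.
    256000 + 64 / Real.log (Real.log 3), fun n hn => ?_⟩
  have hn0 : n ≠ 0 := by omega
  have hnR : (3 : ℝ) ≤ n := by exact_mod_cast hn
  have hlog1 : Real.log 3 ≤ Real.log n := Real.log_le_log (by norm_num) hnR
  have hlog3' : 1 < Real.log 3 := by
    rw [Real.lt_log_iff_exp_lt (by norm_num)]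
    linarith [Real.exp_one_lt_d9]
  have hL := CanonicalHull.log_two_le_two_mul_log hn0
  have hL1 : (1 : ℝ) ≤ (Nat.log 2 n : ℕ) := by
    exact_mod_cast Nat.log_pos one_lt_two (by omega : 2 ≤ n)
  have hL8 : ((Nat.log 2 n : ℕ) : ℝ) ^ 8 ≤ 256 * Real.log n ^ 8 := by
    calc ((Nat.log 2 n : ℕ) : ℝ) ^ 8 ≤ (2 * Real.log n) ^ 8 := by gcongr
      _ = 256 * Real.log n ^ 8 := by ring
  have hlogpos : 0 ≤ Real.log n ^ 8 := by positivity
  refine ⟨?_, ?_⟩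
  · push_cast
    have h1 : ((Nat.log 2 n : ℕ) : ℝ) ^ 2 ≤ (Nat.log 2 n : ℕ) ^ 8 :=
      pow_le_pow_right₀ hL1 (by norm_num)
    calc ((Nat.log 2 n : ℕ) : ℝ) ^ 2 * ((Nat.log 2 n : ℕ) ^ 6 + 1)
        = (Nat.log 2 n : ℕ) ^ 8 + (Nat.log 2 n : ℕ) ^ 2 := by ring
      _ ≤ 512 * Real.log n ^ 8 := by linarith
      _ ≤ _ := by gcongr; linarith
  choose τ hτ hout hbr using CanonicalHull.exists_output (n := n) (by omega)
  refine ⟨fun S i => RealRAM.dirOf (τ S i), fun S => ⟨?_,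
    CanonicalHull.isDirectionSequence_dirOf (hτ S)⟩, fun D hD => ?_⟩
  · obtain ⟨s, t, he, ht, hk, hv⟩ := hout S
    refine ⟨s, t, he, ht.trans ?_, hk, hv⟩
    have h1 : (RealRAM.mainTime n : ℝ) ≤ 1000 * (n * (Nat.log 2 n : ℕ) ^ 8) := by
      exact_mod_cast RealRAM.mainTime_le (n := n) (by omega)
    calc (RealRAM.mainTime n : ℝ) ≤ 1000 * (n * (256 * Real.log n ^ 8)) := h1.trans (by gcongr)
      _ = 256000 * n * Real.log n ^ 8 := by ring
      _ ≤ _ := by gcongr; linarith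
  · have := fun i => (hD i).isProbabilityMeasure
    have hll : Real.log (Real.log 3) ≤ Real.log (Real.log n) :=
      Real.log_le_log (by linarith) hlog1
    have hnll : 0 ≤ n * Real.log (Real.log n) := mul_nonneg (by linarith) (hlog3.le.trans hll)
    -- For n < 2^64 the trivial bound n log(n + 1) ≤ 64n holds for every input, so the failure set
    -- is empty.
    rcases lt_or_ge (Nat.log 2 n) 64 with hsmall | hlarge
    · refine le_of_eq_of_le ?_ zero_le
      rw [← nonpos_iff_eq_zero, ← measure_empty (μ := Measure.pi fun _ :
        Fin (Nat.log 2 n ^ 2 * (Nat.log 2 n ^ 6 + 1)) => Measure.pi D)]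
      refine measure_mono fun S hS => hS ?_
      calc ∫⁻ P, ENNReal.ofReal (CanonicalHull.semislabCost _ P) ∂(Measure.pi D)
          ≤ ∫⁻ _, ENNReal.ofReal (n * Real.log (n + 1)) ∂(Measure.pi D) := by
            exact lintegral_mono fun P => ENNReal.ofReal_le_ofReal
              (CanonicalHull.semislabCost_le (by omega) (hτ S)
                fun i => CanonicalHull.extremalCount_le_card P _)
        _ = ENNReal.ofReal (n * Real.log (n + 1)) := by simp
        _ ≤ _ := by
            refine ENNReal.ofReal_le_ofReal ?_
            have h1 : n + 1 ≤ 2 ^ 64 :=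
              (Nat.lt_pow_succ_log_self one_lt_two n : n < _).trans_le
                (Nat.pow_le_pow_right two_pos (by omega))
            have h2 : Real.log ((n : ℝ) + 1) ≤ 64 := by
              have h3 : (n : ℝ) + 1 ≤ 2 ^ 64 := by exact_mod_cast h1
              refine (Real.log_le_log (by linarith) h3).trans ?_
              rw [Real.log_pow]
              norm_num
              linarith [Real.log_two_lt_d9]
            calc (n : ℝ) * Real.log (n + 1) ≤ n * 64 := by gcongr
              _ = 64 / Real.log (Real.log 3) * (n * Real.log (Real.log 3)) := by
                  field_simp
              _ ≤ 64 / Real.log (Real.log 3) * (n * Real.log (Real.log n)) := by gcongr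
              _ ≤ _ := by gcongr; linarith
    · refine (measure_mono fun S hS => ?_).trans
        (CanonicalHull.pi_failure_le (by omega) hlarge hD)
      by_contra hgood
      refine hS ((CanonicalHull.lintegral_semislabCost_le_of_group (by omega) (hτ S) (hbr S)
        hgood).trans (ENNReal.ofReal_le_ofReal
          ((CanonicalHull.cost_numeric hn0 hlarge).trans ?_)))
      gcongr
      linarith
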